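/- Let $\mathbf T^2=\mathbf R^2/\mathbf Z^2$ and $\mathbf S^1$ be the unit circle with arc length $d\omega$; let $R[\theta]$ denote the rotation of an angle $\theta$, and set $\theta(h)=\pi-2\arcsin h$ for $h\in[-1,1]$. For $S>0$ and $h,h'\in[-1,1]$ with $h\neq h'$, put $\zeta=\tfrac12|h+h'|$, $\eta=\tfrac12|h-h'|$ and $$ \begin{aligned} P(S,h|h')=\frac{3}{\pi^2S\eta}\Bigl(&(S\eta)\wedge(1-S)_+ +(\eta S-|1-S|)_+\\ &+\bigl((S-\tfrac12S\eta)\wedge(1+\tfrac12S\eta)-(\tfrac12S+\tfrac12S\zeta)\vee1\bigr)_+\\ &+\bigl((S-\tfrac12S\eta)\wedge1-(\tfrac12S+\tfrac12S\zeta)\vee(1-\tfrac12S\eta)\bigr)_+\Bigr), \end{aligned} $$ where $a\wedge b=\min(a,b)$, $a\vee b=\max(a,b)$, $a_+=\max(a,0)$, and let $$E(s,h)=\int_{2s}^{\infty}\int_{-1}^1P(\tau,h|h')\,dh'\,d\tau .$$ Let $f^{in}\in L^\infty(\mathbf T^2\times\mathbf S^1)$ satisfy $f^{in}\ge0$ a.e.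 Consider, for $t\ge 0$ and $(x,\omega,s,h)\in\mathbf T^2\times\mathbf S^1\times\mathbf R_+\times[-1,1]$, the Cauchy problem $$ \left\{\begin{aligned} &(\partial_t+\omega\cdot\nabla_x-\partial_s)F(t,x,\omega,s,h)=\int_{-1}^12P(2s,h|h')\,F(t,x,R[\theta(h')]\omega,0,h')\,dh',\\ &F(0,x,\omega,s,h)=f^{in}(x,\omega)\,E(s,h). \end{aligned}\right. $$ A solution is a function $F$ such that $F(t,\cdot)\in L^1(\mathbf T^2\times\mathbf S^1\times\mathbf R_+\times[-1,1])$ for every $t\ge0$, such that its trace $F(t,x,\omega,0,h)$ is integrable on $[0,T]\times\mathbf T^2\times\mathbf S^1\times[-1,1]$ for every $T\ge0$, and such that the equation holds integrated along characteristics: for a.e. $(y,\omega,\sigma,h)\in\mathbf T^2\times\mathbf S^1\times\mathbf R_+\times[-1,1]$ and all $t\in[0,\sigma]$, $$ F(t,y+t\omega,\omega,\sigma-t,h)=f^{in}(y,\omega)E(\sigma,h)+\int_0^t\int_{-1}^12P(2(\sigma-\tau),h|h')\,F(\tau,y+\tau\omega,R[\theta(h')]\omega,0,h')\,dh'\,d\tau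 . $$ Then there exists a solution $F$; any two solutions coincide a.e. in $(x,\omega,s,h)$ for each $t\ge0$; and the solution satisfies, as $t\to+\infty$, $$ F(t,\cdot,\cdot,\cdot,\cdot)\rightharpoonup C\,E\quad\text{in }L^\infty(\mathbf T^2\times\mathbf S^1\times\mathbf R_+\times[-1,1])\ \text{weak-*},\qquad C=\frac1{2\pi}\iint_{\mathbf T^2\times\mathbf S^1}f^{in}(x,\omega)\,dx\,d\omega . $$ That is, $F(t,\cdot)\in L^\infty$ for each $t\ge0$, $E\in L^\infty$, and for every $\varphi\in L^1(\mathbf T^2\times\mathbf S^1\times\mathbf R_+\times[-1,1])$ the integral of $F(t,\cdot)\,\varphi$ over $\mathbf T^2\times\mathbf S^1\times\mathbf R_+\times[-1,1]$ converges to that of $CE\varphi$. -/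

import Mathlib

open MeasureTheory Filter Set
open scoped Topology ENNReal

noncomputable section

namespace LorentzGas

/-- The flat torus `ℝ² / ℤ²`; its `volume` is Lebesgue measure, of total mass `1`. -/
abbrev T2 : Type := Fin 2 → AddCircle (1 : ℝ)

/-- The unit circle `𝐒¹`, parametrized by the polar angle `φ ∈ ℝ / 2πℤ` of the unit vector
`ω = (cos φ, sin φ)`; its `volume` is the arc length, of total mass `2π`. The rotation `R[θ]` of an
angle `θ` is `φ ↦ φ + θ`. -/
abbrev S1 : Type := AddCircle (2 * Real.pi)

instance factTwoPiPos : Fact (0 < 2 * Real.pi) := ⟨Real.two_pi_pos⟩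

/-- The unit vector `(cos φ, sin φ)` with polar angle `φ`. -/
def dir (ω : S1) : Fin 2 → ℝ :=
  ![Real.cos_periodic.lift ω, Real.sin_periodic.lift ω]

/-- Free motion on the torus: `x + t ω`. -/
def move (x : T2) (t : ℝ) (ω : S1) : T2 :=
  fun i => x i + ((t * dir ω i : ℝ) : AddCircle (1 : ℝ))

/-- The deflection angle `θ(h) = π - 2 arcsin h`. -/
def deflection (h : ℝ) : ℝ := Real.pi - 2 * Real.arcsin h

/-- The rotated direction `R[θ(h)] ω`. -/
def deflect (h : ℝ) (ω : S1) : S1 := ω + ((deflection h : ℝ) : S1)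

/-- The transition probability density `P(S, h | h')`
(with `ζ = |h + h'| / 2`, `η = |h - h'| / 2`, and `max a 0` for the positive part of `a`). -/
def P (S h h' : ℝ) : ℝ :=
  let ζ : ℝ := |h + h'| / 2
  let η : ℝ := |h - h'| / 2
  3 / (Real.pi ^ 2 * S * η) *
    (min (S * η) (max (1 - S) 0)
      + max (η * S - |1 - S|) 0
      + max (min (S - S * η / 2) (1 + S * η / 2) - max (S / 2 + S * ζ / 2) 1) 0
      + max (min (S - S * η / 2) 1 - max (S / 2 + S * ζ / 2) (1 - S * η / 2)) 0)

/-- The equilibrium `E(s, h) = ∫_{2s}^∞ ∫_{-1}^1 P(τ, h | h') dh' dτ`. -/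
def E (s h : ℝ) : ℝ :=
  ∫ τ in Ioi (2 * s), ∫ h' in Icc (-1 : ℝ) 1, P τ h h'

/-- The extended phase space, with points `(x, ω, s, h)`; the relevant values of `(s, h)` are those
in `[0, ∞) × [-1, 1]`, which carries the measure `phaseMeasure`. -/
abbrev Phase : Type := T2 × S1 × ℝ × ℝ

/-- The measure `dx dω ds dh` on `𝐓² × 𝐒¹ × [0, ∞) × [-1, 1]`. -/
def phaseMeasure : Measure Phase :=
  (volume : Measure T2).prod ((volume : Measure S1).prod
    ((volume.restrict (Ici (0 : ℝ))).prod (volume.restrict (Icc (-1 : ℝ) 1))))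

/-- The measure `dt dx dω dh` on `[0, T] × 𝐓² × 𝐒¹ × [-1, 1]`. -/
def traceMeasure (T : ℝ) : Measure (ℝ × T2 × S1 × ℝ) :=
  (volume.restrict (Icc (0 : ℝ) T)).prod
    ((volume : Measure T2).prod ((volume : Measure S1).prod (volume.restrict (Icc (-1 : ℝ) 1))))

/-- `F = F(t, x, ω, s, h)` is an `L¹` solution, for `t ≥ 0`, of the Cauchy problem

`(∂_t + ω·∇_x - ∂_s) F(t,x,ω,s,h) = ∫_{-1}^1 2 P(2s,h|h') F(t,x,R[θ(h')]ω,0,h') dh'`,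
`F(0,x,ω,s,h) = fin(x,ω) E(s,h)`

on `𝐓² × 𝐒¹ × [0, ∞) × [-1, 1]`, in the sense of integration along characteristics (mild solution).
The characteristic curve of `∂_t + ω·∇_x - ∂_s` that starts at time `0` from `(y, ω, σ, h)` is
`t ↦ (y + t ω, ω, σ - t, h)`; it reaches the boundary `s = 0` at the time `t = σ`. On almost every
such curve the equation, integrated from `0` to `t`, holds for every `t ∈ [0, σ]`. In particular
`F(·, ·, ·, 0, ·)` is the trace of `F` on the boundary `s = 0`. -/
structure IsSolution (fin : T2 × S1 → ℝ) (F : ℝ → Phase → ℝ) : Prop where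
  integrable : ∀ t : ℝ, 0 ≤ t → Integrable (F t) phaseMeasure
  trace_integrable : ∀ T : ℝ, 0 ≤ T →
    Integrable (fun z : ℝ × T2 × S1 × ℝ => F z.1 (z.2.1, z.2.2.1, 0, z.2.2.2)) (traceMeasure T)
  characteristics : ∀ᵐ z ∂phaseMeasure, ∀ t ∈ Icc (0 : ℝ) z.2.2.1,
    F t (move z.1 t z.2.1, z.2.1, z.2.2.1 - t, z.2.2.2) =
      fin (z.1, z.2.1) * E z.2.2.1 z.2.2.2 +
        ∫ τ in Icc (0 : ℝ) t, ∫ h' in Icc (-1 : ℝ) 1,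
          2 * P (2 * (z.2.2.1 - τ)) z.2.2.2 h' *
            F τ (move z.1 τ z.2.1, deflect h' z.2.1, 0, h')

/-- Weak-* convergence in `L^∞(μ)`, the dual of `L¹(μ)`, as `t → ∞`, of a family `u t`, `t ≥ 0`, of
elements of `L^∞(μ)` to an element `v` of `L^∞(μ)`. -/
def TendstoWeakStar {α : Type*} [MeasurableSpace α] (μ : Measure α)
    (u : ℝ → α → ℝ) (v : α → ℝ) : Prop :=
  (∀ t : ℝ, 0 ≤ t → MemLp (u t) ∞ μ) ∧ MemLp v ∞ μ ∧
    ∀ φ : α → ℝ, Integrable φ μ →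
      Tendsto (fun t : ℝ => ∫ z, u t z * φ z ∂μ) atTop (𝓝 (∫ z, v z * φ z ∂μ))

end LorentzGas

end

/-!
The unknown is determined by its trace `g` on `s = 0`: integrating the equation along the backward
characteristics gives `F(t, y, s, h) = F(0, y - tω, s + t, h) + gain`, where the gain is a positive
linear functional of `g` on `(0, t)` (`evolve`), and at `s = 0` this is a Volterra equation for `g`
(`IsTrace`). All solutions are built from nonnegative functions with values in `ℝ≥0∞`; the trace is
the increasing limit of the Picard iterates (`minTrace`).

Three facts about the kernel carry the proof. First, for `h ≠ h'` one has
`2 P(2s, h | h') = (6 / π²) min(1, (1/s - p)₊ / (q - p))` with `p = 1 + ζ - η`, `q = 1 + ζ + η`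
(`two_mul_P_eq`), so the kernel is symmetric, at most `1`, and at least `1/2` for `s ≤ 1/2`. Second,
`∫∫ 2 P(2s, h | h') ds dh' = 1` (`lintegral_lintegral_kernel`), which by the symmetry says both that
`E` is a stationary solution, with trace `1`, and that mass is conserved (`lintegral_evolve`); the
integral over `s` is a logarithmic quotient, and the remaining integral over `h'` is evaluated by a
dilogarithm identity (`integral_logQuot_add_integral_logQuot`). Third, `E` has finite mass
(`lintegral_tail_lt_top`). Comparison with the stationary solution `M E` bounds the solution.

Uniqueness follows from a Gronwall argument for the trace of the difference of two solutions, as the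
kernel is bounded (`ae_eq_zero_of_le_incoming`).

Convergence is a coupling argument. Let `m(t)` be the integral of `min (F(t), C E)`. The common part
`min (F(t), C E)`, evolved on its own, stays below both `F` and `C E`, so `m` is nondecreasing. The
two remainders have the same mass, namely the total mass minus `m(t)`, and after a fixed time `T`
both lie above a constant on the set `s < 1/4`, by a Doeblin condition (`exists_le_evolve`): the
constant is proportional to the part of the mass with `s < L`, and what lies outside is small
because it is bounded by the tail of `M E`. Hence `m` grows by a fixed amount during each time `T`
until it is close to the total mass (`BoundedEvolution.tendsto_overlap`). So `F(t) → C E` in `L¹`,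
and since `F(t)` is bounded, also weak-* in `L^∞`.

The Doeblin condition comes from three flights in directions at angles of about `2π/3`. Their total
time and total displacement are an invertible linear function of the three durations, so that three
flights spread a particle over a box in time and space (`lintegral_three_flights`), whatever the
final direction (`le_flightStep_three`). Repeating this covers the torus and any bounded interval of
times (`exists_le_flightStep_iterate`).
-/

noncomputable section

namespace LorentzGas

/-! ### A dilogarithm identity -/

/-- The function `y ↦ log y / (y - 1)`, extended by continuity at `y = 1`. -/
def logQuot : ℝ → ℝ := dslope Real.log 1

lemma logQuot_of_ne {y : ℝ} (h : y ≠ 1) : logQuot y = Real.log y / (y - 1) := by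
  rw [logQuot, dslope_of_ne _ h, slope_def_field, Real.log_one, sub_zero]

lemma continuousOn_logQuot : ContinuousOn logQuot (Ioi 0) := by
  rw [logQuot, continuousOn_dslope (Ioi_mem_nhds one_pos)]
  exact ⟨Real.continuousOn_log.mono fun x hx => (ne_of_gt hx),
    Real.differentiableAt_log one_ne_zero⟩

lemma intervalIntegrable_logQuot {a b : ℝ} (ha : 0 < a) (hb : 0 < b) :
    IntervalIntegrable logQuot volume a b :=
  (continuousOn_logQuot.mono fun _ hx => lt_of_lt_of_le (lt_min ha hb) hx.1).intervalIntegrable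

lemma logQuot_nonneg {y : ℝ} (hy : 0 < y) : 0 ≤ logQuot y := by
  rcases eq_or_ne y 1 with rfl | h
  · simp [logQuot]
  · rw [logQuot_of_ne h]
    rcases le_or_gt 1 y with h1 | h1
    · exact div_nonneg (Real.log_nonneg h1) (by linarith)
    · exact div_nonneg_of_nonpos (Real.log_nonpos hy.le h1.le) (by linarith)

lemma hasSum_alternating_inv_sq :
    HasSum (fun n : ℕ => (-1 : ℝ) ^ n / ((n : ℝ) + 1) ^ 2) (Real.pi ^ 2 / 12) := by
  have h1 := hasSum_zeta_two
  have he : HasSum (fun n : ℕ => if Even n then (1 : ℝ) / (n : ℝ) ^ 2 else 0)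
      (Real.pi ^ 2 / 24 + 0) := by
    refine HasSum.even_add_odd ?_ ?_
    · convert! h1.mul_left (1 / 4) using 1
      · ext n
        simp only [even_two_mul, if_true]
        push_cast
        rw [mul_pow]
        ring
      · ring
    · convert! hasSum_zero using 2 with n
      simp
  have h2 := h1.sub (he.mul_left 2)
  have h3 := (hasSum_nat_add_iff' (f := fun n : ℕ => (1 : ℝ) / (n : ℝ) ^ 2
    - 2 * (if Even n then (1 : ℝ) / (n : ℝ) ^ 2 else 0)) 1).2 h2
  convert! h3 using 1
  · ext n
    rcases Nat.even_or_odd n with hn | hn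
    · have : ¬ Even (n + 1) := by simpa [Nat.even_add_one] using hn
      simp [this, hn.neg_one_pow]
    · have : Even (n + 1) := hn.add_one
      simp [this, hn.neg_one_pow]
      ring
  · simp
    ring

lemma integral_logQuot_one_two : ∫ y in (1 : ℝ)..2, logQuot y = Real.pi ^ 2 / 12 := by
  have hshift : ∫ y in (1 : ℝ)..2, logQuot y = ∫ u in (0 : ℝ)..1, logQuot (u + 1) := by
    rw [intervalIntegral.integral_comp_add_right]
    norm_num
  rw [hshift, intervalIntegral.integral_of_le zero_le_one, integral_Ioc_eq_integral_Ioo]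
  set F : ℕ → ℝ → ℝ := fun n u => (-1) ^ n * u ^ n / (n + 1) with hF
  have hint : ∀ n, ∫ u in Ioo (0 : ℝ) 1, F n u = (-1 : ℝ) ^ n / ((n : ℝ) + 1) ^ 2 := by
    intro n
    rw [← integral_Ioc_eq_integral_Ioo, ← intervalIntegral.integral_of_le zero_le_one]
    simp only [hF, intervalIntegral.integral_div, intervalIntegral.integral_const_mul, integral_pow]
    field_simp
    simp
  have hnorm : ∀ n, ∫ u in Ioo (0 : ℝ) 1, ‖F n u‖ = 1 / ((n : ℝ) + 1) ^ 2 := by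
    intro n
    have : ∫ u in Ioo (0 : ℝ) 1, ‖F n u‖ = ∫ u in Ioo (0 : ℝ) 1, u ^ n / (n + 1) := by
      refine setIntegral_congr_fun measurableSet_Ioo fun u hu => ?_
      have : (0 : ℝ) < n + 1 := by positivity
      simp [hF, abs_of_pos hu.1, abs_of_pos this]
    rw [this, ← integral_Ioc_eq_integral_Ioo, ← intervalIntegral.integral_of_le zero_le_one]
    simp only [intervalIntegral.integral_div, integral_pow]
    field_simp
    simp
  have hI : ∀ n, Integrable (F n) (volume.restrict (Ioo (0 : ℝ) 1)) := by
    intro n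
    have hc : Continuous (F n) := by fun_prop
    exact (hc.integrableOn_Icc).mono_set Ioo_subset_Icc_self
  have hsum : Summable fun n => ∫ u in Ioo (0 : ℝ) 1, ‖F n u‖ := by
    simp only [hnorm]
    have := (summable_nat_add_iff 1).2 hasSum_zeta_two.summable
    simpa using this
  have key := hasSum_integral_of_summable_integral_norm hI hsum
  simp only [hint] at key
  rw [hasSum_alternating_inv_sq.unique key]
  refine setIntegral_congr_fun measurableSet_Ioo fun u hu => ?_
  have hu0 : u ≠ 0 := hu.1.ne'
  have hs := (Real.hasSum_pow_div_log_of_abs_lt_one (x := -u)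
    (by rw [abs_neg, abs_of_pos hu.1]; exact hu.2)).mul_left (-1 / u)
  rw [logQuot_of_ne (by simpa using hu0)]
  have h2 : HasSum (fun n => F n u) (Real.log (u + 1) / (u + 1 - 1)) := by
    convert! hs using 1
    · ext n
      simp only [hF]
      rw [pow_succ, neg_pow u n]
      field_simp
    · rw [show (1 : ℝ) - -u = u + 1 by ring, add_sub_cancel_right]
      ring
  exact h2.tsum_eq.symm

lemma hasDerivAt_integral_logQuot {x : ℝ} (hx : 0 < x) :
    HasDerivAt (fun x => ∫ y in (1 : ℝ)..x, logQuot y) (logQuot x) x := by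
  refine intervalIntegral.integral_hasDerivAt_right (intervalIntegrable_logQuot one_pos hx) ?_ ?_
  · exact continuousOn_logQuot.stronglyMeasurableAtFilter isOpen_Ioi x hx
  · exact continuousOn_logQuot.continuousAt (Ioi_mem_nhds hx)

/-- A two-term identity of dilogarithm type: the sum does not depend on `a`, since its derivative
in `a` vanishes, and at `a = 1/2` it is twice the integral over `[1, 2]`. -/
lemma integral_logQuot_add_integral_logQuot {a : ℝ} (h0 : 0 < a) (h1 : a < 1) :
    (∫ y in ((1 - a) / a)..(1 / a), logQuot y) + ∫ y in (a / (1 - a))..(1 / (1 - a)), logQuot y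
      = Real.pi ^ 2 / 6 := by
  set Λ : ℝ → ℝ := fun x => ∫ y in (1 : ℝ)..x, logQuot y with hΛ
  have hsub : ∀ {x y : ℝ}, 0 < x → 0 < y → ∫ t in x..y, logQuot t = Λ y - Λ x := by
    intro x y hx hy
    rw [hΛ]
    simp only
    rw [intervalIntegral.integral_interval_sub_left (intervalIntegrable_logQuot one_pos hy)
      (intervalIntegrable_logQuot one_pos hx)]
  set J : ℝ → ℝ := fun a => Λ (1 / a) - Λ ((1 - a) / a) + (Λ (1 / (1 - a)) - Λ (a / (1 - a)))
    with hJ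
  have hder : ∀ a ∈ Ioo (0 : ℝ) 1, HasDerivAt J 0 a := by
    intro a ha
    have ha0 : 0 < a := ha.1
    have hb0 : 0 < 1 - a := by linarith [ha.2]
    have e1 : HasDerivAt (fun a : ℝ => 1 / a) (-1 / a ^ 2) a := by
      simpa [neg_div] using hasDerivAt_inv ha0.ne'
    have e0 : HasDerivAt (fun a : ℝ => 1 - a) (-1) a := by
      simpa using (hasDerivAt_id a).const_sub 1
    have e2 : HasDerivAt (fun a : ℝ => (1 - a) / a) (-1 / a ^ 2) a := by
      convert! e0.div (hasDerivAt_id a) ha0.ne' using 1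
      simp only [id]
      ring
    have e3 : HasDerivAt (fun a : ℝ => 1 / (1 - a)) (1 / (1 - a) ^ 2) a := by
      convert! e0.inv hb0.ne' using 1
      · ext x
        simp
      · simp
    have e4 : HasDerivAt (fun a : ℝ => a / (1 - a)) (1 / (1 - a) ^ 2) a := by
      convert! (hasDerivAt_id a).div e0 hb0.ne' using 1
      simp only [id]
      ring
    have hΛ' : ∀ x : ℝ, 0 < x → HasDerivAt Λ (logQuot x) x :=
      fun x hx => hasDerivAt_integral_logQuot hx
    have d := (((hΛ' (1 / a) (by positivity)).comp (h := fun a : ℝ => 1 / a) a e1).sub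
      ((hΛ' ((1 - a) / a) (by positivity)).comp (h := fun a : ℝ => (1 - a) / a) a e2)).add
      (((hΛ' (1 / (1 - a)) (by positivity)).comp (h := fun a : ℝ => 1 / (1 - a)) a e3).sub
      ((hΛ' (a / (1 - a)) (by positivity)).comp (h := fun a : ℝ => a / (1 - a)) a e4))
    convert! d using 1
    have n1 : 1 / a ≠ 1 := by
      intro h; rw [div_eq_one_iff_eq ha0.ne'] at h; linarith [ha.2]
    have n3 : 1 / (1 - a) ≠ 1 := by
      intro h; rw [div_eq_one_iff_eq hb0.ne'] at h; linarith [ha.1]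
    rw [logQuot_of_ne n1, logQuot_of_ne n3]
    rcases eq_or_ne a (1 / 2) with rfl | hne
    · norm_num
    · have n2 : (1 - a) / a ≠ 1 := by
        intro h; rw [div_eq_one_iff_eq ha0.ne'] at h; exact hne (by linarith)
      have n4 : a / (1 - a) ≠ 1 := by
        intro h; rw [div_eq_one_iff_eq hb0.ne'] at h; exact hne (by linarith)
      rw [logQuot_of_ne n2, logQuot_of_ne n4, Real.log_div one_ne_zero ha0.ne',
        Real.log_div one_ne_zero hb0.ne', Real.log_div hb0.ne' ha0.ne',
        Real.log_div ha0.ne' hb0.ne', Real.log_one]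
      have c1 : 1 - a - a ≠ 0 := fun h => hne (by linarith)
      have c2 : a - (1 - a) ≠ 0 := fun h => hne (by linarith)
      rw [show 1 / a - 1 = (1 - a) / a by field_simp, show (1 - a) / a - 1 = (1 - a - a) / a by
        field_simp, show 1 / (1 - a) - 1 = a / (1 - a) by field_simp; ring,
        show a / (1 - a) - 1 = -((1 - a - a) / (1 - a)) by field_simp; ring]
      field_simp
      ring
  have hconst : J a = J (1 / 2) := by
    refine isOpen_Ioo.is_const_of_deriv_eq_zero isPreconnected_Ioo
      (fun x hx => (hder x hx).differentiableAt.differentiableWithinAt)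
      (fun x hx => (hder x hx).deriv) ⟨h0, h1⟩ ⟨by norm_num, by norm_num⟩
  have hb : 0 < 1 - a := by linarith
  rw [hsub (by positivity) (by positivity), hsub (by positivity) (by positivity)]
  change J a = _
  rw [hconst]
  simp only [hJ]
  norm_num
  have : Λ 1 = 0 := by simp [hΛ]
  rw [this]
  have : Λ 2 = Real.pi ^ 2 / 12 := integral_logQuot_one_two
  rw [this]
  ring

/-! ### The transition kernel -/

/-- The interval of impact parameters; the endpoints `±1`, where some of the formulas degenerate,
are left out. -/
abbrev H : Set ℝ := Ioo (-1) 1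

/-- The profile `s ↦ min(1, (1/s - p)₊ / (q - p))`: it is `1` up to `s = 1/q` and vanishes after
`s = 1/p`. -/
def ramp (p q s : ℝ) : ℝ := min 1 (max 0 ((1 / s - p) / (q - p)))

lemma ramp_nonneg (p q s : ℝ) : 0 ≤ ramp p q s := le_min zero_le_one (le_max_left _ _)

lemma ramp_le_one (p q s : ℝ) : ramp p q s ≤ 1 := min_le_left _ _

/-- The four positive parts in the definition of `P` add up to a single truncated term. -/
lemma sum_four_terms {S p q : ℝ} (hp : 0 ≤ p) (hpq : p + q ≤ S) :
    min p (max (1 - S) 0) + max (p - |1 - S|) 0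
      + max (min (S - p / 2) (1 + p / 2) - max (S / 2 + q / 2) 1) 0
      + max (min (S - p / 2) 1 - max (S / 2 + q / 2) (1 - p / 2)) 0
      = min p (max 0 (1 + (p - S - q) / 2)) := by
  rcases le_total S 1 with h | h
  · rw [abs_of_nonneg (by linarith : (0 : ℝ) ≤ 1 - S), max_eq_left (by linarith : 0 ≤ 1 - S)]
    have t3 : max (min (S - p / 2) (1 + p / 2) - max (S / 2 + q / 2) 1) 0 = 0 := by
      apply max_eq_right
      have := min_le_left (S - p / 2) (1 + p / 2)
      have := le_max_right (S / 2 + q / 2) 1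
      linarith
    have t4 : max (min (S - p / 2) 1 - max (S / 2 + q / 2) (1 - p / 2)) 0 = 0 := by
      apply max_eq_right
      have := min_le_left (S - p / 2) 1
      have := le_max_right (S / 2 + q / 2) (1 - p / 2)
      linarith
    rw [t3, t4, min_eq_left (a := p) (b := max 0 _) (le_max_of_le_right (by linarith))]
    rcases le_total p (1 - S) with h' | h'
    · rw [min_eq_left h', max_eq_right (by linarith)]; ring
    · rw [min_eq_right h', max_eq_left (by linarith)]; ring
  · rw [abs_of_nonpos (by linarith : 1 - S ≤ 0), max_eq_right (by linarith : 1 - S ≤ 0),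
      min_eq_right hp]
    rcases le_total (p - (S - 1)) 0 with h1 | h1
    · rw [max_eq_right (by linarith : p - -(1 - S) ≤ 0), min_eq_right (by linarith : 1 + p / 2 ≤ _),
        min_eq_right (by linarith : 1 ≤ S - p / 2)]
      rcases le_total (S / 2 + q / 2) 1 with h2 | h2
      · rw [max_eq_right h2, max_eq_left (by linarith : (0 : ℝ) ≤ 1 + p / 2 - 1)]
        rcases le_total (S / 2 + q / 2) (1 - p / 2) with h3 | h3
        · rw [max_eq_right h3, max_eq_left (by linarith),
            max_eq_right (by linarith : 0 ≤ 1 + (p - S - q) / 2), min_eq_left (by linarith)]; ring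
        · rw [max_eq_left h3, max_eq_left (by linarith),
            max_eq_right (by linarith : 0 ≤ 1 + (p - S - q) / 2), min_eq_right (by linarith)]; ring
      · rw [max_eq_left h2, max_eq_left (by linarith : 1 - p / 2 ≤ _),
          max_eq_right (by linarith : 1 - _ ≤ (0 : ℝ)),
          min_eq_right (max_le (by linarith) (by linarith)),
          max_comm, show 1 + p / 2 - (S / 2 + q / 2) = 1 + (p - S - q) / 2 by ring]
        ring
    · rw [max_eq_left (by linarith : 0 ≤ p - -(1 - S)), min_eq_left (by linarith : _ ≤ 1 + p / 2)]
      rw [max_eq_right (a := 0) (by linarith : 0 ≤ 1 + (p - S - q) / 2)]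
      rcases le_total (S / 2 + q / 2) 1 with h2 | h2
      · rw [max_eq_right h2]
        rcases le_total (S / 2 + q / 2) (1 - p / 2) with h3 | h3
        · rw [max_eq_right h3, min_eq_left (b := 1 + _) (by linarith)]
          rcases le_total (S - p / 2) 1 with h4 | h4
          · rw [min_eq_left h4, max_eq_right (by linarith), max_eq_left (by linarith)]; ring
          · rw [min_eq_right h4, max_eq_left (by linarith), max_eq_left (by linarith)]; ring
        · rw [max_eq_left h3, min_eq_right (b := 1 + _) (by linarith)]
          rcases le_total (S - p / 2) 1 with h4 | h4
          · rw [min_eq_left h4, max_eq_right (by linarith), max_eq_left (by linarith)]; ring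
          · rw [min_eq_right h4, max_eq_left (by linarith), max_eq_left (by linarith)]; ring
      · rw [max_eq_left h2, max_eq_left (by linarith : 1 - p / 2 ≤ _),
          min_eq_right (b := 1 + _) (by linarith), max_eq_left (by linarith),
          max_eq_right (by have := min_le_right (S - p / 2) 1; linarith)]
        ring

lemma abs_add_add_abs_sub_le {h h' : ℝ} (hh : |h| ≤ 1) (hh' : |h'| ≤ 1) :
    |h + h'| / 2 + |h - h'| / 2 ≤ 1 := by
  rw [abs_le] at hh hh'
  rcases abs_cases (h + h') with ⟨e, _⟩ | ⟨e, _⟩ <;>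
  rcases abs_cases (h - h') with ⟨e', _⟩ | ⟨e', _⟩ <;> rw [e, e'] <;> linarith

/-- A simpler closed form of the transition probability density. -/
lemma two_mul_P_eq {s h h' : ℝ} (hs : 0 < s) (hh : |h| ≤ 1) (hh' : |h'| ≤ 1) (hne : h ≠ h') :
    2 * P (2 * s) h h' = 6 / Real.pi ^ 2 *
      ramp (1 + |h + h'| / 2 - |h - h'| / 2) (1 + |h + h'| / 2 + |h - h'| / 2) s := by
  have hη : 0 < |h - h'| := abs_pos.2 (sub_ne_zero.2 hne)
  have hζ : 0 ≤ |h + h'| := abs_nonneg _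
  have hle := abs_add_add_abs_sub_le hh hh'
  have hpi := Real.pi_pos
  simp only [P, ramp]
  rw [mul_comm (|h - h'| / 2) (2 * s), sum_four_terms (by positivity) (by nlinarith)]
  set η := |h - h'|
  set ζ := |h + h'|
  have e : min (2 * s * (η / 2)) (max 0 (1 + (2 * s * (η / 2) - 2 * s - 2 * s * (ζ / 2)) / 2))
      = (s * η) * min 1 (max 0 ((1 / s - (1 + ζ / 2 - η / 2)) / (1 + ζ / 2 + η / 2
        - (1 + ζ / 2 - η / 2)))) := by
    have hp : 0 < s * η := by positivity
    rw [mul_min_of_nonneg _ _ hp.le, mul_max_of_nonneg _ _ hp.le, mul_zero, mul_one]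
    congr 1
    · ring
    · rw [show 1 + ζ / 2 + η / 2 - (1 + ζ / 2 - η / 2) = η by ring]
      congr 1
      field_simp
      ring
  rw [e]
  field_simp
  ring

lemma P_symm (S h h' : ℝ) : P S h h' = P S h' h := by
  simp only [P, abs_sub_comm h h', add_comm h h']

lemma two_mul_P_nonneg {s h h' : ℝ} (hs : 0 < s) (hh : |h| ≤ 1) (hh' : |h'| ≤ 1) :
    0 ≤ 2 * P (2 * s) h h' := by
  rcases eq_or_ne h h' with rfl | hne
  · simp [P]
  · rw [two_mul_P_eq hs hh hh' hne]
    exact mul_nonneg (by positivity) (ramp_nonneg _ _ _)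

/-- The density `2 P(2s, h | h')` of the new pair `(s, h)` after a collision with impact parameter
`h'`, as an extended nonnegative number. -/
def kernel (s h h' : ℝ) : ℝ≥0∞ := ENNReal.ofReal (2 * P (2 * s) h h')

lemma kernel_symm (s h h' : ℝ) : kernel s h h' = kernel s h' h := by
  rw [kernel, P_symm, kernel]

@[fun_prop]
lemma measurable_P : Measurable fun p : ℝ × ℝ × ℝ => P p.1 p.2.1 p.2.2 := by
  have ha : Measurable (fun x : ℝ => |x|) := continuous_abs.measurable
  unfold P
  simp only
  fun_prop

@[fun_prop]
lemma Measurable.kernel {α : Type*} [MeasurableSpace α] {s h h' : α → ℝ} (hs : Measurable s)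
    (hh : Measurable h) (hh' : Measurable h') :
    Measurable fun a => kernel (s a) (h a) (h' a) := by
  unfold LorentzGas.kernel
  exact ((measurable_P.comp ((hs.const_mul 2).prodMk (hh.prodMk hh'))).const_mul 2).ennreal_ofReal

lemma six_div_pi_sq_le_one : 6 / Real.pi ^ 2 ≤ 1 := by
  rw [div_le_one (by positivity)]
  nlinarith [Real.pi_gt_three]

lemma half_le_six_div_pi_sq : 1 / 2 ≤ 6 / Real.pi ^ 2 := by
  rw [div_le_div_iff₀ (by norm_num) (by positivity)]
  nlinarith [Real.pi_lt_d2, Real.pi_gt_three]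

lemma abs_le_one_of_mem {h : ℝ} (hh : h ∈ H) : |h| ≤ 1 :=
  abs_le.2 ⟨hh.1.le, hh.2.le⟩

lemma kernel_eq {s h h' : ℝ} (hs : 0 < s) (hh : h ∈ H) (hh' : h' ∈ H)
    (hne : h ≠ h') :
    kernel s h h' = ENNReal.ofReal (6 / Real.pi ^ 2) * ENNReal.ofReal
      (ramp (1 + |h + h'| / 2 - |h - h'| / 2) (1 + |h + h'| / 2 + |h - h'| / 2) s) := by
  rw [kernel, two_mul_P_eq hs (abs_le_one_of_mem hh) (abs_le_one_of_mem hh') hne,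
    ENNReal.ofReal_mul (by positivity)]

lemma kernel_le_one {s h h' : ℝ} (hs : 0 < s) (hh : h ∈ H)
    (hh' : h' ∈ H) : kernel s h h' ≤ 1 := by
  rcases eq_or_ne h h' with rfl | hne
  · simp [kernel, P]
  · rw [kernel_eq hs hh hh' hne]
    exact mul_le_one' (ENNReal.ofReal_le_one.2 six_div_pi_sq_le_one)
      (ENNReal.ofReal_le_one.2 (ramp_le_one _ _ _))

lemma half_le_kernel {s h h' : ℝ} (hs : 0 < s) (hs' : s ≤ 1 / 2) (hh : h ∈ H)
    (hh' : h' ∈ H) (hne : h ≠ h') : 1 / 2 ≤ kernel s h h' := by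
  have h1 := abs_add_add_abs_sub_le (abs_le_one_of_mem hh) (abs_le_one_of_mem hh')
  have hη : 0 < |h - h'| := abs_pos.2 (sub_ne_zero.2 hne)
  have h2 : 2 ≤ 1 / s := by
    rw [le_div_iff₀ hs]; linarith
  have : ramp (1 + |h + h'| / 2 - |h - h'| / 2) (1 + |h + h'| / 2 + |h - h'| / 2) s = 1 := by
    rw [ramp, min_eq_left]
    refine le_max_of_le_right ?_
    rw [le_div_iff₀ (by linarith)]
    linarith
  rw [kernel_eq hs hh hh' hne, this, ENNReal.ofReal_one, mul_one]
  calc (1 / 2 : ℝ≥0∞) = ENNReal.ofReal (1 / 2) := by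
        rw [ENNReal.ofReal_div_of_pos (by norm_num)]; simp
    _ ≤ _ := ENNReal.ofReal_le_ofReal half_le_six_div_pi_sq

lemma integral_ramp {p q : ℝ} (hp : 0 < p) (hpq : p < q) :
    ∫⁻ s in Ioi (0 : ℝ), ENNReal.ofReal (ramp p q s) = ENNReal.ofReal (Real.log (q / p) / (q - p)) := by
  have hq : 0 < q := hp.trans hpq
  have hqp : 1 / q < 1 / p := one_div_lt_one_div_of_lt hp hpq
  have h0q : 0 < 1 / q := by positivity
  have hd : 0 < q - p := by linarith
  have hsplit : Ioi (0 : ℝ) = (Ioc 0 (1 / q) ∪ Ioc (1 / q) (1 / p)) ∪ Ioi (1 / p) := by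
    rw [Ioc_union_Ioc_eq_Ioc h0q.le hqp.le, Ioc_union_Ioi_eq_Ioi (by positivity)]
  have d1 : Disjoint (Ioc 0 (1 / q) ∪ Ioc (1 / q) (1 / p)) (Ioi (1 / p)) := by
    rw [Ioc_union_Ioc_eq_Ioc h0q.le hqp.le]
    exact Ioc_disjoint_Ioi le_rfl
  have d2 : Disjoint (Ioc 0 (1 / q)) (Ioc (1 / q) (1 / p)) := Ioc_disjoint_Ioc_of_le le_rfl
  rw [hsplit, lintegral_union measurableSet_Ioi d1, lintegral_union measurableSet_Ioc d2]
  have i1 : ∫⁻ s in Ioc 0 (1 / q), ENNReal.ofReal (ramp p q s) = ENNReal.ofReal (1 / q) := by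
    rw [setLIntegral_congr_fun (g := fun _ => 1) measurableSet_Ioc]
    · simp
    · intro s hs
      have : q ≤ 1 / s := by
        rw [le_div_iff₀ hs.1, mul_comm, ← le_div_iff₀ hq]; exact hs.2
      have : ramp p q s = 1 := by
        rw [ramp, min_eq_left]
        refine le_max_of_le_right ?_
        rw [le_div_iff₀ hd]; linarith
      simp [this]
  have i3 : ∫⁻ s in Ioi (1 / p), ENNReal.ofReal (ramp p q s) = 0 := by
    rw [setLIntegral_congr_fun (g := fun _ => 0) measurableSet_Ioi]
    · simp
    · intro s hs
      have hs' : 1 / p < s := hs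
      have hs0 : 0 < s := lt_trans (by positivity) hs'
      have : 1 / s ≤ p := by
        rw [div_le_iff₀ hs0, mul_comm, ← div_le_iff₀ hp]; exact hs'.le
      have : ramp p q s = 0 := by
        rw [ramp, max_eq_left, min_eq_right zero_le_one]
        exact div_nonpos_of_nonpos_of_nonneg (by linarith) hd.le
      simp [this]
  have i2 : ∫⁻ s in Ioc (1 / q) (1 / p), ENNReal.ofReal (ramp p q s)
      = ENNReal.ofReal ((Real.log (q / p) - p * (1 / p - 1 / q)) / (q - p)) := by
    have hI : IntervalIntegrable (fun s : ℝ => 1 / s) volume (1 / q) (1 / p) := by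
      refine intervalIntegral.intervalIntegrable_one_div (fun x hx => ?_) continuousOn_id
      rw [uIcc_of_le hqp.le] at hx
      exact (lt_of_lt_of_le h0q hx.1).ne'
    have hI2 : IntervalIntegrable (fun s : ℝ => (1 / s - p) / (q - p)) volume (1 / q) (1 / p) :=
      (hI.sub intervalIntegrable_const).div_const _
    have hv : ∫ s in (1 / q)..(1 / p), (1 / s - p) / (q - p)
        = (Real.log (q / p) - p * (1 / p - 1 / q)) / (q - p) := by
      rw [intervalIntegral.integral_div, intervalIntegral.integral_sub hI intervalIntegrable_const,
        integral_one_div_of_pos h0q (by positivity), intervalIntegral.integral_const]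
      congr 2
      · congr 1
        field_simp
      · rw [smul_eq_mul, mul_comm]
    have hin : ∀ s ∈ Ioc (1 / q) (1 / p), 0 ≤ (1 / s - p) / (q - p) ∧ (1 / s - p) / (q - p) ≤ 1 := by
      intro s hs
      have hs0 : 0 < s := h0q.trans hs.1
      have a1 : p ≤ 1 / s := by
        rw [le_div_iff₀ hs0, mul_comm, ← le_div_iff₀ hp]; exact hs.2
      have a2 : 1 / s ≤ q := by
        rw [div_le_iff₀ hs0, mul_comm, ← div_le_iff₀ hq]; exact hs.1.le
      exact ⟨div_nonneg (by linarith) hd.le, by rw [div_le_one hd]; linarith⟩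
    rw [← hv, intervalIntegral.integral_of_le hqp.le, ofReal_integral_eq_lintegral_ofReal]
    · refine setLIntegral_congr_fun measurableSet_Ioc fun s hs => ?_
      rw [ramp, max_eq_right (hin s hs).1, min_eq_right (hin s hs).2]
    · exact (intervalIntegrable_iff_integrableOn_Ioc_of_le hqp.le).1 hI2
    · exact (ae_restrict_iff' measurableSet_Ioc).2 (ae_of_all _ fun s hs => (hin s hs).1)
  rw [i1, i2, i3, add_zero, ← ENNReal.ofReal_add h0q.le]
  · congr 1
    field_simp
    ring
  · refine div_nonneg ?_ hd.le
    have := Real.one_sub_inv_le_log_of_pos (show 0 < q / p by positivity)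
    have e : p * (1 / p - 1 / q) = 1 - (q / p)⁻¹ := by field_simp
    linarith

/-! ### Normalization of the kernel and the equilibrium -/

/-- The distribution of the impact parameter `h` after a collision. According to the sign of
`h + h'`, the numbers `p < q` of `ramp p q` are `1 + h` and `1 + h'`, or `1 - h` and `1 - h'`, in
some order. -/
lemma lintegral_kernel_time {h h' : ℝ} (hh : h ∈ H) (hh' : h' ∈ H) (hne : h ≠ h')
    (hne' : h' ≠ -h) :
    ∫⁻ s in Ioi (0 : ℝ), kernel s h h' = ENNReal.ofReal (6 / Real.pi ^ 2) * ENNReal.ofReal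
      (if -h < h' then logQuot ((1 + h') / (1 + h)) / (1 + h)
        else logQuot ((1 - h') / (1 - h)) / (1 - h)) := by
  obtain ⟨h1, h2⟩ := hh
  obtain ⟨h3, h4⟩ := hh'
  have hη : 0 < |h - h'| := abs_pos.2 (sub_ne_zero.2 hne)
  have hp : 0 < 1 + |h + h'| / 2 - |h - h'| / 2 := by
    rcases abs_cases (h + h') with ⟨e, _⟩ | ⟨e, _⟩ <;>
    rcases abs_cases (h - h') with ⟨e', _⟩ | ⟨e', _⟩ <;> rw [e, e'] <;> linarith
  rw [setLIntegral_congr_fun measurableSet_Ioi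
    (fun s hs => kernel_eq hs ⟨h1, h2⟩ ⟨h3, h4⟩ hne), lintegral_const_mul' _ _ ENNReal.ofReal_ne_top,
    integral_ramp hp (by linarith)]
  congr 2
  have key : ∀ x y : ℝ, 0 < x → 0 < y → x ≠ y →
      Real.log (y / x) / (y - x) = logQuot (y / x) / x := by
    intro x y hx hy hxy
    rw [logQuot_of_ne (by rw [Ne, div_eq_one_iff_eq hx.ne']; exact hxy.symm)]
    have : y - x ≠ 0 := sub_ne_zero.2 hxy.symm
    field_simp
  have key' : ∀ x y : ℝ, 0 < x → 0 < y → x ≠ y →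
      Real.log (x / y) / (x - y) = logQuot (y / x) / x := by
    intro x y hx hy hxy
    rw [← key x y hx hy hxy, ← inv_div y x, Real.log_inv, ← neg_sub y x, neg_div_neg_eq]
  split_ifs with hc
  · rw [abs_of_pos (by linarith : 0 < h + h')]
    rcases abs_cases (h - h') with ⟨e, _⟩ | ⟨e, _⟩ <;> rw [e]
    · rw [← key' (1 + h) (1 + h') (by linarith) (by linarith) (by simpa using hne)]
      ring_nf
    · rw [← key (1 + h) (1 + h') (by linarith) (by linarith) (by simpa using hne)]
      ring_nf
  · have hc' : h + h' < 0 := by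
      rcases lt_or_eq_of_le (not_lt.1 hc) with h5 | h5
      · linarith
      · exact absurd h5 hne'
    rw [abs_of_neg hc']
    rcases abs_cases (h - h') with ⟨e, _⟩ | ⟨e, _⟩ <;> rw [e]
    · rw [← key (1 - h) (1 - h') (by linarith) (by linarith)
        (by intro h6; exact hne (by linarith))]
      ring_nf
    · rw [← key' (1 - h) (1 - h') (by linarith) (by linarith)
        (by intro h6; exact hne (by linarith))]
      ring_nf

lemma lintegral_logQuot_div {a b c d : ℝ} (hab : a ≤ b) (hc : 0 < c) (ha : 0 < d + a / c) :
    ∫⁻ x in Ioo a b, ENNReal.ofReal (logQuot (d + x / c) / c)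
      = ENNReal.ofReal (∫ y in (d + a / c)..(d + b / c), logQuot y) := by
  have hab' : d + a / c ≤ d + b / c := by gcongr
  have hpos : ∀ x ∈ Icc a b, 0 < d + x / c := fun x hx => lt_of_lt_of_le ha (by gcongr; exact hx.1)
  have hc0 : ContinuousOn (fun x => logQuot (d + x / c) / c) (Icc a b) := by
    refine ContinuousOn.div_const ?_ _
    refine continuousOn_logQuot.comp (by fun_prop) fun x hx => hpos x hx
  have e : ∫ y in (d + a / c)..(d + b / c), logQuot y = ∫ x in a..b, logQuot (d + x / c) / c := by
    rw [intervalIntegral.integral_div, intervalIntegral.integral_comp_add_div _ hc.ne', smul_eq_mul]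
    field_simp
  rw [e, intervalIntegral.integral_of_le hab, integral_Ioc_eq_integral_Ioo,
    ofReal_integral_eq_lintegral_ofReal]
  · exact hc0.integrableOn_Icc.mono_set Ioo_subset_Icc_self
  · refine (ae_restrict_iff' measurableSet_Ioo).2 (ae_of_all _ fun x hx => ?_)
    exact div_nonneg (logQuot_nonneg (hpos x (Ioo_subset_Icc_self hx))) hc.le

lemma lintegral_logQuot_sub_div {a b c d : ℝ} (hab : a ≤ b) (hc : 0 < c) (hb : 0 < d - b / c) :
    ∫⁻ x in Ioo a b, ENNReal.ofReal (logQuot (d - x / c) / c)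
      = ENNReal.ofReal (∫ y in (d - b / c)..(d - a / c), logQuot y) := by
  have hpos : ∀ x ∈ Icc a b, 0 < d - x / c := fun x hx => lt_of_lt_of_le hb (by gcongr; exact hx.2)
  have hc0 : ContinuousOn (fun x => logQuot (d - x / c) / c) (Icc a b) := by
    refine ContinuousOn.div_const ?_ _
    refine continuousOn_logQuot.comp (by fun_prop) fun x hx => hpos x hx
  have e : ∫ y in (d - b / c)..(d - a / c), logQuot y = ∫ x in a..b, logQuot (d - x / c) / c := by
    rw [intervalIntegral.integral_div, intervalIntegral.integral_comp_sub_div _ hc.ne', smul_eq_mul]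
    field_simp
  rw [e, intervalIntegral.integral_of_le hab, integral_Ioc_eq_integral_Ioo,
    ofReal_integral_eq_lintegral_ofReal]
  · exact hc0.integrableOn_Icc.mono_set Ioo_subset_Icc_self
  · refine (ae_restrict_iff' measurableSet_Ioo).2 (ae_of_all _ fun x hx => ?_)
    exact div_nonneg (logQuot_nonneg (hpos x (Ioo_subset_Icc_self hx))) hc.le

/-- The transition densities are normalized. -/
lemma lintegral_lintegral_kernel {h : ℝ} (hh : h ∈ H) :
    ∫⁻ h' in H, ∫⁻ s in Ioi (0 : ℝ), kernel s h h' = 1 := by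
  have hh0 := hh
  obtain ⟨h1, h2⟩ := hh0
  have hpi := Real.pi_pos
  have hae : ∀ᵐ h' : ℝ, h' ≠ h ∧ h' ≠ -h := by
    filter_upwards [compl_mem_ae_iff.2 (measure_singleton (μ := volume) h),
      compl_mem_ae_iff.2 (measure_singleton (μ := volume) (-h))] with x hx hx'
    exact ⟨hx, hx'⟩
  rw [setLIntegral_congr_fun_ae measurableSet_Ioo
    (hae.mono fun h' hne hh' => lintegral_kernel_time hh hh' hne.1.symm hne.2),
    lintegral_const_mul' _ _ ENNReal.ofReal_ne_top]
  have hsplit : H =ᵐ[volume] (Ioo (-1) (-h) ∪ Ioo (-h) 1 : Set ℝ) := by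
    filter_upwards [hae] with x hx
    refine propext ⟨fun hxH => ?_, fun hxU => ?_⟩
    · rcases lt_or_gt_of_ne hx.2 with h5 | h5
      · exact Or.inl ⟨hxH.1, h5⟩
      · exact Or.inr ⟨h5, hxH.2⟩
    · rcases hxU with h5 | h5
      · exact ⟨h5.1, by linarith [h5.2]⟩
      · exact ⟨by linarith [h5.1], h5.2⟩
  rw [setLIntegral_congr hsplit, lintegral_union measurableSet_Ioo]
  swap
  · exact Set.disjoint_left.2 fun x hx hx' => absurd hx.2 (not_lt.2 hx'.1.le)
  have e1 : ∫⁻ x in Ioo (-1) (-h), ENNReal.ofReal (if -h < x then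
      logQuot ((1 + x) / (1 + h)) / (1 + h) else logQuot ((1 - x) / (1 - h)) / (1 - h))
      = ENNReal.ofReal (∫ y in ((1 + h) / (1 - h))..(2 / (1 - h)), logQuot y) := by
    have hc : 0 < 1 - h := by linarith
    rw [setLIntegral_congr_fun (g := fun x => ENNReal.ofReal
      (logQuot (1 / (1 - h) - x / (1 - h)) / (1 - h))) measurableSet_Ioo]
    · rw [lintegral_logQuot_sub_div (by linarith) hc (by rw [← sub_div]; apply div_pos <;> linarith)]
      congr 2 <;> (rw [← sub_div]; congr 1; ring)
    · intro x hx
      simp only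
      rw [if_neg (not_lt.2 hx.2.le), sub_div 1 x]
  have e2 : ∫⁻ x in Ioo (-h) 1, ENNReal.ofReal (if -h < x then
      logQuot ((1 + x) / (1 + h)) / (1 + h) else logQuot ((1 - x) / (1 - h)) / (1 - h))
      = ENNReal.ofReal (∫ y in ((1 - h) / (1 + h))..(2 / (1 + h)), logQuot y) := by
    have hc : 0 < 1 + h := by linarith
    rw [setLIntegral_congr_fun (g := fun x => ENNReal.ofReal
      (logQuot (1 / (1 + h) + x / (1 + h)) / (1 + h))) measurableSet_Ioo]
    · rw [lintegral_logQuot_div (by linarith) hc (by rw [← add_div]; apply div_pos <;> linarith)]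
      congr 2 <;> (rw [← add_div]; congr 1 <;> ring)
    · intro x hx
      simp only
      rw [if_pos hx.1, add_div 1 x]
  have hnn : ∀ a b : ℝ, 0 < a → a ≤ b → 0 ≤ ∫ y in a..b, logQuot y := fun a b ha hab =>
    intervalIntegral.integral_nonneg hab fun y hy => logQuot_nonneg (ha.trans_le hy.1)
  have hid := integral_logQuot_add_integral_logQuot (a := (1 + h) / 2) (by linarith) (by linarith)
  rw [show (1 - (1 + h) / 2) / ((1 + h) / 2) = (1 - h) / (1 + h) by
      rw [show 1 - (1 + h) / 2 = (1 - h) / 2 by ring, div_div_div_cancel_right₀ two_ne_zero],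
    show 1 / ((1 + h) / 2) = 2 / (1 + h) by rw [one_div_div],
    show (1 + h) / 2 / (1 - (1 + h) / 2) = (1 + h) / (1 - h) by
      rw [show 1 - (1 + h) / 2 = (1 - h) / 2 by ring, div_div_div_cancel_right₀ two_ne_zero],
    show 1 / (1 - (1 + h) / 2) = 2 / (1 - h) by
      rw [show 1 - (1 + h) / 2 = (1 - h) / 2 by ring, one_div_div]] at hid
  rw [e1, e2, ← ENNReal.ofReal_add, add_comm, hid, ← ENNReal.ofReal_mul (by positivity)]
  · rw [show 6 / Real.pi ^ 2 * (Real.pi ^ 2 / 6) = 1 by field_simp, ENNReal.ofReal_one]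
  · apply hnn
    · apply div_pos <;> linarith
    · apply div_le_div_of_nonneg_right <;> linarith
  · apply hnn
    · apply div_pos <;> linarith
    · apply div_le_div_of_nonneg_right <;> linarith

/-- The mass `∫_s^∞ ∫ 2 P(2r, h | h') dh' dr` left after time `s`; it is `E(s, h)` as an extended
nonnegative number. -/
def tail (s h : ℝ) : ℝ≥0∞ := ∫⁻ r in Ioi s, ∫⁻ h' in H, kernel r h h'

@[fun_prop]
lemma measurable_lintegral_kernel :
    Measurable fun p : ℝ × ℝ => ∫⁻ h' in H, kernel p.1 p.2 h' :=
  Measurable.lintegral_prod_right' (f := fun q : (ℝ × ℝ) × ℝ => kernel q.1.1 q.1.2 q.2)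
    (by fun_prop)

lemma tail_eq_indicator (s h : ℝ) :
    tail s h = ∫⁻ r, (Ioi s).indicator (fun r => ∫⁻ h' in H, kernel r h h') r := by
  rw [tail, lintegral_indicator measurableSet_Ioi]

lemma measurable_tail' : Measurable fun p : ℝ × ℝ => tail p.1 p.2 := by
  simp only [tail_eq_indicator]
  refine Measurable.lintegral_prod_right' (f := fun q : (ℝ × ℝ) × ℝ =>
    (Ioi q.1.1).indicator (fun r => ∫⁻ h' in H, kernel r q.1.2 h') q.2) ?_
  have : (fun q : (ℝ × ℝ) × ℝ => (Ioi q.1.1).indicator (fun r => ∫⁻ h' in H, kernel r q.1.2 h') q.2)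
      = {q : (ℝ × ℝ) × ℝ | q.1.1 < q.2}.indicator
        (fun q => ∫⁻ h' in H, kernel q.2 q.1.2 h') := by
    ext q
    simp [indicator]
  rw [this]
  exact (measurable_lintegral_kernel.comp (f := fun q : (ℝ × ℝ) × ℝ => (q.2, q.1.2))
    (by fun_prop)).indicator (measurableSet_lt (by fun_prop) (by fun_prop))

@[fun_prop]
lemma Measurable.tail {α : Type*} [MeasurableSpace α] {s h : α → ℝ} (hs : Measurable s)
    (hh : Measurable h) : Measurable fun a => tail (s a) (h a) :=
  measurable_tail'.comp (hs.prodMk hh)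

lemma tail_zero {h : ℝ} (hh : h ∈ H) : tail 0 h = 1 := by
  rw [tail, lintegral_lintegral_swap, lintegral_lintegral_kernel hh]
  exact Measurable.aemeasurable (by simp only [Function.uncurry_def]; fun_prop)

lemma tail_antitone (h : ℝ) : Antitone fun s => tail s h := fun _ _ hst =>
  lintegral_mono_set (Ioi_subset_Ioi hst)

lemma tail_le_one {s h : ℝ} (hs : 0 ≤ s) (hh : h ∈ H) : tail s h ≤ 1 :=
  (tail_antitone h hs).trans (tail_zero hh).le

lemma tail_add_lintegral (h : ℝ) {s t : ℝ} (hst : s ≤ t) :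
    tail t h + ∫⁻ r in Ioc s t, ∫⁻ h' in H, kernel r h h' = tail s h := by
  rw [tail, tail, ← Ioc_union_Ioi_eq_Ioi hst, lintegral_union measurableSet_Ioi
    (Ioc_disjoint_Ioi le_rfl), add_comm]

lemma restrict_H : (volume : Measure ℝ).restrict H = volume.restrict (Icc (-1) 1) :=
  restrict_Ioo_eq_restrict_Icc

lemma E_eq_toReal_tail {s h : ℝ} (hs : 0 ≤ s) (hh : h ∈ H) : E s h = (tail s h).toReal := by
  have hinner : ∀ r : ℝ, 0 < r → ∫ h' in Icc (-1 : ℝ) 1, 2 * P (2 * r) h h'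
      = (∫⁻ h' in H, kernel r h h').toReal := by
    intro r hr
    rw [integral_eq_lintegral_of_nonneg_ae, restrict_H]
    · rfl
    · refine (ae_restrict_iff' measurableSet_Icc).2 (ae_of_all _ fun x hx => ?_)
      exact two_mul_P_nonneg hr (abs_le_one_of_mem hh) (abs_le.2 hx)
    · exact Measurable.aestronglyMeasurable (by
        exact (measurable_P.comp (f := fun x : ℝ => (2 * r, h, x)) (by fun_prop)).const_mul 2)
  have e1 : E s h = ∫ r in Ioi s, ∫ h' in Icc (-1 : ℝ) 1, 2 * P (2 * r) h h' := by
    have := integral_comp_mul_left_Ioi (fun τ => ∫ h' in Icc (-1 : ℝ) 1, P τ h h') s two_pos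
    simp only [integral_const_mul]
    rw [this, E, smul_eq_mul]
    ring
  have e2 : ∫ r in Ioi s, ∫ h' in Icc (-1 : ℝ) 1, 2 * P (2 * r) h h'
      = ∫ r in Ioi s, (∫⁻ h' in H, kernel r h h').toReal :=
    setIntegral_congr_fun measurableSet_Ioi fun r hr => hinner r (hs.trans_lt hr)
  have hm : Measurable fun r => ∫⁻ h' in H, kernel r h h' :=
    measurable_lintegral_kernel.comp (f := fun r : ℝ => (r, h)) (by fun_prop)
  rw [e1, e2, tail, integral_toReal hm.aemeasurable]
  refine ae_lt_top hm ?_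
  exact ((tail_le_one hs hh).trans_lt ENNReal.one_lt_top).ne

/-! ### Finiteness of the total mass of the equilibrium -/

/-- If `p > 1/2` then `s < 2` on the support of the ramp; otherwise `q - p ≥ 1/2`, and the factor
`1/s` in the ramp compensates for `s`. -/
lemma mul_ramp_le {p q s : ℝ} (hp : 0 < p) (hpq : p < q) (hq : 1 ≤ q) (hs : 0 < s) :
    s * ramp p q s ≤ (Ioc 0 (1 / p)).indicator (fun _ => 2) s := by
  have hd : 0 < q - p := by linarith
  by_cases h : s ≤ 1 / p
  · rw [indicator_of_mem (show s ∈ Ioc 0 (1 / p) from ⟨hs, h⟩)]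
    rcases le_or_gt p (1 / 2) with h1 | h1
    · have h2 : s * ((1 / s - p) / (q - p)) ≤ 2 := by
        rw [← mul_div_assoc, div_le_iff₀ hd, mul_sub, mul_one_div_cancel hs.ne']
        nlinarith
      have h3 : ramp p q s ≤ max 0 ((1 / s - p) / (q - p)) := min_le_right _ _
      calc s * ramp p q s ≤ s * max 0 ((1 / s - p) / (q - p)) := by gcongr
        _ = max 0 (s * ((1 / s - p) / (q - p))) := by rw [mul_max_of_nonneg _ _ hs.le, mul_zero]
        _ ≤ 2 := max_le zero_le_two h2
    · have h2 : 1 / p ≤ 2 := by rw [div_le_iff₀ hp]; linarith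
      have := mul_le_mul_of_nonneg_left (ramp_le_one p q s) hs.le
      linarith
  · have h2 : 1 / s ≤ p := by
      rw [div_le_iff₀ hs, mul_comm, ← div_le_iff₀ hp]; exact (not_le.1 h).le
    have : ramp p q s = 0 := by
      rw [ramp, max_eq_left, min_eq_right zero_le_one]
      exact div_nonpos_of_nonpos_of_nonneg (by linarith) hd.le
    rw [indicator_of_notMem (fun hm : s ∈ Ioc 0 (1 / p) => h hm.2), this, mul_zero]

/-- The largest flight time `1/p` that has positive density is bounded by a product of integrable
functions, since `p ≥ 1 - |h|` and `p ≥ 1 - |h'|`. -/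
lemma one_div_le_rpow_mul_rpow {h h' : ℝ} (hh : h ∈ H) (hh' : h' ∈ H) :
    0 < 1 + |h + h'| / 2 - |h - h'| / 2 ∧ 1 / (1 + |h + h'| / 2 - |h - h'| / 2)
      ≤ (1 - |h|) ^ (-(1 / 2) : ℝ) * (1 - |h'|) ^ (-(1 / 2) : ℝ) := by
  have a1 : 0 < 1 - |h| := by rw [sub_pos, abs_lt]; exact hh
  have a2 : 0 < 1 - |h'| := by rw [sub_pos, abs_lt]; exact hh'
  have t1 : |h - h'| ≤ |h + h'| + 2 * |h| := by
    have := abs_sub (2 * h) (h + h')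
    rw [show 2 * h - (h + h') = h - h' by ring, abs_mul, abs_two] at this
    linarith
  have t2 : |h - h'| ≤ |h + h'| + 2 * |h'| := by
    have := abs_sub (h + h') (2 * h')
    rw [show h + h' - 2 * h' = h - h' by ring, abs_mul, abs_two] at this
    linarith
  set p := 1 + |h + h'| / 2 - |h - h'| / 2 with hp
  have b1 : 1 - |h| ≤ p := by rw [hp]; linarith
  have b2 : 1 - |h'| ≤ p := by rw [hp]; linarith
  have hp0 : 0 < p := a1.trans_le b1
  refine ⟨hp0, ?_⟩
  rw [← Real.mul_rpow a1.le a2.le, Real.rpow_neg (by positivity), ← Real.sqrt_eq_rpow, one_div]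
  refine inv_anti₀ (Real.sqrt_pos.2 (by positivity)) ?_
  rw [Real.sqrt_le_left hp0.le, sq]
  exact mul_le_mul b1 b2 a2.le hp0.le

lemma lintegral_rpow_lt_top :
    ∫⁻ h in H, ENNReal.ofReal ((1 - |h|) ^ (-(1 / 2) : ℝ)) < ∞ := by
  have hI : IntervalIntegrable (fun x : ℝ => x ^ (-(1 / 2) : ℝ)) volume 0 1 :=
    intervalIntegral.intervalIntegrable_rpow' (by norm_num)
  have h1 : IntervalIntegrable (fun x : ℝ => (1 - x) ^ (-(1 / 2) : ℝ)) volume 0 1 := by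
    have := hI.comp_sub_left 1
    simpa using this.symm
  have h2 : IntervalIntegrable (fun x : ℝ => (1 + x) ^ (-(1 / 2) : ℝ)) volume (-1) 0 := by
    have := hI.comp_add_left 1
    simpa using this
  have h1' : IntervalIntegrable (fun x : ℝ => (1 - |x|) ^ (-(1 / 2) : ℝ)) volume 0 1 := by
    refine h1.congr fun x hx => ?_
    rw [uIoc_of_le zero_le_one] at hx
    rw [abs_of_pos hx.1]
  have h2' : IntervalIntegrable (fun x : ℝ => (1 - |x|) ^ (-(1 / 2) : ℝ)) volume (-1) 0 := by
    refine h2.congr fun x hx => ?_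
    rw [uIoc_of_le (by norm_num)] at hx
    rw [abs_of_nonpos hx.2, sub_neg_eq_add]
  have h3 := (intervalIntegrable_iff_integrableOn_Ioo_of_le (by norm_num)).1 (h2'.trans h1')
  exact h3.lintegral_lt_top

lemma lintegral_mul_kernel_le {h h' : ℝ} (hh : h ∈ H) (hh' : h' ∈ H) :
    ∫⁻ r in Ioi (0 : ℝ), ENNReal.ofReal r * kernel r h h'
      ≤ 2 * (ENNReal.ofReal ((1 - |h|) ^ (-(1 / 2) : ℝ)) *
        ENNReal.ofReal ((1 - |h'|) ^ (-(1 / 2) : ℝ))) := by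
  rcases eq_or_ne h h' with rfl | hne
  · simp [kernel, P]
  obtain ⟨hp, hle⟩ := one_div_le_rpow_mul_rpow hh hh'
  have hη : 0 < |h - h'| := abs_pos.2 (sub_ne_zero.2 hne)
  have hq : 1 ≤ 1 + |h + h'| / 2 + |h - h'| / 2 := by
    have := abs_nonneg (h + h'); linarith
  set p := 1 + |h + h'| / 2 - |h - h'| / 2
  set q := 1 + |h + h'| / 2 + |h - h'| / 2
  have hpq : p < q := by simp only [p, q]; linarith
  have hpw : ∀ r ∈ Ioi (0 : ℝ), ENNReal.ofReal r * kernel r h h'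
      ≤ (Ioc 0 (1 / p)).indicator (fun _ => (2 : ℝ≥0∞)) r := by
    intro r hr
    have hr0 : 0 < r := hr
    rw [kernel_eq hr hh hh' hne]
    calc ENNReal.ofReal r * (ENNReal.ofReal (6 / Real.pi ^ 2) * ENNReal.ofReal (ramp p q r))
        ≤ ENNReal.ofReal r * (1 * ENNReal.ofReal (ramp p q r)) := by
          gcongr
          exact ENNReal.ofReal_le_one.2 six_div_pi_sq_le_one
      _ = ENNReal.ofReal (r * ramp p q r) := by rw [one_mul, ENNReal.ofReal_mul hr0.le]
      _ ≤ ENNReal.ofReal ((Ioc 0 (1 / p)).indicator (fun _ => 2) r) :=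
          ENNReal.ofReal_le_ofReal (mul_ramp_le hp hpq hq hr)
      _ = _ := by
          by_cases hm : r ∈ Ioc 0 (1 / p)
          · rw [indicator_of_mem hm, indicator_of_mem hm, ENNReal.ofReal_ofNat]
          · rw [indicator_of_notMem hm, indicator_of_notMem hm, ENNReal.ofReal_zero]
  calc _ ≤ ∫⁻ r in Ioi (0 : ℝ), (Ioc 0 (1 / p)).indicator (fun _ => (2 : ℝ≥0∞)) r :=
        setLIntegral_mono' measurableSet_Ioi hpw
    _ ≤ ∫⁻ r, (Ioc 0 (1 / p)).indicator (fun _ => (2 : ℝ≥0∞)) r := setLIntegral_le_lintegral _ _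
    _ = 2 * ENNReal.ofReal (1 / p) := by
        rw [lintegral_indicator measurableSet_Ioc, setLIntegral_const, Real.volume_Ioc, sub_zero]
    _ ≤ _ := by
        rw [← ENNReal.ofReal_mul]
        · gcongr
        · refine Real.rpow_nonneg ?_ _
          rw [sub_nonneg, abs_le]
          exact ⟨hh.1.le, hh.2.le⟩

/-- The equilibrium has finite mass: by Tonelli's theorem, its mass is a first moment
of the flight time. -/
lemma lintegral_tail_lt_top : ∫⁻ s in Ioi (0 : ℝ), ∫⁻ h in H, tail s h < ∞ := by
  have e1 : ∫⁻ s in Ioi (0 : ℝ), ∫⁻ h in H, tail s h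
      = ∫⁻ h in H, ∫⁻ s in Ioi (0 : ℝ), tail s h :=
    lintegral_lintegral_swap
      (Measurable.aemeasurable (by simp only [Function.uncurry_def]; fun_prop))
  have e2 : ∀ h, ∫⁻ s in Ioi (0 : ℝ), tail s h
      = ∫⁻ h' in H, ∫⁻ r in Ioi (0 : ℝ), ENNReal.ofReal r * kernel r h h' := by
    intro h
    set f : ℝ → ℝ≥0∞ := fun r => ∫⁻ h' in H, kernel r h h' with hf
    have hfm : Measurable f :=
      measurable_lintegral_kernel.comp (f := fun r : ℝ => (r, h)) (by fun_prop)
    have a1 : ∀ s ∈ Ioi (0 : ℝ), tail s h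
        = ∫⁻ r in Ioi (0 : ℝ), (Iio r).indicator (fun _ => f r) s := by
      intro s hs
      rw [tail_eq_indicator, ← lintegral_indicator measurableSet_Ioi]
      refine lintegral_congr fun r => ?_
      have hs' : (0 : ℝ) < s := hs
      by_cases hr : s < r
      · simp [hr, hs'.trans hr, hf]
      · simp [hr, indicator]
    have a2 : ∀ r ∈ Ioi (0 : ℝ), ∫⁻ s in Ioi (0 : ℝ), (Iio r).indicator (fun _ => f r) s
        = ∫⁻ h' in H, ENNReal.ofReal r * kernel r h h' := by
      intro r hr
      rw [lintegral_indicator measurableSet_Iio, Measure.restrict_restrict measurableSet_Iio,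
        Iio_inter_Ioi, setLIntegral_const, Real.volume_Ioo, sub_zero, mul_comm,
        lintegral_const_mul' _ _ ENNReal.ofReal_ne_top]
    rw [setLIntegral_congr_fun measurableSet_Ioi a1, lintegral_lintegral_swap,
      setLIntegral_congr_fun measurableSet_Ioi a2, lintegral_lintegral_swap]
    · exact Measurable.aemeasurable (by simp only [Function.uncurry_def]; fun_prop)
    · refine Measurable.aemeasurable ?_
      have : (Function.uncurry fun s r : ℝ => (Iio r).indicator (fun _ => f r) s)
          = {x : ℝ × ℝ | x.1 < x.2}.indicator (fun x => f x.2) := by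
        ext x; simp [indicator, Function.uncurry]
      rw [this]
      exact (hfm.comp measurable_snd).indicator (measurableSet_lt (by fun_prop) (by fun_prop))
  rw [e1]
  simp only [e2]
  set w : ℝ → ℝ≥0∞ := fun h => ENNReal.ofReal ((1 - |h|) ^ (-(1 / 2) : ℝ)) with hw
  have hwm : Measurable w := by
    have ha : Measurable (fun x : ℝ => |x|) := continuous_abs.measurable
    simp only [hw]
    fun_prop
  calc _ ≤ ∫⁻ h in H, ∫⁻ h' in H, 2 * (w h * w h') :=
        setLIntegral_mono' measurableSet_Ioo fun h hh => setLIntegral_mono' measurableSet_Ioo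
          fun h' hh' => lintegral_mul_kernel_le hh hh'
    _ = 2 * ((∫⁻ h in H, w h) * ∫⁻ h in H, w h) := by
        have : ∀ h, ∫⁻ h' in H, 2 * (w h * w h') = (2 * ∫⁻ h' in H, w h') * w h := by
          intro h
          rw [lintegral_const_mul _ (by fun_prop), lintegral_const_mul _ hwm]
          ring
        simp only [this]
        rw [lintegral_const_mul _ hwm]
        ring
    _ < ∞ := by
        have := lintegral_rpow_lt_top
        exact ENNReal.mul_lt_top (by simp) (ENNReal.mul_lt_top this this)

/-! ### Free flow and collisions -/

/-- Positions and directions. -/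
abbrev Y : Type := T2 × S1

/-- Free motion during a time `t`. -/
def flow (t : ℝ) (y : Y) : Y := (move y.1 t y.2, y.2)

/-- Change of direction in a collision with impact parameter `h`. -/
def bounce (h : ℝ) (y : Y) : Y := (y.1, deflect h y.2)

/-- The cosine of an angle in `ℝ / 2πℤ`. -/
def circleCos : S1 → ℝ := Real.cos_periodic.lift

/-- The sine of an angle in `ℝ / 2πℤ`. -/
def circleSin : S1 → ℝ := Real.sin_periodic.lift

lemma circleCos_coe (x : ℝ) : circleCos (x : S1) = Real.cos x := rfl

lemma continuous_circleCos : Continuous circleCos :=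
  continuous_coinduced_dom.2 Real.continuous_cos

lemma continuous_circleSin : Continuous circleSin :=
  continuous_coinduced_dom.2 Real.continuous_sin

@[fun_prop]
lemma measurable_circleCos : Measurable circleCos := continuous_circleCos.measurable

@[fun_prop]
lemma measurable_circleSin : Measurable circleSin := continuous_circleSin.measurable

@[fun_prop]
lemma measurable_coe_circle {T : ℝ} : Measurable fun x : ℝ => (x : AddCircle T) :=
  AddCircle.measurable_mk'

@[fun_prop]
lemma measurable_dir (i : Fin 2) : Measurable fun ω => dir ω i := by
  fin_cases i
  · exact measurable_circleCos
  · exact measurable_circleSin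

@[fun_prop]
lemma measurable_deflection : Measurable deflection := by
  unfold deflection
  exact (Real.measurable_arcsin.const_mul 2).const_sub _

section
variable {α : Type*} [MeasurableSpace α]

@[fun_prop]
lemma Measurable.deflect {h : α → ℝ} {ω : α → S1} (hh : Measurable h) (hω : Measurable ω) :
    Measurable fun a => deflect (h a) (ω a) := by
  unfold LorentzGas.deflect
  have := measurable_deflection.comp hh
  exact hω.add (measurable_coe_circle.comp this)

@[fun_prop]
lemma Measurable.move {x : α → T2} {t : α → ℝ} {ω : α → S1} (hx : Measurable x)
    (ht : Measurable t) (hω : Measurable ω) : Measurable fun a => move (x a) (t a) (ω a) := by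
  unfold LorentzGas.move
  refine measurable_pi_lambda _ fun i => ?_
  exact ((measurable_pi_apply i).comp hx).add
    (measurable_coe_circle.comp (ht.mul ((measurable_dir i).comp hω)))

@[fun_prop]
lemma Measurable.flow {t : α → ℝ} {y : α → Y} (ht : Measurable t) (hy : Measurable y) :
    Measurable fun a => flow (t a) (y a) := by
  unfold LorentzGas.flow
  fun_prop

@[fun_prop]
lemma Measurable.bounce {h : α → ℝ} {y : α → Y} (hh : Measurable h) (hy : Measurable y) :
    Measurable fun a => bounce (h a) (y a) := by
  unfold LorentzGas.bounce
  fun_prop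

end

lemma flow_flow (s t : ℝ) (y : Y) : flow s (flow t y) = flow (t + s) y := by
  refine Prod.ext (funext fun i => ?_) rfl
  simp only [flow, move, add_mul, AddCircle.coe_add, add_assoc]

lemma flow_zero (y : Y) : flow 0 y = y := by
  refine Prod.ext (funext fun i => ?_) rfl
  simp [flow, move]

lemma measurePreserving_flow (t : ℝ) : MeasurePreserving (flow t) := by
  have h : MeasurePreserving (fun p : S1 × T2 => (p.1, move p.2 t p.1)) (volume.prod volume)
      (volume.prod volume) := by
    refine (MeasurePreserving.id volume).skew_product (g := fun ω x => move x t ω) ?_ ?_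
    · simp only [Function.uncurry_def]; fun_prop
    · exact ae_of_all _ fun ω =>
        (measurePreserving_add_right (volume : Measure T2)
          (fun i => ((t * dir ω i : ℝ) : AddCircle (1 : ℝ)))).map_eq
  exact (Measure.measurePreserving_swap.comp h).comp Measure.measurePreserving_swap

lemma measurePreserving_bounce (h : ℝ) : MeasurePreserving (bounce h) := by
  have h1 : MeasurePreserving (deflect h) (volume : Measure S1) volume :=
    measurePreserving_add_right (volume : Measure S1) _
  exact (MeasurePreserving.id (volume : Measure T2)).prod h1

lemma lintegral_flow {f : Y → ℝ≥0∞} (hf : Measurable f) (t : ℝ) :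
    ∫⁻ y, f (flow t y) = ∫⁻ y, f y := (measurePreserving_flow t).lintegral_comp hf

lemma lintegral_bounce {f : Y → ℝ≥0∞} (hf : Measurable f) (h : ℝ) :
    ∫⁻ y, f (bounce h y) = ∫⁻ y, f y := (measurePreserving_bounce h).lintegral_comp hf

lemma deflection_cos {θ : ℝ} (h0 : 0 < θ) (h1 : θ < 2 * Real.pi) :
    deflection (Real.cos (θ / 2)) = θ := by
  rw [deflection, ← Real.sin_pi_div_two_sub, Real.arcsin_sin] <;> linarith

lemma image_cos_half : (fun θ : ℝ => Real.cos (θ / 2)) '' Ioo 0 (2 * Real.pi) = H := by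
  ext h
  constructor
  · rintro ⟨θ, ⟨h0, h1⟩, rfl⟩
    constructor
    · have := Real.cos_lt_cos_of_nonneg_of_le_pi (x := θ / 2) (y := Real.pi) (by linarith) le_rfl
        (by linarith)
      rwa [Real.cos_pi] at this
    · have := Real.cos_lt_cos_of_nonneg_of_le_pi (x := 0) (y := θ / 2) le_rfl (by linarith)
        (by linarith)
      rwa [Real.cos_zero] at this
  · intro hh
    refine ⟨2 * Real.arccos h, ⟨?_, ?_⟩, ?_⟩
    · have := Real.arccos_pos.2 hh.2
      linarith
    · have h1 : Real.arccos h ≠ Real.pi := fun e => by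
        rw [Real.arccos_eq_pi] at e
        linarith [hh.1]
      have := lt_of_le_of_ne (Real.arccos_le_pi h) h1
      linarith
    · simp only
      rw [mul_div_cancel_left₀ _ two_ne_zero, Real.cos_arccos hh.1.le hh.2.le]

/-- A uniformly distributed impact parameter gives the new direction `ω'` the density
`|sin((ω' - ω)/2)| / 2`, which is at least `(1 - cos(ω' - ω)) / 4`. -/
lemma lintegral_deflect_ge (f : S1 → ℝ≥0∞) (ω : S1) :
    ∫⁻ ω', ENNReal.ofReal ((1 - circleCos (ω' - ω)) / 4) * f ω' ≤ ∫⁻ h in H, f (deflect h ω) := by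
  have hpi := Real.two_pi_pos
  have hder : ∀ θ ∈ Ioo 0 (2 * Real.pi), HasDerivWithinAt (fun θ : ℝ => Real.cos (θ / 2))
      (-Real.sin (θ / 2) / 2) (Ioo 0 (2 * Real.pi)) θ := by
    intro θ _
    have := ((hasDerivAt_id θ).div_const 2).cos
    simp only [id] at this
    convert! this.hasDerivWithinAt using 1
    ring
  have hinj : InjOn (fun θ : ℝ => Real.cos (θ / 2)) (Ioo 0 (2 * Real.pi)) := by
    intro a ha b hb hab
    rw [← deflection_cos ha.1 ha.2, ← deflection_cos hb.1 hb.2]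
    exact congrArg deflection hab
  rw [← image_cos_half, lintegral_image_eq_lintegral_abs_deriv_mul measurableSet_Ioo hder hinj]
  have e : ∫⁻ ω', ENNReal.ofReal ((1 - circleCos (ω' - ω)) / 4) * f ω'
      = ∫⁻ θ in Ioo 0 (2 * Real.pi), ENNReal.ofReal ((1 - Real.cos θ) / 4) * f (ω + θ) := by
    rw [← lintegral_add_left_eq_self (μ := (volume : Measure S1))
      (fun ω' => ENNReal.ofReal ((1 - circleCos (ω' - ω)) / 4) * f ω') ω,
      ← AddCircle.lintegral_preimage (2 * Real.pi) 0, zero_add,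
      setLIntegral_congr Ioo_ae_eq_Ioc.symm]
    simp only [add_sub_cancel_left, circleCos_coe]
  rw [e]
  refine setLIntegral_mono' measurableSet_Ioo fun θ hθ => ?_
  rw [deflect, deflection_cos hθ.1 hθ.2]
  gcongr
  have hs0 : 0 ≤ Real.sin (θ / 2) :=
    Real.sin_nonneg_of_nonneg_of_le_pi (by linarith [hθ.1]) (by linarith [hθ.2])
  have hs1 := Real.sin_le_one (θ / 2)
  have hc : Real.cos θ = 1 - 2 * Real.sin (θ / 2) ^ 2 := by
    rw [← Real.cos_two_mul_eq_one_sub, mul_div_cancel₀ θ two_ne_zero]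
  rw [hc, abs_div, abs_neg, abs_of_nonneg hs0, abs_two]
  nlinarith

/-! ### The integral equation along characteristics -/

lemma setLIntegral_Ioo_add (f : ℝ → ℝ≥0∞) (a b c : ℝ) :
    ∫⁻ x in Ioo a b, f (x + c) = ∫⁻ x in Ioo (a + c) (b + c), f x := by
  rw [← lintegral_indicator measurableSet_Ioo, ← lintegral_indicator measurableSet_Ioo,
    ← lintegral_add_right_eq_self ((Ioo (a + c) (b + c)).indicator f) c]
  refine lintegral_congr fun x => ?_
  simp [indicator]

lemma setLIntegral_Ioi_add (f : ℝ → ℝ≥0∞) (a c : ℝ) :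
    ∫⁻ x in Ioi a, f (x + c) = ∫⁻ x in Ioi (a + c), f x := by
  rw [← lintegral_indicator measurableSet_Ioi, ← lintegral_indicator measurableSet_Ioi,
    ← lintegral_add_right_eq_self ((Ioi (a + c)).indicator f) c]
  refine lintegral_congr fun x => ?_
  simp [indicator]

lemma setLIntegral_Ioo_sub (f : ℝ → ℝ≥0∞) (a b c : ℝ) :
    ∫⁻ x in Ioo a b, f (c - x) = ∫⁻ x in Ioo (c - b) (c - a), f x := by
  rw [← lintegral_indicator measurableSet_Ioo, ← lintegral_indicator measurableSet_Ioo,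
    ← lintegral_sub_left_eq_self ((Ioo (c - b) (c - a)).indicator f) c]
  refine lintegral_congr fun x => ?_
  simp only [indicator, mem_Ioo, sub_lt_sub_iff_left, and_comm]

lemma lintegral_triangle_swap {f : ℝ → ℝ → ℝ≥0∞} (hf : Measurable (Function.uncurry f)) (T : ℝ) :
    ∫⁻ t in Ioo 0 T, ∫⁻ τ in Ioo 0 t, f t τ = ∫⁻ τ in Ioo 0 T, ∫⁻ t in Ioo τ T, f t τ := by
  have e1 : ∀ t ∈ Ioo 0 T, ∫⁻ τ in Ioo 0 t, f t τ
      = ∫⁻ τ in Ioo 0 T, {x : ℝ × ℝ | x.2 < x.1}.indicator (Function.uncurry f) (t, τ) := by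
    intro t ht
    rw [← lintegral_indicator measurableSet_Ioo, ← lintegral_indicator measurableSet_Ioo]
    refine lintegral_congr fun τ => ?_
    by_cases h : τ < t
    · simp [indicator, h, h.trans ht.2, Function.uncurry]
    · simp [indicator, h]
  have e2 : ∀ τ ∈ Ioo 0 T, ∫⁻ t in Ioo τ T, f t τ
      = ∫⁻ t in Ioo 0 T, {x : ℝ × ℝ | x.2 < x.1}.indicator (Function.uncurry f) (t, τ) := by
    intro τ hτ
    rw [← lintegral_indicator measurableSet_Ioo, ← lintegral_indicator measurableSet_Ioo]
    refine lintegral_congr fun t => ?_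
    by_cases h : τ < t
    · simp [indicator, h, hτ.1.trans h, Function.uncurry]
    · simp [indicator, h]
  rw [setLIntegral_congr_fun measurableSet_Ioo e1, setLIntegral_congr_fun measurableSet_Ioo e2]
  exact lintegral_lintegral_swap
    ((hf.indicator (measurableSet_lt measurable_snd measurable_fst)).aemeasurable)

/-- The contribution at time `t` of the collisions during `(0, t)`, for the trace `g` on `s = 0`. A
particle that is at `y` at the time `t` and has collided at the time `τ` was then at
`flow (τ - t) y`, with the direction after the collision; `bounce h'` gives the direction that
belongs to the argument of `g` in the collision term. -/
def gain (g : ℝ × Y × ℝ → ℝ≥0∞) (t : ℝ) (y : Y) (s h : ℝ) : ℝ≥0∞ :=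
  ∫⁻ τ in Ioo 0 t, ∫⁻ h' in H, kernel (s + t - τ) h h' * g (τ, bounce h' (flow (τ - t) y), h')

/-- The density at time `t`, given the initial density `u` and the trace `g` on `s = 0`. -/
def evolve (u : Y × ℝ × ℝ → ℝ≥0∞) (g : ℝ × Y × ℝ → ℝ≥0∞) (t : ℝ) (z : Y × ℝ × ℝ) : ℝ≥0∞ :=
  u (flow (-t) z.1, z.2.1 + t, z.2.2) + gain g t z.1 z.2.1 z.2.2

/-- `g` is the trace on `s = 0` of the density that evolves from `u`, for `t ≥ 0` and `h ∈ (-1, 1)`.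
Other values of `g` are never used. -/
def IsTrace (u : Y × ℝ × ℝ → ℝ≥0∞) (g : ℝ × Y × ℝ → ℝ≥0∞) : Prop :=
  ∀ t, 0 ≤ t → ∀ y, ∀ h ∈ H, g (t, y, h) = evolve u g t (y, 0, h)

section
variable {u : Y × ℝ × ℝ → ℝ≥0∞} {g : ℝ × Y × ℝ → ℝ≥0∞}

lemma measurable_gain (hg : Measurable g) :
    Measurable fun p : ℝ × Y × ℝ × ℝ => gain g p.1 p.2.1 p.2.2.1 p.2.2.2 := by
  have hin : Measurable fun q : (ℝ × Y × ℝ × ℝ) × ℝ => ∫⁻ h' in H,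
      kernel (q.1.2.2.1 + q.1.1 - q.2) q.1.2.2.2 h' *
        g (q.2, bounce h' (flow (q.2 - q.1.1) q.1.2.1), h') :=
    Measurable.lintegral_prod_right' (f := fun r : ((ℝ × Y × ℝ × ℝ) × ℝ) × ℝ =>
      kernel (r.1.1.2.2.1 + r.1.1.1 - r.1.2) r.1.1.2.2.2 r.2 *
        g (r.1.2, bounce r.2 (flow (r.1.2 - r.1.1.1) r.1.1.2.1), r.2)) (by fun_prop)
  have hS : MeasurableSet {q : (ℝ × Y × ℝ × ℝ) × ℝ | 0 < q.2 ∧ q.2 < q.1.1} :=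
    (measurableSet_lt (f := fun _ : (ℝ × Y × ℝ × ℝ) × ℝ => (0 : ℝ)) (g := fun q => q.2)
      (by fun_prop) (by fun_prop)).inter (measurableSet_lt (f := fun q : (ℝ × Y × ℝ × ℝ) × ℝ => q.2)
      (g := fun q => q.1.1) (by fun_prop) (by fun_prop))
  have := Measurable.lintegral_prod_right' (ν := volume) (hin.indicator hS)
  convert! this using 2 with p
  rw [gain, ← lintegral_indicator measurableSet_Ioo]
  rfl

@[fun_prop]
lemma Measurable.gain {α : Type*} [MeasurableSpace α] (hg : Measurable g) {t s h : α → ℝ}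
    {y : α → Y} (ht : Measurable t) (hy : Measurable y) (hs : Measurable s) (hh : Measurable h) :
    Measurable fun a => gain g (t a) (y a) (s a) (h a) :=
  (measurable_gain hg).comp (ht.prodMk (hy.prodMk (hs.prodMk hh)))

@[fun_prop]
lemma Measurable.evolve {α : Type*} [MeasurableSpace α] (hu : Measurable u) (hg : Measurable g)
    {t : α → ℝ} {z : α → Y × ℝ × ℝ} (ht : Measurable t) (hz : Measurable z) :
    Measurable fun a => evolve u g (t a) (z a) := by
  unfold LorentzGas.evolve
  fun_prop

lemma gain_mono {g' : ℝ × Y × ℝ → ℝ≥0∞} {t : ℝ}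
    (hgg : ∀ τ, 0 < τ → ∀ y, ∀ h ∈ H, g (τ, y, h) ≤ g' (τ, y, h)) (y : Y) (s h : ℝ) :
    gain g t y s h ≤ gain g' t y s h :=
  setLIntegral_mono' measurableSet_Ioo fun τ hτ => setLIntegral_mono' measurableSet_Ioo
    fun h' hh' => mul_le_mul_right (hgg τ hτ.1 _ h' hh') _

lemma gain_add {g' : ℝ × Y × ℝ → ℝ≥0∞} (hg : Measurable g) (t : ℝ) (y : Y) (s h : ℝ) :
    gain (g + g') t y s h = gain g t y s h + gain g' t y s h := by
  simp only [gain, Pi.add_apply, mul_add]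
  have hm : ∀ τ, Measurable fun h' =>
      kernel (s + t - τ) h h' * g (τ, bounce h' (flow (τ - t) y), h') := fun τ => by fun_prop
  simp_rw [fun τ => lintegral_add_left (μ := volume.restrict H) (hm τ)
    (fun h' => kernel (s + t - τ) h h' * g' (τ, bounce h' (flow (τ - t) y), h'))]
  rw [lintegral_add_left]
  exact Measurable.lintegral_prod_right' (f := fun r : ℝ × ℝ =>
      kernel (s + t - r.1) h r.2 * g (r.1, bounce r.2 (flow (r.1 - t) y), r.2)) (by fun_prop)

lemma gain_iSup {g : ℕ → ℝ × Y × ℝ → ℝ≥0∞} (hg : ∀ n, Measurable (g n)) (hmono : Monotone g)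
    (t : ℝ) (y : Y) (s h : ℝ) :
    gain (fun z => ⨆ n, g n z) t y s h = ⨆ n, gain (g n) t y s h := by
  simp only [gain, ENNReal.mul_iSup]
  rw [← lintegral_iSup]
  · refine lintegral_congr fun τ => ?_
    rw [← lintegral_iSup]
    · intro n; have := hg n; fun_prop
    · intro m n hmn h'
      exact mul_le_mul_right (hmono hmn _) _
  · intro n
    have := hg n
    exact Measurable.lintegral_prod_right' (f := fun r : ℝ × ℝ =>
      kernel (s + t - r.1) h r.2 * g n (r.1, bounce r.2 (flow (r.1 - t) y), r.2)) (by fun_prop)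
  · intro m n hmn τ
    exact lintegral_mono fun h' => mul_le_mul_right (hmono hmn _) _

/-- Picard iterates for the trace. -/
def traceIter (u : Y × ℝ × ℝ → ℝ≥0∞) : ℕ → ℝ × Y × ℝ → ℝ≥0∞
  | 0 => 0
  | n + 1 => fun z => evolve u (traceIter u n) z.1 (z.2.1, 0, z.2.2)

/-- The minimal trace: the increasing limit of the Picard iterates. -/
def minTrace (u : Y × ℝ × ℝ → ℝ≥0∞) : ℝ × Y × ℝ → ℝ≥0∞ := fun z => ⨆ n, traceIter u n z

@[fun_prop]
lemma measurable_traceIter (hu : Measurable u) (n : ℕ) : Measurable (traceIter u n) := by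
  induction n with
  | zero => exact measurable_const
  | succ n ih => simp only [traceIter]; fun_prop

@[fun_prop]
lemma measurable_minTrace (hu : Measurable u) : Measurable (minTrace u) :=
  Measurable.iSup fun n => measurable_traceIter hu n

lemma monotone_traceIter (u : Y × ℝ × ℝ → ℝ≥0∞) : Monotone (traceIter u) := by
  refine monotone_nat_of_le_succ fun n => ?_
  induction n with
  | zero => exact fun z => zero_le
  | succ n ih =>
    intro z
    simp only [traceIter, evolve]
    gcongr
    exact gain_mono (fun τ _ y h _ => ih _) _ _ _

lemma minTrace_eq (hu : Measurable u) (t : ℝ) (y : Y) (h : ℝ) :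
    minTrace u (t, y, h) = evolve u (minTrace u) t (y, 0, h) := by
  rw [evolve]
  unfold minTrace
  have hm : Monotone fun n => traceIter u n (t, y, h) := fun m n hmn => monotone_traceIter u hmn _
  rw [gain_iSup (measurable_traceIter hu) (monotone_traceIter u), ENNReal.add_iSup,
    ← hm.iSup_nat_add 1]
  rfl

lemma isTrace_minTrace (hu : Measurable u) : IsTrace u (minTrace u) :=
  fun t _ y h _ => minTrace_eq hu t y h

/-- The minimal trace lies below every supersolution. -/
lemma minTrace_le (hsup : ∀ t, 0 ≤ t → ∀ y, ∀ h ∈ H, evolve u g t (y, 0, h) ≤ g (t, y, h))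
    {t : ℝ} (ht : 0 ≤ t) (y : Y) {h : ℝ} (hh : h ∈ H) : minTrace u (t, y, h) ≤ g (t, y, h) := by
  refine iSup_le fun n => ?_
  induction n generalizing t y h with
  | zero => exact zero_le
  | succ n ih =>
    refine le_trans ?_ (hsup t ht y h hh)
    simp only [traceIter, evolve]
    gcongr
    exact gain_mono (fun τ hτ y h hh => ih hτ.le y hh) _ _ _

lemma traceIter_add {v : Y × ℝ × ℝ → ℝ≥0∞} (hu : Measurable u) (n : ℕ) :
    traceIter (u + v) n = traceIter u n + traceIter v n := by
  induction n with
  | zero => simp [traceIter]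
  | succ n ih =>
    ext z
    simp only [traceIter, evolve, ih, Pi.add_apply, gain_add (measurable_traceIter hu n)]
    ring

lemma minTrace_add {v : Y × ℝ × ℝ → ℝ≥0∞} (hu : Measurable u) :
    minTrace (u + v) = minTrace u + minTrace v := by
  ext z
  simp only [minTrace, Pi.add_apply, traceIter_add hu]
  exact (ENNReal.iSup_add_iSup_of_monotone (fun m n hmn => monotone_traceIter u hmn z)
    (fun m n hmn => monotone_traceIter v hmn z)).symm

lemma evolve_mono {v : Y × ℝ × ℝ → ℝ≥0∞} {g' : ℝ × Y × ℝ → ℝ≥0∞}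
    (huv : ∀ y, ∀ s, 0 ≤ s → ∀ h ∈ H, u (y, s, h) ≤ v (y, s, h))
    (hgg : ∀ τ, 0 < τ → ∀ y, ∀ h ∈ H, g (τ, y, h) ≤ g' (τ, y, h)) {t : ℝ} (ht : 0 ≤ t) (y : Y)
    {s h : ℝ} (hs : 0 ≤ s) (hh : h ∈ H) : evolve u g t (y, s, h) ≤ evolve v g' t (y, s, h) :=
  add_le_add (huv _ _ (by simp only; linarith) _ hh) (gain_mono hgg _ _ _)

lemma gain_const (M : ℝ≥0∞) (t : ℝ) (y : Y) (s h : ℝ) :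
    gain (fun _ => M) t y s h = M * ∫⁻ r in Ioo s (s + t), ∫⁻ h' in H, kernel r h h' := by
  have hm : Measurable fun r => ∫⁻ h' in H, kernel r h h' :=
    measurable_lintegral_kernel.comp (f := fun r : ℝ => (r, h)) (by fun_prop)
  have := setLIntegral_Ioo_sub (fun r => ∫⁻ h' in H, kernel r h h' * M) 0 t (s + t)
  simp only [gain]
  rw [this, ← lintegral_const_mul _ hm, add_sub_cancel_right, sub_zero]
  refine lintegral_congr fun r => ?_
  rw [lintegral_mul_const _ (by fun_prop), mul_comm]

lemma tail_add_lintegral_Ioo (h : ℝ) {s t : ℝ} (hst : s ≤ t) :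
    tail t h + ∫⁻ r in Ioo s t, ∫⁻ h' in H, kernel r h h' = tail s h := by
  rw [setLIntegral_congr Ioo_ae_eq_Ioc, tail_add_lintegral h hst]

/-- Multiples of the equilibrium are stationary. -/
lemma evolve_tail (M : ℝ≥0∞) {t : ℝ} (ht : 0 ≤ t) (z : Y × ℝ × ℝ) :
    evolve (fun z => M * tail z.2.1 z.2.2) (fun _ => M) t z = M * tail z.2.1 z.2.2 := by
  rw [evolve, gain_const, ← mul_add, tail_add_lintegral_Ioo _ (by linarith)]

lemma minTrace_le_const {M : ℝ≥0∞}
    (hu : ∀ y, ∀ s, 0 ≤ s → ∀ h ∈ H, u (y, s, h) ≤ M * tail s h) {t : ℝ} (ht : 0 ≤ t) (y : Y)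
    {h : ℝ} (hh : h ∈ H) : minTrace u (t, y, h) ≤ M := by
  refine minTrace_le (g := fun _ => M) (fun t ht y h hh => ?_) ht y hh
  calc _ ≤ evolve (fun z => M * tail z.2.1 z.2.2) (fun _ => M) t (y, 0, h) :=
        evolve_mono hu (fun _ _ _ _ _ => le_rfl) ht y le_rfl hh
    _ = M := by rw [evolve_tail M ht, tail_zero hh, mul_one]

lemma evolve_le_tail {M : ℝ≥0∞}
    (hu : ∀ y, ∀ s, 0 ≤ s → ∀ h ∈ H, u (y, s, h) ≤ M * tail s h)
    (hg : ∀ τ, 0 < τ → ∀ y, ∀ h ∈ H, g (τ, y, h) ≤ M) {t : ℝ} (ht : 0 ≤ t) (y : Y)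
    {s h : ℝ} (hs : 0 ≤ s) (hh : h ∈ H) : evolve u g t (y, s, h) ≤ M * tail s h :=
  (evolve_mono hu hg ht y hs hh).trans (evolve_tail M ht (y, s, h)).le

/-- The evolution can be restarted at any time. -/
lemma evolve_evolve (u : Y × ℝ × ℝ → ℝ≥0∞) (g : ℝ × Y × ℝ → ℝ≥0∞) {a t : ℝ} (ha : 0 ≤ a)
    (ht : 0 ≤ t) (z : Y × ℝ × ℝ) :
    evolve (evolve u g a) (fun z => g (a + z.1, z.2)) t z = evolve u g (a + t) z := by
  obtain ⟨y, s, h⟩ := z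
  simp only [evolve, flow_flow]
  rw [add_assoc, show -t + -a = -(a + t) by ring, show s + t + a = s + (a + t) by ring]
  congr 1
  have hsplit : Ioo 0 (a + t) =ᵐ[volume] (Ioo 0 a ∪ Ioo a (a + t) : Set ℝ) := by
    filter_upwards [compl_mem_ae_iff.2 (measure_singleton (μ := volume) a)] with x hx
    have hx' : x ≠ a := hx
    refine propext ⟨fun hxH => ?_, fun hxU => ?_⟩
    · rcases lt_or_gt_of_ne hx' with h5 | h5
      · exact Or.inl ⟨hxH.1, h5⟩
      · exact Or.inr ⟨h5, hxH.2⟩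
    · rcases hxU with h5 | h5
      · exact ⟨h5.1, by linarith [h5.2]⟩
      · exact ⟨by linarith [h5.1], h5.2⟩
  simp only [gain]
  rw [setLIntegral_congr hsplit, lintegral_union measurableSet_Ioo]
  swap
  · exact Set.disjoint_left.2 fun x hx hx' => absurd hx.2 (not_lt.2 hx'.1.le)
  congr 1
  · refine lintegral_congr fun τ => lintegral_congr fun h' => ?_
    rw [flow_flow, show -t + (τ - a) = τ - (a + t) by ring,
      show s + t + a - τ = s + (a + t) - τ by ring]
  · have := setLIntegral_Ioo_add (fun τ => ∫⁻ h' in H, kernel (s + (a + t) - τ) h h' *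
      g (τ, bounce h' (flow (τ - (a + t)) y), h')) 0 t a
    rw [zero_add, add_comm t a] at this
    rw [← this]
    refine lintegral_congr fun τ => lintegral_congr fun h' => ?_
    rw [show s + (a + t) - (τ + a) = s + t - τ by ring, show τ + a - (a + t) = τ - t by ring,
      add_comm a τ]

lemma IsTrace.shift (hg : IsTrace u g) {a : ℝ} (ha : 0 ≤ a) :
    IsTrace (evolve u g a) (fun z => g (a + z.1, z.2)) := by
  intro t ht y h hh
  rw [evolve_evolve u g ha ht]
  exact hg (a + t) (by linarith) y h hh

end

/-! ### Conservation of mass -/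

/-- The measure `dx dω ds dh` on the phase space, with the positions and directions grouped, and
with null boundaries left out. -/
def phase : Measure (Y × ℝ × ℝ) :=
  (volume : Measure Y).prod ((volume.restrict (Ioi (0 : ℝ))).prod (volume.restrict H))

instance : SFinite phase := by unfold phase; infer_instance

lemma lintegral_prod_prod {ρ : Measure ℝ} [SFinite ρ] {f : Y × ℝ × ℝ → ℝ≥0∞} (hf : Measurable f) :
    ∫⁻ w, f w ∂((volume : Measure Y).prod (ρ.prod (volume.restrict H)))
      = ∫⁻ s, (∫⁻ h in H, ∫⁻ y, f (y, s, h)) ∂ρ := by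
  have hm : Measurable fun p : ℝ × ℝ => ∫⁻ y, f (y, p.1, p.2) :=
    Measurable.lintegral_prod_right' (f := fun r : (ℝ × ℝ) × Y => f (r.2, r.1.1, r.1.2))
      (by fun_prop)
  rw [lintegral_prod_symm _ hf.aemeasurable, lintegral_prod _ hm.aemeasurable]

lemma lintegral_phase {f : Y × ℝ × ℝ → ℝ≥0∞} (hf : Measurable f) :
    ∫⁻ z, f z ∂phase = ∫⁻ s in Ioi (0 : ℝ), ∫⁻ h in H, ∫⁻ y, f (y, s, h) :=
  lintegral_prod_prod hf

lemma ae_phase : ∀ᵐ z ∂phase, 0 < z.2.1 ∧ z.2.2 ∈ H := by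
  have h1 : ∀ᵐ p : ℝ × ℝ ∂((volume.restrict (Ioi (0 : ℝ))).prod (volume.restrict H)),
      0 < p.1 ∧ p.2 ∈ H := by
    rw [Measure.prod_restrict]
    filter_upwards [ae_restrict_mem (measurableSet_Ioi.prod measurableSet_Ioo)] with p hp
    exact hp
  exact Measure.quasiMeasurePreserving_snd.ae h1

lemma lintegral_phase_tail_lt_top (M : ℝ≥0∞) (hM : M ≠ ∞) :
    ∫⁻ z, M * tail z.2.1 z.2.2 ∂phase < ∞ := by
  rw [lintegral_phase (by fun_prop)]
  have e : ∀ s h, ∫⁻ _ : Y, M * tail s h = M * volume (univ : Set Y) * tail s h := fun s h => by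
    rw [lintegral_const]; ring
  simp only [e]
  have hc : M * volume (univ : Set Y) ≠ ∞ := ENNReal.mul_ne_top hM (measure_ne_top _ _)
  simp_rw [fun s => lintegral_const_mul' (μ := volume.restrict H) _ (fun h => tail s h) hc]
  rw [lintegral_const_mul' _ _ hc]
  exact ENNReal.mul_lt_top hc.lt_top lintegral_tail_lt_top

section
variable {u : Y × ℝ × ℝ → ℝ≥0∞} {g : ℝ × Y × ℝ → ℝ≥0∞}

/-- The flux `∫ g(τ, y, h') dy` through the boundary `s = 0`. -/
def flux (g : ℝ × Y × ℝ → ℝ≥0∞) (τ h' : ℝ) : ℝ≥0∞ := ∫⁻ y, g (τ, y, h')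

lemma measurable_flux' (hg : Measurable g) : Measurable fun p : ℝ × ℝ => flux g p.1 p.2 :=
  Measurable.lintegral_prod_right' (f := fun r : (ℝ × ℝ) × Y => g (r.1.1, r.2, r.1.2))
      (by fun_prop)

@[fun_prop]
lemma Measurable.flux {α : Type*} [MeasurableSpace α] (hg : Measurable g) {t h : α → ℝ}
    (ht : Measurable t) (hh : Measurable h) : Measurable fun a => flux g (t a) (h a) :=
  (measurable_flux' hg).comp (ht.prodMk hh)

lemma lintegral_gain (hg : Measurable g) (t s h : ℝ) :
    ∫⁻ y, gain g t y s h
      = ∫⁻ τ in Ioo 0 t, ∫⁻ h' in H, kernel (s + t - τ) h h' * flux g τ h' := by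
  simp only [gain]
  have hm : Measurable fun q : (Y × ℝ) × ℝ =>
      kernel (s + t - q.1.2) h q.2 * g (q.1.2, bounce q.2 (flow (q.1.2 - t) q.1.1), q.2) := by
    fun_prop
  rw [lintegral_lintegral_swap]
  swap
  · exact (Measurable.lintegral_prod_right' hm).aemeasurable
  refine lintegral_congr fun τ => ?_
  rw [lintegral_lintegral_swap]
  swap
  · exact Measurable.aemeasurable (by simp only [Function.uncurry_def]; fun_prop)
  refine lintegral_congr fun h' => ?_
  rw [lintegral_const_mul _ (by fun_prop), flux, lintegral_flow
    (f := fun y => g (τ, bounce h' y, h')) (by fun_prop), lintegral_bounce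
    (f := fun y => g (τ, y, h')) (by fun_prop)]

/-- The part of the gain that has not reached `s = 0` at time `t`. -/
lemma lintegral_phase_gain (hg : Measurable g) (t : ℝ) :
    ∫⁻ z, gain g t z.1 z.2.1 z.2.2 ∂phase
      = ∫⁻ τ in Ioo 0 t, ∫⁻ h' in H, tail (t - τ) h' * flux g τ h' := by
  rw [lintegral_phase (by fun_prop)]
  simp only [lintegral_gain hg]
  have m4 : Measurable fun q : ((ℝ × ℝ) × ℝ) × ℝ =>
      kernel (q.1.1.1 + t - q.1.2) q.1.1.2 q.2 * flux g q.1.2 q.2 := by fun_prop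
  have m3 := Measurable.lintegral_prod_right' (ν := volume.restrict H) m4
  have hswap : ∀ s, ∫⁻ h in H, ∫⁻ τ in Ioo 0 t, ∫⁻ h' in H,
      kernel (s + t - τ) h h' * flux g τ h' = ∫⁻ τ in Ioo 0 t, ∫⁻ h' in H,
        (∫⁻ h in H, kernel (s + t - τ) h h') * flux g τ h' := by
    intro s
    rw [lintegral_lintegral_swap]
    · refine lintegral_congr fun τ => ?_
      rw [lintegral_lintegral_swap]
      · refine lintegral_congr fun h' => ?_
        rw [lintegral_mul_const _ (by fun_prop)]
      · exact Measurable.aemeasurable (by simp only [Function.uncurry_def]; fun_prop)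
    · exact (m3.comp (f := fun q : ℝ × ℝ => ((s, q.1), q.2)) (by fun_prop)).aemeasurable
  simp only [hswap]
  have k3 : Measurable fun q : (ℝ × ℝ) × ℝ => ∫⁻ h in H, kernel (q.1.1 + t - q.1.2) h q.2 :=
    Measurable.lintegral_prod_right' (f := fun q : ((ℝ × ℝ) × ℝ) × ℝ =>
      kernel (q.1.1.1 + t - q.1.1.2) q.2 q.1.2) (by fun_prop)
  have k3' : Measurable fun q : (ℝ × ℝ) × ℝ => (∫⁻ h in H, kernel (q.1.1 + t - q.1.2) h q.2) *
      flux g q.1.2 q.2 := by fun_prop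
  rw [lintegral_lintegral_swap]
  swap
  · exact (Measurable.lintegral_prod_right' k3').aemeasurable
  refine lintegral_congr fun τ => ?_
  rw [lintegral_lintegral_swap]
  swap
  · exact (k3'.comp (f := fun q : ℝ × ℝ => ((q.1, τ), q.2)) (by fun_prop)).aemeasurable
  refine lintegral_congr fun h' => ?_
  have k1 : Measurable fun s => ∫⁻ h in H, kernel (s + t - τ) h h' :=
    k3.comp (f := fun s : ℝ => ((s, τ), h')) (by fun_prop)
  rw [lintegral_mul_const _ k1]
  congr 1
  simp only [kernel_symm _ _ h', add_sub_assoc]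
  rw [setLIntegral_Ioi_add (fun r => ∫⁻ h in H, kernel r h' h), zero_add, tail]

/-- The part of the gain that comes back to `s = 0` before the time `T`. -/
lemma lintegral_trace_gain (hg : Measurable g) (T : ℝ) :
    ∫⁻ t in Ioo 0 T, ∫⁻ h in H, ∫⁻ y, gain g t y 0 h
      = ∫⁻ τ in Ioo 0 T, ∫⁻ h' in H,
        (∫⁻ r in Ioo 0 (T - τ), ∫⁻ h in H, kernel r h' h) * flux g τ h' := by
  simp only [lintegral_gain hg, zero_add]
  have m4 : Measurable fun q : ((ℝ × ℝ) × ℝ) × ℝ =>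
      kernel (q.1.1.1 - q.1.2) q.1.1.2 q.2 * flux g q.1.2 q.2 := by fun_prop
  have m3 := Measurable.lintegral_prod_right' (ν := volume.restrict H) m4
  have hswap : ∀ t, ∫⁻ h in H, ∫⁻ τ in Ioo 0 t, ∫⁻ h' in H,
      kernel (t - τ) h h' * flux g τ h' = ∫⁻ τ in Ioo 0 t, ∫⁻ h' in H,
        (∫⁻ h in H, kernel (t - τ) h h') * flux g τ h' := by
    intro t
    rw [lintegral_lintegral_swap]
    · refine lintegral_congr fun τ => ?_
      rw [lintegral_lintegral_swap]
      · refine lintegral_congr fun h' => ?_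
        rw [lintegral_mul_const _ (by fun_prop)]
      · exact Measurable.aemeasurable (by simp only [Function.uncurry_def]; fun_prop)
    · exact (m3.comp (f := fun q : ℝ × ℝ => ((t, q.1), q.2)) (by fun_prop)).aemeasurable
  simp only [hswap]
  have k3 : Measurable fun q : (ℝ × ℝ) × ℝ => ∫⁻ h in H, kernel (q.1.1 - q.1.2) h q.2 :=
    Measurable.lintegral_prod_right' (f := fun q : ((ℝ × ℝ) × ℝ) × ℝ =>
      kernel (q.1.1.1 - q.1.1.2) q.2 q.1.2) (by fun_prop)
  have k3' : Measurable fun q : (ℝ × ℝ) × ℝ => (∫⁻ h in H, kernel (q.1.1 - q.1.2) h q.2) *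
      flux g q.1.2 q.2 := by fun_prop
  rw [lintegral_triangle_swap (f := fun t τ => ∫⁻ h' in H,
    (∫⁻ h in H, kernel (t - τ) h h') * flux g τ h') (Measurable.lintegral_prod_right' k3')]
  refine lintegral_congr fun τ => ?_
  rw [lintegral_lintegral_swap]
  swap
  · exact (k3'.comp (f := fun q : ℝ × ℝ => ((q.1, τ), q.2)) (by fun_prop)).aemeasurable
  refine lintegral_congr fun h' => ?_
  have k1 : Measurable fun s => ∫⁻ h in H, kernel (s - τ) h h' :=
    k3.comp (f := fun s : ℝ => ((s, τ), h')) (by fun_prop)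
  rw [lintegral_mul_const _ k1]
  congr 1
  simp only [kernel_symm _ _ h', sub_eq_add_neg]
  rw [setLIntegral_Ioo_add (fun r => ∫⁻ h in H, kernel r h' h), add_neg_cancel]

/-- Conservation of mass: what leaves through `s = 0` during `(0, T)` is, by the normalization of
the kernel, what is created by collisions. -/
theorem lintegral_evolve (hu : Measurable u) (hg : Measurable g) (hug : IsTrace u g) {T : ℝ}
    (hT : 0 ≤ T) (hfin : ∫⁻ t in Ioo 0 T, ∫⁻ h in H, flux g t h ≠ ∞) :
    ∫⁻ z, evolve u g T z ∂phase = ∫⁻ z, u z ∂phase := by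
  set w : ℝ → ℝ≥0∞ := fun s => ∫⁻ h in H, ∫⁻ y, u (y, s, h) with hw
  have hU : ∀ t h s, ∫⁻ y, u (flow (-t) y, s, h) = ∫⁻ y, u (y, s, h) := fun t h s =>
    lintegral_flow (f := fun y => u (y, s, h)) (by fun_prop) _
  -- the outgoing mass
  have hout : ∫⁻ t in Ioo 0 T, ∫⁻ h in H, flux g t h
      = (∫⁻ s in Ioo 0 T, w s) + ∫⁻ τ in Ioo 0 T, ∫⁻ h' in H,
        (∫⁻ r in Ioo 0 (T - τ), ∫⁻ h in H, kernel r h' h) * flux g τ h' := by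
    rw [← lintegral_trace_gain hg, ← lintegral_add_right]
    · refine setLIntegral_congr_fun measurableSet_Ioo fun t ht => ?_
      simp only [hw]
      rw [← lintegral_add_right]
      · refine setLIntegral_congr_fun measurableSet_Ioo fun h hh => ?_
        simp only [flux]
        rw [← hU t h t, ← lintegral_add_right _ (by fun_prop)]
        refine lintegral_congr fun y => ?_
        rw [hug t ht.1.le y h hh, evolve, zero_add]
      · exact Measurable.lintegral_prod_right' (f := fun q : ℝ × Y => gain g t q.2 0 q.1)
          (by fun_prop)
    · refine Measurable.lintegral_prod_right' (f := fun p : ℝ × ℝ => ∫⁻ y, gain g p.1 y 0 p.2) ?_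
      exact Measurable.lintegral_prod_right'
        (f := fun q : (ℝ × ℝ) × Y => gain g q.1.1 q.2 0 q.1.2) (by fun_prop)
  -- splitting the flux according to whether the particle is still in flight at time `T`
  have hsplit : ∫⁻ t in Ioo 0 T, ∫⁻ h in H, flux g t h
      = (∫⁻ τ in Ioo 0 T, ∫⁻ h' in H, tail (T - τ) h' * flux g τ h') +
        ∫⁻ τ in Ioo 0 T, ∫⁻ h' in H,
        (∫⁻ r in Ioo 0 (T - τ), ∫⁻ h in H, kernel r h' h) * flux g τ h' := by
    have m2 : Measurable fun q : ℝ × ℝ => tail (T - q.1) q.2 * flux g q.1 q.2 := by fun_prop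
    rw [← lintegral_add_left (Measurable.lintegral_prod_right' m2)]
    refine setLIntegral_congr_fun measurableSet_Ioo fun τ hτ => ?_
    rw [← lintegral_add_left (by fun_prop)]
    refine setLIntegral_congr_fun measurableSet_Ioo fun h' hh' => ?_
    simp only
    rw [← add_mul, tail_add_lintegral_Ioo _ (by linarith [hτ.2]), tail_zero hh', one_mul]
  have hcancel : ∫⁻ s in Ioo 0 T, w s
      = ∫⁻ τ in Ioo 0 T, ∫⁻ h' in H, tail (T - τ) h' * flux g τ h' := by
    refine (ENNReal.add_left_inj ?_).1 (hout.symm.trans hsplit)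
    refine ne_top_of_le_ne_top hfin ?_
    rw [hout]
    exact le_add_self
  have hsp : Ioi (0 : ℝ) =ᵐ[volume] (Ioo 0 T ∪ Ioi T : Set ℝ) := by
    filter_upwards [compl_mem_ae_iff.2 (measure_singleton (μ := volume) T)] with x hx
    have hx' : x ≠ T := hx
    refine propext ⟨fun hxH => ?_, fun hxU => ?_⟩
    · rcases lt_or_gt_of_ne hx' with h5 | h5
      · exact Or.inl ⟨hxH, h5⟩
      · exact Or.inr h5
    · rcases hxU with h5 | h5
      · exact h5.1
      · exact lt_of_le_of_lt hT h5
  have e1 : ∫⁻ z, evolve u g T z ∂phase = (∫⁻ s in Ioi T, w s) +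
      ∫⁻ τ in Ioo 0 T, ∫⁻ h' in H, tail (T - τ) h' * flux g τ h' := by
    simp only [evolve]
    rw [lintegral_add_right _ (by fun_prop), lintegral_phase_gain hg]
    congr 1
    rw [lintegral_phase (by fun_prop)]
    simp only [hU]
    rw [setLIntegral_Ioi_add w, zero_add]
  rw [e1, ← hcancel, lintegral_phase hu, setLIntegral_congr hsp,
    lintegral_union measurableSet_Ioi, add_comm]
  exact Set.disjoint_left.2 fun x hx hx' => absurd hx.2 (not_lt.2 (le_of_lt hx'))

end

/-! ### Three flights spread the particles -/

/-- Space-time displacements, with the sup norm. -/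
abbrev V : Type := ℝ × (Fin 2 → ℝ)

/-- The unit vector with polar angle `x ∈ ℝ`. -/
def unitVec (x : ℝ) : Fin 2 → ℝ := ![Real.cos x, Real.sin x]

lemma unitVec_eq_dir (x : ℝ) : unitVec x = dir (x : S1) := rfl

/-- The flights have directions at angles within `1/20` of `2π/3`, where the cosine is about `-1/2`
and the sine about `√3/2`. -/
lemma cos_sin_near {a : ℝ} (ha : |a - 2 * Real.pi / 3| ≤ 1 / 20) :
    Real.cos a ∈ Icc (-(3 / 5) : ℝ) (-(2 / 5)) ∧ Real.sin a ∈ Icc (4 / 5 : ℝ) (93 / 100) := by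
  set e := a - 2 * Real.pi / 3 with he
  have hae : a = Real.pi - Real.pi / 3 + e := by rw [he]; ring
  have h1 : |Real.sin e| ≤ 1 / 20 := (Real.abs_sin_le_abs).trans ha
  have h2 : 1 - 1 / 800 ≤ Real.cos e := by
    have := Real.one_sub_sq_div_two_le_cos (x := e)
    have h3 : e ^ 2 ≤ (1 / 20) ^ 2 := sq_le_sq' (by linarith [(abs_le.1 ha).1]) (abs_le.1 ha).2
    linarith
  have h4 := Real.cos_le_one e
  have s3 : (0 : ℝ) ≤ √3 := Real.sqrt_nonneg 3
  have s3' : √3 ^ 2 = 3 := Real.sq_sqrt (by norm_num)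
  have s1 : √3 ≤ 1.7321 := by
    rw [Real.sqrt_le_left (by norm_num)]; norm_num
  have s2 : 1.732 ≤ √3 := by
    apply Real.le_sqrt_of_sq_le; norm_num
  obtain ⟨h5, h6⟩ := abs_le.1 h1
  have hc : Real.cos a = -(1 / 2) * Real.cos e - √3 / 2 * Real.sin e := by
    rw [hae, Real.cos_add, Real.cos_pi_sub, Real.sin_pi_sub, Real.cos_pi_div_three,
      Real.sin_pi_div_three]
  have hs : Real.sin a = √3 / 2 * Real.cos e - 1 / 2 * Real.sin e := by
    rw [hae, Real.sin_add, Real.cos_pi_sub, Real.sin_pi_sub, Real.cos_pi_div_three,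
      Real.sin_pi_div_three]
    ring
  have p1 := mul_le_mul s2 h2 (by norm_num) s3
  have p2 := mul_le_mul s1 h4 (by linarith) (by norm_num)
  have p3 : |√3 * Real.sin e| ≤ 1.7321 * (1 / 20) := by
    rw [abs_mul, abs_of_nonneg s3]
    exact mul_le_mul s1 h1 (abs_nonneg _) (by norm_num)
  obtain ⟨p4, p5⟩ := abs_le.1 p3
  rw [hc, hs]
  refine ⟨⟨?_, ?_⟩, ?_, ?_⟩ <;> linarith

/-- The times of three flights in directions at angles of about `2π/3` are determined by the total
time and the total displacement, and lie in `(0, 1/2)` if these are near `3/4` and `0`. -/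
lemma flight_times_mem {c d C₁ S₁ C₂ S₂ r₁ r₂ r₃ : ℝ} (hcd : c ^ 2 + d ^ 2 = 1)
    (hC₁ : C₁ ∈ Icc (-(3 / 5) : ℝ) (-(2 / 5))) (hS₁ : S₁ ∈ Icc (4 / 5 : ℝ) (93 / 100))
    (hC₂ : C₂ ∈ Icc (-(3 / 5) : ℝ) (-(2 / 5))) (hS₂ : S₂ ∈ Icc (4 / 5 : ℝ) (93 / 100))
    (ht : |r₁ + r₂ + r₃ - 3 / 4| < 1 / 200)
    (hx : |r₁ * (c * C₁ - d * S₁) + r₂ * (c * C₂ + d * S₂) + r₃ * c| < 1 / 200)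
    (hy : |r₁ * (d * C₁ + c * S₁) + r₂ * (d * C₂ - c * S₂) + r₃ * d| < 1 / 200) :
    r₁ ∈ Ioo (0 : ℝ) (1 / 2) ∧ r₂ ∈ Ioo (0 : ℝ) (1 / 2) ∧ r₃ ∈ Ioo (0 : ℝ) (1 / 2) := by
  obtain ⟨a1, a2⟩ := hC₁
  obtain ⟨a3, a4⟩ := hS₁
  obtain ⟨a5, a6⟩ := hC₂
  obtain ⟨a7, a8⟩ := hS₂
  have hc : |c| ≤ 1 := abs_le_one_iff_mul_self_le_one.2 (by nlinarith [sq_nonneg d])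
  have hd : |d| ≤ 1 := abs_le_one_iff_mul_self_le_one.2 (by nlinarith [sq_nonneg c])
  set X := r₁ * (c * C₁ - d * S₁) + r₂ * (c * C₂ + d * S₂) + r₃ * c with hX
  set Z := r₁ * (d * C₁ + c * S₁) + r₂ * (d * C₂ - c * S₂) + r₃ * d with hZ
  -- coordinates along and across the direction `(c, d)`
  have e1 : c * X + d * Z = r₁ * C₁ + r₂ * C₂ + r₃ := by
    rw [hX, hZ]
    linear_combination (r₁ * C₁ + r₂ * C₂ + r₃) * hcd
  have e2 : c * Z - d * X = r₁ * S₁ - r₂ * S₂ := by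
    rw [hX, hZ]
    linear_combination (r₁ * S₁ - r₂ * S₂) * hcd
  have bound : ∀ p q : ℝ, |p| ≤ 1 → |q| < 1 / 200 → |p * q| ≤ 1 / 200 := by
    intro p q hp hq
    rw [abs_mul]
    nlinarith [abs_nonneg p, abs_nonneg q]
  have b1 := abs_le.1 (bound c X hc hx)
  have b2 := abs_le.1 (bound d Z hd hy)
  have b3 := abs_le.1 (bound c Z hc hy)
  have b4 := abs_le.1 (bound d X hd hx)
  have b5 := abs_lt.1 ht
  clear_value X Z
  obtain ⟨A, hA⟩ : ∃ A, A = c * X + d * Z := ⟨_, rfl⟩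
  obtain ⟨B, hB⟩ : ∃ B, B = c * Z - d * X := ⟨_, rfl⟩
  rw [← hA] at e1
  rw [← hB] at e2
  have hA1 : |A| ≤ 1 / 100 :=
    abs_le.2 ⟨by linarith only [hA, b1.1, b2.1], by linarith only [hA, b1.2, b2.2]⟩
  have hB1 : |B| ≤ 1 / 100 :=
    abs_le.2 ⟨by linarith only [hB, b3.1, b4.2], by linarith only [hB, b3.2, b4.1]⟩
  obtain ⟨W, hW⟩ : ∃ W, W = r₁ + r₂ + r₃ - A := ⟨_, rfl⟩
  have hA2 := abs_le.1 hA1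
  have hW1 : 7 / 10 ≤ W ∧ W ≤ 8 / 10 :=
    ⟨by linarith only [hW, b5.1, hA2.2], by linarith only [hW, b5.2, hA2.1]⟩
  have e3 : W = r₁ * (1 - C₁) + r₂ * (1 - C₂) := by rw [hW, e1]; ring
  clear hx hy hX hZ b1 b2 b3 b4 bound
  obtain ⟨D, hD⟩ : ∃ D, D = (1 - C₁) * S₂ + (1 - C₂) * S₁ := ⟨_, rfl⟩
  have n1 : (1.4 : ℝ) ≤ 1 - C₁ ∧ 1 - C₁ ≤ 1.6 := ⟨by linarith only [a2], by linarith only [a1]⟩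
  have n2 : (1.4 : ℝ) ≤ 1 - C₂ ∧ 1 - C₂ ≤ 1.6 := ⟨by linarith only [a6], by linarith only [a5]⟩
  have hD1 : 2.24 ≤ D := by
    have p1 := mul_le_mul n1.1 a7 (by norm_num) (by linarith only [n1.1])
    have p2 := mul_le_mul n2.1 a3 (by norm_num) (by linarith only [n2.1])
    linarith only [p1, p2, hD]
  have hD2 : D ≤ 2.976 := by
    have p1 := mul_le_mul n1.2 a8 (by linarith only [a7]) (by norm_num)
    have p2 := mul_le_mul n2.2 a4 (by linarith only [a3]) (by norm_num)
    linarith only [p1, p2, hD]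
  have f1 : r₁ * D = W * S₂ + B * (1 - C₂) := by rw [e3, e2, hD]; ring
  have f2 : r₂ * D = W * S₁ - B * (1 - C₁) := by rw [e3, e2, hD]; ring
  have hBC : ∀ C : ℝ, (1.4 : ℝ) ≤ 1 - C ∧ 1 - C ≤ 1.6 → |B * (1 - C)| ≤ 0.016 := by
    intro C hC
    have h0 : 0 < 1 - C := by linarith only [hC.1]
    rw [abs_mul, abs_of_pos h0]
    have := mul_le_mul hB1 hC.2 h0.le (by norm_num)
    linarith only [this]
  have hWS : ∀ S : ℝ, 4 / 5 ≤ S → S ≤ 93 / 100 → 0.56 ≤ W * S ∧ W * S ≤ 0.744 := by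
    intro S h1 h2
    have p1 := mul_le_mul hW1.1 h1 (by norm_num) (by linarith only [hW1.1])
    have p2 := mul_le_mul hW1.2 h2 (by linarith only [h1]) (by norm_num)
    exact ⟨by linarith only [p1], by linarith only [p2]⟩
  have c1 := abs_le.1 (hBC C₁ n1)
  have c2 := abs_le.1 (hBC C₂ n2)
  have c3 := hWS S₁ a3 a4
  have c4 := hWS S₂ a7 a8
  have hD0 : 0 < D := by linarith only [hD1]
  have g1 : 0.54 ≤ r₁ * D ∧ r₁ * D ≤ 0.761 :=
    ⟨by rw [f1]; linarith only [c4.1, c2.1], by rw [f1]; linarith only [c4.2, c2.2]⟩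
  have g2 : 0.54 ≤ r₂ * D ∧ r₂ * D ≤ 0.761 :=
    ⟨by rw [f2]; linarith only [c3.1, c1.2], by rw [f2]; linarith only [c3.2, c1.1]⟩
  have k1 : 0.18 ≤ r₁ ∧ r₁ ≤ 0.34 :=
    ⟨le_of_mul_le_mul_right (by linarith only [g1.1, hD2]) hD0,
      le_of_mul_le_mul_right (by linarith only [g1.2, hD1]) hD0⟩
  have k2 : 0.18 ≤ r₂ ∧ r₂ ≤ 0.34 :=
    ⟨le_of_mul_le_mul_right (by linarith only [g2.1, hD2]) hD0,
      le_of_mul_le_mul_right (by linarith only [g2.2, hD1]) hD0⟩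
  refine ⟨⟨by linarith only [k1.1], by linarith only [k1.2]⟩,
    ⟨by linarith only [k2.1], by linarith only [k2.2]⟩,
    by linarith only [hW, hW1.1, hA2.1, k1.2, k2.2], by linarith only [b5.2, k1.1, k2.1]⟩

instance : (volume : Measure V).IsAddHaarMeasure :=
  inferInstanceAs ((volume : Measure ℝ).prod (volume : Measure (Fin 2 → ℝ))).IsAddHaarMeasure

lemma lintegral_fin_three {F : (Fin 3 → ℝ) → ℝ≥0∞} (hF : Measurable F) :
    ∫⁻ r, F r = ∫⁻ r₁, ∫⁻ r₂, ∫⁻ r₃, F ![r₁, r₂, r₃] := by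
  have e1 := (volume_preserving_piFinSuccAbove (fun _ : Fin 3 => ℝ) 0).symm.lintegral_comp hF
  rw [← e1, Measure.volume_eq_prod, lintegral_prod _ (by fun_prop)]
  refine lintegral_congr fun r₁ => ?_
  have e2 := (volume_preserving_finTwoArrow ℝ).symm.lintegral_comp
    (f := fun q => F ((MeasurableEquiv.piFinSuccAbove (fun _ : Fin 3 => ℝ) 0).symm (r₁, q)))
    (by fun_prop)
  rw [← e2, Measure.volume_eq_prod, lintegral_prod _ (by fun_prop)]
  refine lintegral_congr fun r₂ => lintegral_congr fun r₃ => ?_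
  congr 1
  ext i
  fin_cases i <;> rfl

lemma lintegral_V {F : V → ℝ≥0∞} (hF : Measurable F) :
    ∫⁻ p, F p = ∫⁻ r : Fin 3 → ℝ, F (r 0, ![r 1, r 2]) := by
  have e1 := (volume_preserving_piFinSuccAbove (fun _ : Fin 3 => ℝ) 0).lintegral_comp hF
  rw [← e1]
  refine lintegral_congr fun r => ?_
  congr 1
  refine Prod.ext rfl (funext fun i => ?_)
  fin_cases i <;> rfl

/-- Three flights with independent uniform durations in `(0, 1/2)` in directions at angles of about
`2π/3` spread a point over a box: their total time and displacement depend linearly on the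
durations, with a determinant between `0` and `3`. -/
lemma lintegral_three_flights {φ a b : ℝ} (ha : |a - 2 * Real.pi / 3| ≤ 1 / 20)
    (hb : |b - 2 * Real.pi / 3| ≤ 1 / 20) {F : V → ℝ≥0∞} (hF : Measurable F) :
    ENNReal.ofReal (1 / 3) * ∫⁻ p in Metric.ball (0 : V) (1 / 200), F (3 / 4 + p.1, p.2)
      ≤ ∫⁻ r₁ in Ioo (0 : ℝ) (1 / 2), ∫⁻ r₂ in Ioo (0 : ℝ) (1 / 2), ∫⁻ r₃ in Ioo (0 : ℝ) (1 / 2),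
        F (r₁ + r₂ + r₃, r₁ • unitVec (φ + a) + r₂ • unitVec (φ - b) + r₃ • unitVec φ) := by
  obtain ⟨hC₁, hS₁⟩ := cos_sin_near ha
  obtain ⟨hC₂, hS₂⟩ := cos_sin_near hb
  have hcd := Real.cos_sq_add_sin_sq φ
  set M : Matrix (Fin 3) (Fin 3) ℝ := !![1, 1, 1;
    Real.cos (φ + a), Real.cos (φ - b), Real.cos φ;
    Real.sin (φ + a), Real.sin (φ - b), Real.sin φ] with hM
  have hdet : M.det = (1 - Real.cos a) * Real.sin b + (1 - Real.cos b) * Real.sin a := by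
    rw [hM, Matrix.det_fin_three]
    simp only [Matrix.of_apply, Matrix.cons_val', Matrix.cons_val_zero, Matrix.cons_val_one,
      Matrix.cons_val, Real.cos_add, Real.cos_sub, Real.sin_add, Real.sin_sub]
    linear_combination ((1 - Real.cos a) * Real.sin b + (1 - Real.cos b) * Real.sin a) * hcd
  obtain ⟨a1, a2⟩ := hC₁
  obtain ⟨a3, a4⟩ := hS₁
  obtain ⟨a5, a6⟩ := hC₂
  obtain ⟨a7, a8⟩ := hS₂
  have hdet1 : 0 < M.det := by
    rw [hdet]
    exact add_pos (mul_pos (by linarith) (by linarith)) (mul_pos (by linarith) (by linarith))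
  have hdet2 : M.det ≤ 3 := by
    rw [hdet]
    have p1 := mul_le_mul (by linarith : 1 - Real.cos a ≤ 1.6) a8 (by linarith) (by norm_num)
    have p2 := mul_le_mul (by linarith : 1 - Real.cos b ≤ 1.6) a4 (by linarith) (by norm_num)
    linarith
  set G : V → ℝ≥0∞ := (Metric.ball ((3 / 4, 0) : V) (1 / 200)).indicator F with hG
  have hGm : Measurable G := hF.indicator Metric.isOpen_ball.measurableSet
  set A : (Fin 3 → ℝ) → V := fun r => (Matrix.toLin' M r 0, ![Matrix.toLin' M r 1,
    Matrix.toLin' M r 2]) with hA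
  have hAm : Measurable A := by
    have h1 : Continuous (Matrix.toLin' M) := LinearMap.continuous_of_finiteDimensional _
    have h2 : ∀ i, Measurable fun r => Matrix.toLin' M r i := fun i =>
      (continuous_apply i).measurable.comp h1.measurable
    refine (h2 0).prodMk (measurable_pi_lambda _ fun i => ?_)
    fin_cases i
    · exact h2 1
    · exact h2 2
  have hAv : ∀ r₁ r₂ r₃ : ℝ, A ![r₁, r₂, r₃] =
      (r₁ + r₂ + r₃, r₁ • unitVec (φ + a) + r₂ • unitVec (φ - b) + r₃ • unitVec φ) := by
    intro r₁ r₂ r₃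
    simp only [hA, Matrix.toLin'_apply, hM]
    refine Prod.ext ?_ (funext fun i => ?_)
    · simp [Matrix.mulVec, dotProduct, Fin.sum_univ_three]
    · fin_cases i <;>
        simp [Matrix.mulVec, dotProduct, Fin.sum_univ_three, unitVec] <;> ring
  have hchange : ∫⁻ r, G (A r) = ENNReal.ofReal |M.det⁻¹| * ∫⁻ p, G p := by
    have h1 := Real.map_matrix_volume_pi_eq_smul_volume_pi hdet1.ne'
    have h2 : Measurable fun p : Fin 3 → ℝ => G (p 0, ![p 1, p 2]) := by
      refine hGm.comp ((measurable_pi_apply 0).prodMk (measurable_pi_lambda _ fun i => ?_))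
      fin_cases i
      · exact measurable_pi_apply 1
      · exact measurable_pi_apply 2
    have h1' : Measurable (Matrix.toLin' M) :=
      (LinearMap.continuous_of_finiteDimensional _).measurable
    rw [lintegral_V hGm, ← smul_eq_mul, ← lintegral_smul_measure, ← h1, lintegral_map h2 h1']
  have hball : ∫⁻ p, G p = ∫⁻ p in Metric.ball (0 : V) (1 / 200), F (3 / 4 + p.1, p.2) := by
    rw [← lintegral_indicator Metric.isOpen_ball.measurableSet,
      ← lintegral_add_left_eq_self G ((3 / 4, 0) : V)]
    refine lintegral_congr fun p => ?_
    have : ((3 / 4, 0) : V) + p = (3 / 4 + p.1, p.2) := by ext <;> simp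
    simp only [hG, indicator, Metric.mem_ball, dist_self_add_left, dist_zero_right]
    rw [this]
  rw [← hball]
  calc ENNReal.ofReal (1 / 3) * ∫⁻ p, G p ≤ ENNReal.ofReal |M.det⁻¹| * ∫⁻ p, G p := by
        gcongr
        rw [abs_inv, abs_of_pos hdet1, one_div]
        exact inv_anti₀ hdet1 hdet2
    _ = ∫⁻ r₁, ∫⁻ r₂, ∫⁻ r₃, G (A ![r₁, r₂, r₃]) := by
        rw [← hchange]
        exact lintegral_fin_three (hGm.comp hAm)
    _ ≤ ∫⁻ r₁, ∫⁻ r₂, ∫⁻ r₃, (Ioo (0 : ℝ) (1 / 2)).indicator (fun r₁ =>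
          (Ioo (0 : ℝ) (1 / 2)).indicator (fun r₂ => (Ioo (0 : ℝ) (1 / 2)).indicator (fun r₃ =>
          F (A ![r₁, r₂, r₃])) r₃) r₂) r₁ := by
        refine lintegral_mono fun r₁ => lintegral_mono fun r₂ => lintegral_mono fun r₃ => ?_
        simp only [hG]
        by_cases hmem : A ![r₁, r₂, r₃] ∈ Metric.ball ((3 / 4, 0) : V) (1 / 200)
        · have hm := hmem
          rw [hAv, Metric.mem_ball, Prod.dist_eq, max_lt_iff, dist_pi_lt_iff (by norm_num)] at hm
          obtain ⟨m1, m2⟩ := hm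
          have m3 := m2 0
          have m4 := m2 1
          simp only [Real.dist_eq, unitVec, Pi.add_apply, Pi.smul_apply, smul_eq_mul,
            Matrix.cons_val_zero, Matrix.cons_val_one, Pi.zero_apply, sub_zero, Real.cos_add,
            Real.cos_sub, Real.sin_add, Real.sin_sub] at m1 m3 m4
          obtain ⟨i1, i2, i3⟩ := flight_times_mem hcd ⟨a1, a2⟩ ⟨a3, a4⟩ ⟨a5, a6⟩ ⟨a7, a8⟩ m1 m3 m4
          rw [indicator_of_mem i1, indicator_of_mem i2, indicator_of_mem i3]
          exact indicator_le_self _ _ _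
        · rw [indicator_of_notMem hmem]
          exact zero_le
    _ = _ := by
        rw [← lintegral_indicator measurableSet_Ioo]
        refine lintegral_congr fun r₁ => ?_
        by_cases h1 : r₁ ∈ Ioo (0 : ℝ) (1 / 2)
        · simp only [indicator_of_mem h1]
          rw [← lintegral_indicator measurableSet_Ioo]
          refine lintegral_congr fun r₂ => ?_
          by_cases h2 : r₂ ∈ Ioo (0 : ℝ) (1 / 2)
          · simp only [indicator_of_mem h2]
            rw [← lintegral_indicator measurableSet_Ioo]
            simp only [hAv]
          · simp only [indicator_of_notMem h2, lintegral_zero]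
        · simp only [indicator_of_notMem h1, lintegral_zero]

/-! ### Successive flights -/

/-- The projection of the plane onto the torus. -/
def toTorus (z : Fin 2 → ℝ) : T2 := fun i => (z i : AddCircle (1 : ℝ))

lemma toTorus_add (z w : Fin 2 → ℝ) : toTorus (z + w) = toTorus z + toTorus w := by
  ext i
  simp [toTorus]

@[fun_prop]
lemma measurable_toTorus : Measurable toTorus :=
  measurable_pi_lambda _ fun i => measurable_coe_circle.comp (measurable_pi_apply i)

@[fun_prop]
lemma Measurable.toTorus {α : Type*} [MeasurableSpace α] {f : α → Fin 2 → ℝ} (hf : Measurable f) :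
    Measurable fun a => toTorus (f a) := measurable_toTorus.comp hf

@[fun_prop]
lemma measurable_dir_vec : Measurable dir := measurable_pi_lambda _ measurable_dir

@[fun_prop]
lemma Measurable.dir {α : Type*} [MeasurableSpace α] {f : α → S1} (hf : Measurable f) :
    Measurable fun a => dir (f a) := measurable_dir_vec.comp hf

@[fun_prop]
lemma Measurable.circleCos {α : Type*} [MeasurableSpace α] {f : α → S1} (hf : Measurable f) :
    Measurable fun a => circleCos (f a) := measurable_circleCos.comp hf

lemma move_neg (x : T2) (t : ℝ) (ω : S1) : move x (-t) ω = x - toTorus (t • dir ω) := by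
  ext i
  simp [move, toTorus, sub_eq_add_neg]

/-- A lower bound for the density of the deflection angle. -/
def weight (ω : S1) : ℝ≥0∞ := ENNReal.ofReal ((1 - circleCos ω) / 4)

@[fun_prop]
lemma Measurable.weight {α : Type*} [MeasurableSpace α] {f : α → S1} (hf : Measurable f) :
    Measurable fun a => weight (f a) := by
  unfold LorentzGas.weight
  fun_prop

/-- The contribution to the collision rate at `(t, x, ω)` of the collisions that come after a flight
of duration less than `1/2`, with lower bounds for the densities: the previous collision, at the
rate `f`, led to the direction `ω'` at the time `t - r`. -/
def flightStep (f : ℝ × Y → ℝ≥0∞) (p : ℝ × Y) : ℝ≥0∞ :=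
  1 / 2 * ∫⁻ ω', weight (ω' - p.2.2) * ∫⁻ r in Ioo (0 : ℝ) (1 / 2),
    f (p.1 - r, p.2.1 - toTorus (r • dir ω'), ω')

lemma measurable_flightStep {f : ℝ × Y → ℝ≥0∞} (hf : Measurable f) : Measurable (flightStep f) := by
  unfold flightStep
  have h1 : Measurable fun q : (ℝ × Y) × S1 => ∫⁻ r in Ioo (0 : ℝ) (1 / 2),
      f (q.1.1 - r, q.1.2.1 - toTorus (r • dir q.2), q.2) :=
    Measurable.lintegral_prod_right' (f := fun s : ((ℝ × Y) × S1) × ℝ =>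
      f (s.1.1.1 - s.2, s.1.1.2.1 - toTorus (s.2 • dir s.1.2), s.1.2)) (by fun_prop)
  refine Measurable.const_mul ?_ _
  exact Measurable.lintegral_prod_right' (f := fun q : (ℝ × Y) × S1 =>
    weight (q.2 - q.1.2.2) * ∫⁻ r in Ioo (0 : ℝ) (1 / 2),
      f (q.1.1 - r, q.1.2.1 - toTorus (r • dir q.2), q.2)) (by fun_prop)

lemma flightStep_mono {f g : ℝ × Y → ℝ≥0∞} (h : f ≤ g) : flightStep f ≤ flightStep g := by
  intro p
  unfold flightStep
  gcongr
  exact h _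

lemma lintegral_mul_lintegral_swap {w : S1 → ℝ≥0∞} (hw : Measurable w) {G : ℝ → S1 → ℝ≥0∞}
    (hG : Measurable (Function.uncurry G)) :
    ∫⁻ r in Ioo (0 : ℝ) (1 / 2), (1 / 2 * ∫⁻ ω, w ω * G r ω)
      = 1 / 2 * ∫⁻ ω, w ω * ∫⁻ r in Ioo (0 : ℝ) (1 / 2), G r ω := by
  have hm : Measurable (Function.uncurry fun r ω => w ω * G r ω) :=
    (hw.comp measurable_snd).mul hG
  rw [lintegral_const_mul' _ _ (by simp), lintegral_lintegral_swap hm.aemeasurable]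
  congr 1
  refine lintegral_congr fun ω => ?_
  have hG' : Measurable fun r => G r ω := hG.comp (measurable_id.prodMk measurable_const)
  rw [lintegral_const_mul _ hG']

/-- The integral of `f` over the durations of three flights in given directions. -/
def threeFlights (f : ℝ × Y → ℝ≥0∞) (t : ℝ) (x : T2) (ω₁ ω₂ ω₃ : S1) : ℝ≥0∞ :=
  ∫⁻ r₁ in Ioo (0 : ℝ) (1 / 2), ∫⁻ r₂ in Ioo (0 : ℝ) (1 / 2), ∫⁻ r₃ in Ioo (0 : ℝ) (1 / 2),
    f (t - r₁ - r₂ - r₃,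
      x - toTorus (r₁ • dir ω₁) - toTorus (r₂ • dir ω₂) - toTorus (r₃ • dir ω₃), ω₃)

lemma flightStep_three {f : ℝ × Y → ℝ≥0∞} (hf : Measurable f) (t : ℝ) (x : T2) (ω : S1) :
    flightStep (flightStep (flightStep f)) (t, x, ω)
      = 1 / 2 * ∫⁻ ω₁, weight (ω₁ - ω) * (1 / 2 * ∫⁻ ω₂, weight (ω₂ - ω₁) *
        (1 / 2 * ∫⁻ ω₃, weight (ω₃ - ω₂) * threeFlights f t x ω₁ ω₂ ω₃)) := by
  have m3 : ∀ ω₁ ω₂, Measurable fun q : ((ℝ × ℝ) × S1) × ℝ => f (t - q.1.1.1 - q.1.1.2 - q.2,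
      x - toTorus (q.1.1.1 • dir ω₁) - toTorus (q.1.1.2 • dir ω₂)
        - toTorus (q.2 • dir q.1.2), q.1.2) := fun ω₁ ω₂ => by fun_prop
  simp only [flightStep]
  congr 1
  refine lintegral_congr fun ω₁ => ?_
  congr 1
  rw [lintegral_mul_lintegral_swap (G := fun r₁ ω₂ => ∫⁻ r₂ in Ioo (0 : ℝ) (1 / 2),
    (1 / 2 * ∫⁻ ω₃, weight (ω₃ - ω₂) * ∫⁻ r₃ in Ioo (0 : ℝ) (1 / 2), f (t - r₁ - r₂ - r₃,
      x - toTorus (r₁ • dir ω₁) - toTorus (r₂ • dir ω₂) - toTorus (r₃ • dir ω₃), ω₃)))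
    (by fun_prop)]
  · congr 1
    refine lintegral_congr fun ω₂ => ?_
    congr 1
    simp only [threeFlights]
    have h2 := Measurable.lintegral_prod_right' (ν := volume.restrict (Ioo (0 : ℝ) (1 / 2)))
      (m3 ω₁ ω₂)
    have e2 : ∀ r₁, ∫⁻ r₂ in Ioo (0 : ℝ) (1 / 2), (1 / 2 * ∫⁻ ω₃, weight (ω₃ - ω₂) *
        ∫⁻ r₃ in Ioo (0 : ℝ) (1 / 2), f (t - r₁ - r₂ - r₃, x - toTorus (r₁ • dir ω₁)
          - toTorus (r₂ • dir ω₂) - toTorus (r₃ • dir ω₃), ω₃))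
        = 1 / 2 * ∫⁻ ω₃, weight (ω₃ - ω₂) * ∫⁻ r₂ in Ioo (0 : ℝ) (1 / 2),
        ∫⁻ r₃ in Ioo (0 : ℝ) (1 / 2), f (t - r₁ - r₂ - r₃, x - toTorus (r₁ • dir ω₁)
          - toTorus (r₂ • dir ω₂) - toTorus (r₃ • dir ω₃), ω₃) := by
      intro r₁
      refine lintegral_mul_lintegral_swap (by fun_prop) ?_
      exact h2.comp (f := fun q : ℝ × S1 => ((r₁, q.1), q.2)) (by fun_prop)
    simp only [e2]
    refine lintegral_mul_lintegral_swap (by fun_prop) ?_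
    exact Measurable.lintegral_prod_right' (f := fun s : (ℝ × S1) × ℝ =>
      ∫⁻ r₃ in Ioo (0 : ℝ) (1 / 2), f (t - s.1.1 - s.2 - r₃, x - toTorus (s.1.1 • dir ω₁)
          - toTorus (s.2 • dir ω₂) - toTorus (r₃ • dir s.1.2), s.1.2))
      (h2.comp (f := fun s : (ℝ × S1) × ℝ => ((s.1.1, s.2), s.1.2)) (by fun_prop))
  · refine Measurable.lintegral_prod_right' (f := fun s : (ℝ × S1) × ℝ =>
      1 / 2 * ∫⁻ ω₃, weight (ω₃ - s.1.2) * ∫⁻ r₃ in Ioo (0 : ℝ) (1 / 2),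
      f (t - s.1.1 - s.2 - r₃, x - toTorus (s.1.1 • dir ω₁) - toTorus (s.2 • dir s.1.2)
        - toTorus (r₃ • dir ω₃), ω₃)) ?_
    refine Measurable.const_mul ?_ _
    refine Measurable.lintegral_prod_right' (f := fun s : ((ℝ × S1) × ℝ) × S1 =>
      weight (s.2 - s.1.1.2) * ∫⁻ r₃ in Ioo (0 : ℝ) (1 / 2),
      f (t - s.1.1.1 - s.1.2 - r₃, x - toTorus (s.1.1.1 • dir ω₁) - toTorus (s.1.2 • dir s.1.1.2)
        - toTorus (r₃ • dir s.2), s.2)) ?_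
    refine Measurable.mul (by fun_prop) ?_
    exact Measurable.lintegral_prod_right' (f := fun s : (((ℝ × S1) × ℝ) × S1) × ℝ =>
      f (t - s.1.1.1.1 - s.1.1.2 - s.2, x - toTorus (s.1.1.1.1 • dir ω₁)
        - toTorus (s.1.1.2 • dir s.1.1.1.2) - toTorus (s.2 • dir s.1.2), s.1.2)) (by fun_prop)

lemma measurable_threeFlights {f : ℝ × Y → ℝ≥0∞} (hf : Measurable f) (t : ℝ) (x : T2) :
    Measurable fun q : (S1 × S1) × S1 => threeFlights f t x q.1.1 q.1.2 q.2 := by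
  unfold threeFlights
  refine Measurable.lintegral_prod_right' (f := fun q : ((S1 × S1) × S1) × ℝ =>
    ∫⁻ r₂ in Ioo (0 : ℝ) (1 / 2), ∫⁻ r₃ in Ioo (0 : ℝ) (1 / 2),
    f (t - q.2 - r₂ - r₃, x - toTorus (q.2 • dir q.1.1.1) - toTorus (r₂ • dir q.1.1.2)
      - toTorus (r₃ • dir q.1.2), q.1.2)) ?_
  refine Measurable.lintegral_prod_right' (f := fun q : (((S1 × S1) × S1) × ℝ) × ℝ =>
    ∫⁻ r₃ in Ioo (0 : ℝ) (1 / 2), f (t - q.1.2 - q.2 - r₃, x - toTorus (q.1.2 • dir q.1.1.1.1)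
      - toTorus (q.2 • dir q.1.1.1.2) - toTorus (r₃ • dir q.1.1.2), q.1.1.2)) ?_
  exact Measurable.lintegral_prod_right' (f := fun q : ((((S1 × S1) × S1) × ℝ) × ℝ) × ℝ =>
    f (t - q.1.1.2 - q.1.2 - q.2, x - toTorus (q.1.1.2 • dir q.1.1.1.1.1)
      - toTorus (q.1.2 • dir q.1.1.1.1.2) - toTorus (q.2 • dir q.1.1.1.2), q.1.1.1.2)) (by fun_prop)

/-- Moving the last direction to the front. -/
lemma flightStep_three' {f : ℝ × Y → ℝ≥0∞} (hf : Measurable f) (t : ℝ) (x : T2) (ω : S1) :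
    flightStep (flightStep (flightStep f)) (t, x, ω)
      = 1 / 2 * (1 / 2 * (1 / 2 * ∫⁻ ω₃, ∫⁻ ω₁, weight (ω₁ - ω) * ∫⁻ ω₂, weight (ω₂ - ω₁) *
        (weight (ω₃ - ω₂) * threeFlights f t x ω₁ ω₂ ω₃))) := by
  have h2 : (1 / 2 : ℝ≥0∞) ≠ ∞ := by simp
  have hw : ∀ ω, weight ω ≠ ∞ := fun ω => ENNReal.ofReal_ne_top
  have n3 : Measurable fun q : (S1 × S1) × S1 => weight (q.2 - q.1.2) *
      (weight (q.1.1 - q.2) * threeFlights f t x q.1.2 q.2 q.1.1) := by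
    have := (measurable_threeFlights hf t x).comp
      (f := fun q : (S1 × S1) × S1 => ((q.1.2, q.2), q.1.1)) (by fun_prop)
    exact Measurable.mul (by fun_prop) (Measurable.mul (by fun_prop) this)
  have n2 := Measurable.lintegral_prod_right' (ν := (volume : Measure S1)) n3
  have e2 : ∀ ω₁ ω₂, weight (ω₂ - ω₁) * (1 / 2 * ∫⁻ ω₃, weight (ω₃ - ω₂) *
      threeFlights f t x ω₁ ω₂ ω₃) = 1 / 2 * ∫⁻ ω₃, weight (ω₂ - ω₁) *
        (weight (ω₃ - ω₂) * threeFlights f t x ω₁ ω₂ ω₃) := by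
    intro ω₁ ω₂
    rw [mul_left_comm, lintegral_const_mul' _ _ (hw _)]
  have e1 : ∀ ω₁, weight (ω₁ - ω) * (1 / 2 * ∫⁻ ω₂, weight (ω₂ - ω₁) * (1 / 2 * ∫⁻ ω₃,
      weight (ω₃ - ω₂) * threeFlights f t x ω₁ ω₂ ω₃)) = 1 / 2 * (1 / 2 * ∫⁻ ω₃,
        weight (ω₁ - ω) * ∫⁻ ω₂, weight (ω₂ - ω₁) *
          (weight (ω₃ - ω₂) * threeFlights f t x ω₁ ω₂ ω₃)) := by
    intro ω₁
    simp only [e2]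
    rw [mul_left_comm, lintegral_const_mul' _ _ h2, lintegral_const_mul' _ _ (hw _),
      mul_left_comm (weight (ω₁ - ω)), lintegral_lintegral_swap]
    exact (n3.comp (f := fun q : S1 × S1 => ((q.2, ω₁), q.1)) (by fun_prop)).aemeasurable
  rw [flightStep_three hf]
  simp only [e1]
  rw [lintegral_const_mul' _ _ h2, lintegral_const_mul' _ _ h2, lintegral_lintegral_swap]
  exact Measurable.aemeasurable (Measurable.mul (by fun_prop)
    (n2.comp (f := fun q : S1 × S1 => (q.2, q.1)) (by fun_prop)))

/-! ### Spreading by many flights -/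

/-- The angles between successive flights are taken in this window. -/
lemma window_subset : Icc (2 * Real.pi / 3 - 1 / 20) (2 * Real.pi / 3 + 1 / 20)
    ⊆ Ioc 0 (0 + 2 * Real.pi) := by
  intro a ha
  have := Real.pi_gt_three
  exact ⟨by linarith [ha.1], by linarith [ha.2]⟩

lemma setLIntegral_window_add_le (f : S1 → ℝ≥0∞) (φ : ℝ) :
    ∫⁻ a in Icc (2 * Real.pi / 3 - 1 / 20) (2 * Real.pi / 3 + 1 / 20), f ((φ + a : ℝ) : S1)
      ≤ ∫⁻ ω, f ω := by
  rw [← lintegral_add_left_eq_self f (φ : S1), ← AddCircle.lintegral_preimage (2 * Real.pi) 0]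
  simp only [AddCircle.coe_add]
  exact lintegral_mono_set window_subset

lemma setLIntegral_window_sub_le (f : S1 → ℝ≥0∞) (φ : ℝ) :
    ∫⁻ a in Icc (2 * Real.pi / 3 - 1 / 20) (2 * Real.pi / 3 + 1 / 20), f ((φ - a : ℝ) : S1)
      ≤ ∫⁻ ω, f ω := by
  rw [← lintegral_sub_left_eq_self f (φ : S1), ← AddCircle.lintegral_preimage (2 * Real.pi) 0]
  simp only [AddCircle.coe_sub]
  exact lintegral_mono_set window_subset

lemma lintegral_window_weight_ge (γ : ℝ) :
    ENNReal.ofReal ((1 / 20 - Real.sin (1 / 20)) / 2)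
      ≤ ∫⁻ a in Icc (2 * Real.pi / 3 - 1 / 20) (2 * Real.pi / 3 + 1 / 20),
        weight ((γ + a : ℝ) : S1) := by
  have h1 : ∀ x : ℝ, 0 ≤ (1 - Real.cos x) / 4 := fun x => by linarith [Real.cos_le_one x]
  have hc : Continuous fun a : ℝ => (1 - Real.cos (γ + a)) / 4 := by fun_prop
  simp only [weight, circleCos_coe]
  rw [← ofReal_integral_eq_lintegral_ofReal hc.integrableOn_Icc (ae_of_all _ fun a => h1 _)]
  apply ENNReal.ofReal_le_ofReal
  rw [integral_Icc_eq_integral_Ioc, ← intervalIntegral.integral_of_le (by linarith),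
    intervalIntegral.integral_div, intervalIntegral.integral_sub (by simp)
      (Continuous.intervalIntegrable (by fun_prop) _ _),
    intervalIntegral.integral_comp_add_left, integral_cos, intervalIntegral.integral_const]
  set θ := γ + 2 * Real.pi / 3
  rw [show γ + (2 * Real.pi / 3 + 1 / 20) = θ + 1 / 20 by simp only [θ]; ring,
    show γ + (2 * Real.pi / 3 - 1 / 20) = θ - 1 / 20 by simp only [θ]; ring, Real.sin_add,
    Real.sin_sub, smul_eq_mul]
  have h2 : 0 ≤ Real.sin (1 / 20) := Real.sin_nonneg_of_nonneg_of_le_pi (by norm_num)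
    (by linarith [Real.pi_gt_three])
  have h3 := mul_le_mul_of_nonneg_right (Real.cos_le_one θ) h2
  linarith

lemma weight_ge {x : ℝ} (hx : Real.cos x ≤ 0) : ENNReal.ofReal (1 / 4) ≤ weight (x : S1) := by
  rw [weight, circleCos_coe]
  apply ENNReal.ofReal_le_ofReal
  linarith

lemma threeFlights_ge {f : ℝ × Y → ℝ≥0∞} (hf : Measurable f) (t : ℝ) (x : T2) {φ a b : ℝ}
    (ha : |a - 2 * Real.pi / 3| ≤ 1 / 20) (hb : |b - 2 * Real.pi / 3| ≤ 1 / 20) :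
    ENNReal.ofReal (1 / 3) * ∫⁻ p in Metric.ball (0 : V) (1 / 200),
        f (t - 3 / 4 - p.1, x - toTorus p.2, (φ : S1))
      ≤ threeFlights f t x ((φ + a : ℝ) : S1) ((φ - b : ℝ) : S1) (φ : S1) := by
  have := lintegral_three_flights (φ := φ) ha hb
    (F := fun q => f (t - q.1, x - toTorus q.2, (φ : S1))) (by fun_prop)
  simp only [← sub_sub, toTorus_add, unitVec_eq_dir] at this
  exact this

/-- The constant in `le_flightStep_three`: the factors `1/2` come from the three kernels, the integral
of `weight` over a window of angles of length `1/10` gives the next factor, the two factors `1/4` are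
lower bounds for `weight`, the factor `1/3` is the inverse of a bound for the determinant in
`lintegral_three_flights`, and `1/10` is the length of the second window. -/
def spreadConst : ℝ≥0∞ :=
  1 / 2 * (1 / 2 * (1 / 2 * (ENNReal.ofReal ((1 / 20 - Real.sin (1 / 20)) / 2) *
    (ENNReal.ofReal (1 / 4) * (ENNReal.ofReal (1 / 4) * ENNReal.ofReal (1 / 3)) *
      ENNReal.ofReal (1 / 10)))))

lemma spreadConst_ne_zero : spreadConst ≠ 0 := by
  have h : 0 < (1 / 20 - Real.sin (1 / 20)) / 2 := by
    have := Real.sin_lt (show (0 : ℝ) < 1 / 20 by norm_num)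
    linarith
  have h2 : (1 / 2 : ℝ≥0∞) ≠ 0 := by simp
  refine mul_ne_zero h2 (mul_ne_zero h2 (mul_ne_zero h2 (mul_ne_zero ?_ (mul_ne_zero (mul_ne_zero ?_
    (mul_ne_zero ?_ ?_)) ?_)))) <;> rw [Ne, ENNReal.ofReal_eq_zero, not_le]
  · exact h
  all_goals norm_num

/-- After three flights the position and the time are spread over a box, and the direction over the
whole circle. -/
lemma le_flightStep_three {f : ℝ × Y → ℝ≥0∞} (hf : Measurable f) (t : ℝ) (x : T2) (ω : S1) :
    spreadConst * ∫⁻ p in Metric.ball (0 : V) (1 / 200), ∫⁻ ω',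
        f (t - 3 / 4 - p.1, x - toTorus p.2, ω')
      ≤ flightStep (flightStep (flightStep f)) (t, x, ω) := by
  rw [flightStep_three' hf, spreadConst, lintegral_lintegral_swap (Measurable.aemeasurable
    (by simp only [Function.uncurry_def]; fun_prop))]
  rw [mul_assoc (1 / 2), mul_assoc (1 / 2), mul_assoc (1 / 2)]
  gcongr 1 / 2 * (1 / 2 * (1 / 2 * ?_))
  rw [← lintegral_const_mul _ (Measurable.lintegral_prod_right' (f := fun q : S1 × V =>
    f (t - 3 / 4 - q.2.1, x - toTorus q.2.2, q.1)) (by fun_prop))]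
  refine lintegral_mono fun ω₃ => ?_
  obtain ⟨φ, rfl⟩ := QuotientAddGroup.mk_surjective ω₃
  obtain ⟨β, rfl⟩ := QuotientAddGroup.mk_surjective ω
  change _ * ∫⁻ p in Metric.ball (0 : V) (1 / 200), f (t - 3 / 4 - p.1, x - toTorus p.2, (φ : S1))
    ≤ ∫⁻ ω₁, weight (ω₁ - (β : S1)) * ∫⁻ ω₂, weight (ω₂ - ω₁) *
        (weight ((φ : S1) - ω₂) * threeFlights f t x ω₁ ω₂ (φ : S1))
  set Q := ∫⁻ p in Metric.ball (0 : V) (1 / 200), f (t - 3 / 4 - p.1, x - toTorus p.2, (φ : S1))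
  set W := Icc (2 * Real.pi / 3 - 1 / 20) (2 * Real.pi / 3 + 1 / 20) with hW
  have hWabs : ∀ a ∈ W, |a - 2 * Real.pi / 3| ≤ 1 / 20 := fun a ha =>
    abs_le.2 ⟨by linarith [ha.1], by linarith [ha.2]⟩
  have hvol : volume W = ENNReal.ofReal (1 / 10) := by
    rw [hW, Real.volume_Icc]; congr 1; ring
  set κ := ENNReal.ofReal (1 / 4) * (ENNReal.ofReal (1 / 4) * (ENNReal.ofReal (1 / 3) * Q)) *
    ENNReal.ofReal (1 / 10) with hκ
  have hinner : ∀ a ∈ W, κ ≤ ∫⁻ ω₂, weight (ω₂ - ((φ + a : ℝ) : S1)) *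
        (weight ((φ : S1) - ω₂) * threeFlights f t x ((φ + a : ℝ) : S1) ω₂ (φ : S1)) := by
    intro a ha
    refine le_trans ?_ (setLIntegral_window_sub_le _ φ)
    rw [hκ, ← hvol, ← setLIntegral_const]
    refine setLIntegral_mono' measurableSet_Icc fun b hb => ?_
    obtain ⟨⟨a1, a2⟩, a3, a4⟩ := cos_sin_near (hWabs a ha)
    obtain ⟨⟨b1, b2⟩, b3, b4⟩ := cos_sin_near (hWabs b hb)
    have w1 : ENNReal.ofReal (1 / 4) ≤ weight (((φ - b : ℝ) : S1) - ((φ + a : ℝ) : S1)) := by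
      rw [← AddCircle.coe_sub, show φ - b - (φ + a) = -(a + b) by ring]
      refine weight_ge ?_
      rw [Real.cos_neg, Real.cos_add]
      nlinarith
    have w2 : ENNReal.ofReal (1 / 4) ≤ weight ((φ : S1) - ((φ - b : ℝ) : S1)) := by
      rw [← AddCircle.coe_sub, sub_sub_cancel]
      exact weight_ge (by linarith)
    gcongr
    exact threeFlights_ge hf t x (hWabs a ha) (hWabs b hb)
  calc _ = ENNReal.ofReal ((1 / 20 - Real.sin (1 / 20)) / 2) * κ := by rw [hκ]; ring
    _ ≤ (∫⁻ a in W, weight ((φ - β + a : ℝ) : S1)) * κ := by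
        gcongr
        exact lintegral_window_weight_ge _
    _ = ∫⁻ a in W, weight (((φ + a : ℝ) : S1) - (β : S1)) * κ := by
        rw [← lintegral_mul_const _ (by fun_prop)]
        refine lintegral_congr fun a => ?_
        rw [← AddCircle.coe_sub, show φ + a - β = φ - β + a by ring]
    _ ≤ ∫⁻ a in W, weight (((φ + a : ℝ) : S1) - (β : S1)) *
          ∫⁻ ω₂, weight (ω₂ - ((φ + a : ℝ) : S1)) *
            (weight ((φ : S1) - ω₂) * threeFlights f t x ((φ + a : ℝ) : S1) ω₂ (φ : S1)) :=
        setLIntegral_mono' measurableSet_Icc fun a ha => mul_le_mul_right (hinner a ha) _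
    _ ≤ _ := setLIntegral_window_add_le (fun ω₁ => weight (ω₁ - (β : S1)) * ∫⁻ ω₂,
        weight (ω₂ - ω₁) * (weight ((φ : S1) - ω₂) * threeFlights f t x ω₁ ω₂ (φ : S1))) φ

/-- The convolution of the indicator functions of two balls is bounded below on a larger ball. -/
lemma setLIntegral_ball_add_ge {a δ : ℝ} (hδ : 0 < δ) (ha : δ ≤ a) {Φ : V → ℝ≥0∞}
    (hΦ : Measurable Φ) :
    volume (Metric.ball (0 : V) (δ / 4)) * ∫⁻ z in Metric.ball 0 (a + δ / 2), Φ z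
      ≤ ∫⁻ q in Metric.ball (0 : V) δ, ∫⁻ p in Metric.ball (0 : V) a, Φ (q + p) := by
  have hS : MeasurableSet {x : V × V | x.2 - x.1 ∈ Metric.ball (0 : V) a} :=
    (measurable_snd.sub measurable_fst) Metric.isOpen_ball.measurableSet
  have hm : Measurable ({x : V × V | x.2 - x.1 ∈ Metric.ball (0 : V) a}.indicator
      fun x => Φ x.2) := (hΦ.comp measurable_snd).indicator hS
  have e1 : ∀ q, ∫⁻ p in Metric.ball (0 : V) a, Φ (q + p) = ∫⁻ z,
      {x : V × V | x.2 - x.1 ∈ Metric.ball (0 : V) a}.indicator (fun x => Φ x.2) (q, z) := by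
    intro q
    rw [← lintegral_indicator Metric.isOpen_ball.measurableSet, ← lintegral_add_left_eq_self
      (fun z => {x : V × V | x.2 - x.1 ∈ Metric.ball (0 : V) a}.indicator (fun x => Φ x.2) (q, z)) q]
    refine lintegral_congr fun p => ?_
    simp [indicator]
  simp only [e1]
  rw [lintegral_lintegral_swap (f := fun q z => {x : V × V | x.2 - x.1 ∈
    Metric.ball (0 : V) a}.indicator (fun x => Φ x.2) (q, z)) hm.aemeasurable,
    ← lintegral_const_mul' _ _
    measure_ball_lt_top.ne, ← lintegral_indicator Metric.isOpen_ball.measurableSet]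
  refine lintegral_mono fun z => ?_
  by_cases hz : z ∈ Metric.ball (0 : V) (a + δ / 2)
  swap
  · rw [indicator_of_notMem hz]; exact zero_le
  rw [indicator_of_mem hz]
  have hz' : ‖z‖ < a + δ / 2 := by simpa using hz
  -- a point `w` of the smaller ball such that `z - w` is in the ball of radius `a`, both well inside
  obtain ⟨w, hw1, hw2⟩ : ∃ w : V, ‖w‖ ≤ 3 * δ / 4 ∧ ‖z - w‖ < a - δ / 4 := by
    rcases le_or_gt ‖z‖ (3 * δ / 4) with h | h
    · exact ⟨z, h, by rw [sub_self, norm_zero]; linarith⟩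
    · have hz0 : 0 < ‖z‖ := by linarith
      refine ⟨(3 * δ / 4 / ‖z‖) • z, ?_, ?_⟩
      · rw [norm_smul, Real.norm_of_nonneg (by positivity), div_mul_cancel₀ _ hz0.ne']
      · have : z - (3 * δ / 4 / ‖z‖) • z = (1 - 3 * δ / 4 / ‖z‖) • z := by rw [sub_smul, one_smul]
        rw [this, norm_smul, Real.norm_of_nonneg (by rw [sub_nonneg, div_le_one hz0]; exact h.le),
          sub_mul, one_mul, div_mul_cancel₀ _ hz0.ne']
        linarith
  have hsub : ∀ q ∈ Metric.ball w (δ / 4), q ∈ Metric.ball (0 : V) δ ∧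
      z - q ∈ Metric.ball (0 : V) a := by
    intro q hq
    rw [Metric.mem_ball, dist_eq_norm] at hq
    constructor
    · rw [mem_ball_zero_iff]
      have := norm_add_le (q - w) w
      rw [sub_add_cancel] at this
      linarith
    · rw [mem_ball_zero_iff]
      have := norm_sub_le (z - w) (q - w)
      rw [sub_sub_sub_cancel_right] at this
      linarith
  calc volume (Metric.ball (0 : V) (δ / 4)) * Φ z
      = ∫⁻ q in Metric.ball w (δ / 4), Φ z := by
        rw [setLIntegral_const, mul_comm, ← Measure.addHaar_ball_center volume w]
    _ ≤ ∫⁻ q in Metric.ball w (δ / 4), {x : V × V | x.2 - x.1 ∈ Metric.ball (0 : V) a}.indicator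
          (fun x => Φ x.2) (q, z) := by
        refine setLIntegral_mono' Metric.isOpen_ball.measurableSet fun q hq => ?_
        rw [indicator_of_mem (show (q, z) ∈ {x : V × V | x.2 - x.1 ∈ Metric.ball (0 : V) a} from
          (hsub q hq).2)]
    _ ≤ _ := lintegral_mono_set fun q hq => (hsub q hq).1

lemma measurable_flightStep_iterate {f : ℝ × Y → ℝ≥0∞} (hf : Measurable f) (n : ℕ) :
    Measurable (flightStep^[n] f) := by
  induction n with
  | zero => exact hf
  | succ n ih => rw [Function.iterate_succ_apply']; exact measurable_flightStep ih

/-- Many flights spread a particle over a large box: by induction, each further triple of flights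
enlarges the radius by half of the radius `1/200` for three flights. -/
lemma exists_le_flightStep_iterate (m : ℕ) : ∃ c : ℝ≥0∞, c ≠ 0 ∧ ∀ f : ℝ × Y → ℝ≥0∞,
    Measurable f → ∀ t x ω, c * ∫⁻ p in Metric.ball (0 : V) (1 / 200 + m * (1 / 400)), ∫⁻ ω',
        f (t - (m + 1) * (3 / 4) - p.1, x - toTorus p.2, ω')
      ≤ flightStep^[3 * (m + 1)] f (t, x, ω) := by
  induction m with
  | zero =>
    refine ⟨spreadConst, spreadConst_ne_zero, fun f hf t x ω => ?_⟩
    have := le_flightStep_three hf t x ω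
    simpa using this
  | succ m ih =>
    obtain ⟨c, hc, hle⟩ := ih
    refine ⟨spreadConst * (volume (univ : Set S1) *
      (c * volume (Metric.ball (0 : V) (1 / 200 / 4)))), ?_, ?_⟩
    · refine mul_ne_zero spreadConst_ne_zero (mul_ne_zero ?_ (mul_ne_zero hc
        (Metric.measure_ball_pos _ _ (by norm_num)).ne'))
      rw [AddCircle.measure_univ]
      simpa using Real.two_pi_pos
    · intro f hf t x ω
      set g := flightStep^[3 * (m + 1)] f with hg
      have e : flightStep^[3 * (m + 1 + 1)] f = flightStep (flightStep (flightStep g)) := by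
        rw [show 3 * (m + 1 + 1) = 3 * (m + 1) + 1 + 1 + 1 by ring]
        simp only [Function.iterate_succ_apply', hg]
      rw [e]
      refine le_trans ?_ (le_flightStep_three (measurable_flightStep_iterate hf _) t x ω)
      set Ψ : V → ℝ≥0∞ := fun z => ∫⁻ ω', f (t - (m + 1 + 1) * (3 / 4) - z.1, x - toTorus z.2, ω')
        with hΨ
      have hΨm : Measurable Ψ := Measurable.lintegral_prod_right' (f := fun q : V × S1 =>
        f (t - (m + 1 + 1) * (3 / 4) - q.1.1, x - toTorus q.1.2, q.2)) (by fun_prop)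
      have key := setLIntegral_ball_add_ge (a := 1 / 200 + m * (1 / 400)) (δ := 1 / 200)
        (by norm_num) (by have : (0 : ℝ) ≤ m := Nat.cast_nonneg m; linarith) hΨm
      rw [show (1 / 200 + m * (1 / 400) + 1 / 200 / 2 : ℝ) = 1 / 200 + (m + 1 : ℕ) * (1 / 400) by
        push_cast; ring] at key
      have hq : ∀ q : V, volume (univ : Set S1) * (c * ∫⁻ p in
          Metric.ball (0 : V) (1 / 200 + m * (1 / 400)), Ψ (q + p))
          ≤ ∫⁻ ω', g (t - 3 / 4 - q.1, x - toTorus q.2, ω') := by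
        intro q
        rw [mul_comm, ← lintegral_const]
        refine lintegral_mono fun ω' => ?_
        refine le_trans (le_of_eq ?_) (hle f hf _ _ ω')
        congr 1
        refine lintegral_congr fun p => lintegral_congr fun ω'' => ?_
        simp only [Prod.fst_add, Prod.snd_add, toTorus_add]
        congr 2
        · ring
        · rw [sub_sub]
      calc _ = spreadConst * (volume (univ : Set S1) * (c *
            (volume (Metric.ball (0 : V) (1 / 200 / 4)) * ∫⁻ z in
              Metric.ball (0 : V) (1 / 200 + (m + 1 : ℕ) * (1 / 400)), Ψ z))) := by
            simp only [hΨ]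
            push_cast
            ring
        _ ≤ spreadConst * (volume (univ : Set S1) * (c * ∫⁻ q in Metric.ball (0 : V) (1 / 200),
            ∫⁻ p in Metric.ball (0 : V) (1 / 200 + m * (1 / 400)), Ψ (q + p))) := by
            gcongr
        _ ≤ spreadConst * ∫⁻ q in Metric.ball (0 : V) (1 / 200), (volume (univ : Set S1) * (c *
            ∫⁻ p in Metric.ball (0 : V) (1 / 200 + m * (1 / 400)), Ψ (q + p))) := by
            gcongr
            exact (mul_le_mul_right (lintegral_const_mul_le _ _) _).trans
              (lintegral_const_mul_le _ _)
        _ ≤ _ := by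
            gcongr with q
            exact hq q

/-! ### A uniform lower bound for the evolution -/

/-- The rate of the collisions that lead to the state `y` at the time `t`, for the trace `g`. It is
`0` for `t ≤ 0`, so that the integrals over past flights need no restriction to positive times. -/
def rate (g : ℝ × Y × ℝ → ℝ≥0∞) (p : ℝ × Y) : ℝ≥0∞ :=
  (Ioi (0 : ℝ)).indicator (fun t => ∫⁻ h in H, g (t, bounce h p.2, h)) p.1

/-- The rate of the first collisions, for the initial density `u`. -/
def firstRate (u : Y × ℝ × ℝ → ℝ≥0∞) (p : ℝ × Y) : ℝ≥0∞ :=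
  (Ioi (0 : ℝ)).indicator (fun t => ∫⁻ h in H, u (flow (-t) (bounce h p.2), t, h)) p.1

section
variable {u : Y × ℝ × ℝ → ℝ≥0∞} {g : ℝ × Y × ℝ → ℝ≥0∞}

lemma measurable_rate (hg : Measurable g) : Measurable (rate g) := by
  have : Measurable fun p : ℝ × Y => ∫⁻ h in H, g (p.1, bounce h p.2, h) :=
    Measurable.lintegral_prod_right' (f := fun q : (ℝ × Y) × ℝ => g (q.1.1, bounce q.2 q.1.2, q.2))
      (by fun_prop)
  exact this.indicator (measurable_fst measurableSet_Ioi)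

@[fun_prop]
lemma Measurable.rate {α : Type*} [MeasurableSpace α] (hg : Measurable g) {f : α → ℝ × Y}
    (hf : Measurable f) : Measurable fun a => rate g (f a) := (measurable_rate hg).comp hf

lemma measurable_firstRate (hu : Measurable u) : Measurable (firstRate u) := by
  have : Measurable fun p : ℝ × Y => ∫⁻ h in H, u (flow (-p.1) (bounce h p.2), p.1, h) :=
    Measurable.lintegral_prod_right' (f := fun q : (ℝ × Y) × ℝ =>
      u (flow (-q.1.1) (bounce q.2 q.1.2), q.1.1, q.2)) (by fun_prop)
  exact this.indicator (measurable_fst measurableSet_Ioi)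

/-- The gain is bounded below by the collisions of the recent past, since the kernel is at least
`1/2` for flights of duration at most `1/2`. -/
lemma half_lintegral_rate_le_gain (hg : Measurable g) (t : ℝ) (y : Y) {s h : ℝ} (hs : 0 ≤ s)
    (hh : h ∈ H) :
    1 / 2 * ∫⁻ r in Ioo 0 (1 / 2 - s), rate g (t - r, flow (-r) y) ≤ gain g t y s h := by
  have e : gain g t y s h = ∫⁻ r in Ioo 0 t, ∫⁻ h' in H,
      kernel (s + r) h h' * g (t - r, bounce h' (flow (-r) y), h') := by
    have := setLIntegral_Ioo_sub (fun τ => ∫⁻ h' in H,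
      kernel (s + t - τ) h h' * g (τ, bounce h' (flow (τ - t) y), h')) 0 t t
    rw [sub_self, sub_zero] at this
    rw [gain, ← this]
    refine lintegral_congr fun r => lintegral_congr fun h' => ?_
    rw [show s + t - (t - r) = s + r by ring, show t - r - t = -r by ring]
  rw [e, ← lintegral_const_mul _ (by fun_prop), ← lintegral_indicator measurableSet_Ioo,
    ← lintegral_indicator measurableSet_Ioo]
  refine lintegral_mono fun r => ?_
  by_cases hr : r ∈ Ioo 0 (1 / 2 - s)
  swap
  · rw [indicator_of_notMem hr]
    exact zero_le
  rw [indicator_of_mem hr]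
  by_cases hrt : r < t
  swap
  · rw [rate, indicator_of_notMem (by simpa using hrt), mul_zero]
    exact zero_le
  rw [indicator_of_mem (show r ∈ Ioo 0 t from ⟨hr.1, hrt⟩), rate, indicator_of_mem (by simpa using hrt),
    ← lintegral_const_mul _ (by fun_prop)]
  refine lintegral_mono_ae ?_
  filter_upwards [ae_restrict_mem measurableSet_Ioo,
    ae_restrict_of_ae (compl_mem_ae_iff.2 (measure_singleton (μ := volume) h))] with h' hh' hne
  gcongr
  exact half_le_kernel (by linarith [hr.1]) (by linarith [hr.2]) hh hh' (Ne.symm hne)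

lemma firstRate_le_rate (hug : IsTrace u g) : firstRate u ≤ rate g := by
  intro p
  refine indicator_le_indicator' fun ht => setLIntegral_mono' measurableSet_Ioo fun h hh => ?_
  rw [hug p.1 (le_of_lt ht) _ h hh, evolve, zero_add]
  exact le_self_add

/-- Collisions that are preceded by a collision at most `1/2` earlier. -/
lemma flightStep_rate_le (hg : Measurable g) (hug : IsTrace u g) : flightStep (rate g) ≤ rate g := by
  rintro ⟨t, x, ω⟩
  by_cases ht : 0 < t
  swap
  · refine le_of_eq_of_le ?_ zero_le
    rw [flightStep]
    refine mul_eq_zero_of_right _ ?_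
    rw [← lintegral_zero (μ := (volume : Measure S1))]
    refine lintegral_congr fun ω' => mul_eq_zero_of_right _ ?_
    rw [← lintegral_zero (μ := volume.restrict (Ioo (0 : ℝ) (1 / 2)))]
    refine setLIntegral_congr_fun measurableSet_Ioo fun r hr => ?_
    rw [rate, indicator_of_notMem]
    simp only [mem_Ioi, not_lt]
    linarith [hr.1]
  rw [rate, indicator_of_mem (by exact ht)]
  calc flightStep (rate g) (t, x, ω)
      = ∫⁻ ω', weight (ω' - ω) * (1 / 2 * ∫⁻ r in Ioo (0 : ℝ) (1 / 2),
          rate g (t - r, flow (-r) (x, ω'))) := by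
        rw [flightStep, ← lintegral_const_mul' _ _ (by simp)]
        refine lintegral_congr fun ω' => ?_
        rw [mul_left_comm]
        simp only [flow, move_neg]
    _ ≤ ∫⁻ h in H, 1 / 2 * ∫⁻ r in Ioo (0 : ℝ) (1 / 2),
          rate g (t - r, flow (-r) (x, deflect h ω)) := lintegral_deflect_ge (fun ω' =>
            1 / 2 * ∫⁻ r in Ioo (0 : ℝ) (1 / 2), rate g (t - r, flow (-r) (x, ω'))) ω
    _ ≤ ∫⁻ h in H, g (t, bounce h (x, ω), h) := by
        refine setLIntegral_mono' measurableSet_Ioo fun h hh => ?_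
        rw [hug t ht.le _ h hh, evolve]
        refine le_trans ?_ le_add_self
        have := half_lintegral_rate_le_gain hg t (bounce h (x, ω)) le_rfl hh
        rw [sub_zero] at this
        exact this

lemma flightStep_iterate_firstRate_le (hg : Measurable g) (hug : IsTrace u g) (n : ℕ) :
    flightStep^[n] (firstRate u) ≤ rate g := by
  induction n with
  | zero => exact firstRate_le_rate hug
  | succ n ih =>
    rw [Function.iterate_succ_apply']
    exact (flightStep_mono ih).trans (flightStep_rate_le hg hug)

lemma lintegral_firstRate (hu : Measurable u) (L : ℝ) :
    ∫⁻ t in Ioo 0 L, ∫⁻ y, firstRate u (t, y)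
      = ∫⁻ s in Ioo 0 L, ∫⁻ h in H, ∫⁻ y, u (y, s, h) := by
  refine setLIntegral_congr_fun measurableSet_Ioo fun t ht => ?_
  simp only [firstRate, indicator_of_mem (show t ∈ Ioi (0 : ℝ) from ht.1)]
  rw [lintegral_lintegral_swap (Measurable.aemeasurable
    (by simp only [Function.uncurry_def]; fun_prop))]
  refine lintegral_congr fun h => ?_
  rw [lintegral_bounce (f := fun y => u (flow (-t) y, t, h)) (by fun_prop),
    lintegral_flow (f := fun y => u (y, t, h)) (by fun_prop)]

end

lemma lintegral_box_toTorus {f : T2 → ℝ≥0∞} (hf : Measurable f) :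
    ∫⁻ z in univ.pi fun _ : Fin 2 => Ioc (-(1 / 2) : ℝ) (1 / 2), f (toTorus z) = ∫⁻ x, f x := by
  have h := measurePreserving_pi _ _
    (fun _ : Fin 2 => AddCircle.measurePreserving_mk (1 : ℝ) (-(1 / 2)))
  rw [← Measure.restrict_pi_pi] at h
  norm_num at h
  have := h.lintegral_comp hf
  norm_num
  exact this

instance : (volume : Measure T2).IsNegInvariant :=
  Measure.pi.isNegInvariant fun _ => (volume : Measure (AddCircle (1 : ℝ)))

/-- A ball contains a product of a time interval and a fundamental domain of the torus. -/
lemma le_lintegral_ball {R : ℝ} (hR : 1 ≤ R) {f : ℝ × Y → ℝ≥0∞} (hf : Measurable f) (a : ℝ)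
    (x : T2) :
    ∫⁻ t in Ioo (a - R) (a + R), ∫⁻ y, f (t, y)
      ≤ ∫⁻ p in Metric.ball (0 : V) R, ∫⁻ ω', f (a - p.1, x - toTorus p.2, ω') := by
  set B := univ.pi fun _ : Fin 2 => Ioc (-(1 / 2) : ℝ) (1 / 2) with hB
  have hsub : Ioo (-R) R ×ˢ B ⊆ Metric.ball (0 : V) R := by
    rintro ⟨p, z⟩ ⟨hp, hz⟩
    rw [mem_ball_zero_iff, Prod.norm_def, max_lt_iff]
    refine ⟨abs_lt.2 hp, ?_⟩
    refine lt_of_le_of_lt ((pi_norm_le_iff_of_nonneg (by norm_num : (0 : ℝ) ≤ 1 / 2)).2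
      fun i => ?_) (by linarith : 1 / 2 < R)
    have := hz i (mem_univ i)
    exact abs_le.2 ⟨this.1.le, this.2⟩
  have hm : Measurable fun q : ℝ × T2 => ∫⁻ ω', f (q.1, q.2, ω') :=
    Measurable.lintegral_prod_right' (f := fun q : (ℝ × T2) × S1 => f (q.1.1, q.1.2, q.2))
      (by fun_prop)
  have hmV : Measurable fun p : V => ∫⁻ ω', f (a - p.1, x - toTorus p.2, ω') :=
    hm.comp (f := fun p : V => (a - p.1, x - toTorus p.2)) (by fun_prop)
  refine le_trans (le_of_eq ?_) (lintegral_mono_set hsub)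
  rw [Measure.volume_eq_prod ℝ (Fin 2 → ℝ), ← Measure.prod_restrict, lintegral_prod _ hmV.aemeasurable]
  have e := setLIntegral_Ioo_sub (fun t => ∫⁻ y, f (t, y)) (-R) R a
  rw [sub_neg_eq_add] at e
  rw [← e]
  refine lintegral_congr fun t => ?_
  have hm' : Measurable fun x' => ∫⁻ ω', f (a - t, x', ω') :=
    hm.comp (f := fun x' : T2 => (a - t, x')) (by fun_prop)
  rw [lintegral_box_toTorus (f := fun x' => ∫⁻ ω', f (a - t, x - x', ω'))
    (hm'.comp (measurable_const.sub measurable_id)),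
    lintegral_sub_left_eq_self (fun x' => ∫⁻ ω', f (a - t, x', ω')) x,
    Measure.volume_eq_prod T2 S1, lintegral_prod _ (by fun_prop)]

/-- A Doeblin condition: after a time that depends only on `L`, the mass that was within `L` of its
next collision is spread over all states that are within `1/4` of their next collision. -/
theorem exists_le_evolve (L : ℝ) : ∃ T : ℝ, 0 ≤ T ∧ ∃ c : ℝ≥0∞, c ≠ 0 ∧
    ∀ u : Y × ℝ × ℝ → ℝ≥0∞, ∀ g : ℝ × Y × ℝ → ℝ≥0∞, Measurable u → Measurable g → IsTrace u g →
      ∀ y, ∀ s ∈ Ioo (0 : ℝ) (1 / 4), ∀ h ∈ H,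
        c * ∫⁻ s in Ioo 0 L, ∫⁻ h in H, ∫⁻ y, u (y, s, h) ≤ evolve u g T (y, s, h) := by
  obtain ⟨m, hm⟩ := exists_nat_ge (400 * (|L| + 1))
  obtain ⟨c, hc, hle⟩ := exists_le_flightStep_iterate m
  have hR : |L| + 1 ≤ 1 / 200 + m * (1 / 400) := by linarith
  have hL := abs_nonneg L
  refine ⟨(m + 1) * (3 / 4) + 1 / 2, by positivity, 1 / 2 * (c * ENNReal.ofReal (1 / 4)),
    mul_ne_zero (by simp) (mul_ne_zero hc (by simp)), fun u g hu hg hug y s hs h hh => ?_⟩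
  set T : ℝ := (m + 1) * (3 / 4) + 1 / 2 with hT
  set U := ∫⁻ s in Ioo 0 L, ∫⁻ h in H, ∫⁻ y, u (y, s, h) with hU
  have hrate : ∀ r ∈ Ioo (0 : ℝ) (1 / 4), ∀ y, c * U ≤ rate g (T - r, y) := by
    rintro r hr ⟨x, ω⟩
    refine le_trans ?_ (flightStep_iterate_firstRate_le hg hug (3 * (m + 1)) (T - r, x, ω))
    refine le_trans ?_ (hle _ (measurable_firstRate hu) (T - r) x ω)
    gcongr
    refine le_trans ?_ (le_lintegral_ball (by linarith) (measurable_firstRate hu) _ x)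
    rw [hU, ← lintegral_firstRate hu]
    refine lintegral_mono_set (Ioo_subset_Ioo ?_ ?_)
    · rw [hT]; linarith [hr.1]
    · rw [hT]; linarith [hr.2, le_abs_self L]
  rw [evolve]
  refine le_trans ?_ (le_add_self.trans' (half_lintegral_rate_le_gain hg T y hs.1.le hh))
  rw [mul_assoc]
  gcongr
  calc c * ENNReal.ofReal (1 / 4) * U = ∫⁻ _ in Ioo (0 : ℝ) (1 / 4), c * U := by
        rw [setLIntegral_const, Real.volume_Ioo, sub_zero]; ring
    _ ≤ ∫⁻ r in Ioo (0 : ℝ) (1 / 4), rate g (T - r, flow (-r) y) :=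
        setLIntegral_mono' measurableSet_Ioo fun r hr => hrate r hr _
    _ ≤ _ := lintegral_mono_set (Ioo_subset_Ioo le_rfl (by linarith [hs.2]))

/-! ### Convergence to equilibrium -/

section
variable {u : Y × ℝ × ℝ → ℝ≥0∞} {g : ℝ × Y × ℝ → ℝ≥0∞} {M N : ℝ≥0∞}

lemma lintegral_flux_ne_top (hM : M ≠ ∞) (hg : ∀ τ, 0 ≤ τ → ∀ y, ∀ h ∈ H, g (τ, y, h) ≤ M)
    (T : ℝ) : ∫⁻ t in Ioo 0 T, ∫⁻ h in H, flux g t h ≠ ∞ := by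
  have hle : ∫⁻ t in Ioo 0 T, ∫⁻ h in H, flux g t h
      ≤ ∫⁻ _ in Ioo 0 T, ∫⁻ _ in H, ∫⁻ _ : Y, M :=
    setLIntegral_mono' measurableSet_Ioo fun t ht => setLIntegral_mono' measurableSet_Ioo
      fun h hh => lintegral_mono fun y => hg t ht.1.le y h hh
  refine ne_top_of_le_ne_top ?_ hle
  simp only [lintegral_const]
  have h1 : volume.restrict H univ ≠ ∞ := by simp
  have h2 : (volume.restrict (Ioo 0 T)) univ ≠ ∞ := by simp
  exact ENNReal.mul_ne_top (ENNReal.mul_ne_top (ENNReal.mul_ne_top hM (measure_ne_top _ _)) h1) h2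

lemma setLIntegral_phase_lt (hu : Measurable u) (L : ℝ) :
    ∫⁻ z in {z | z.2.1 < L}, u z ∂phase = ∫⁻ s in Ioo 0 L, ∫⁻ h in H, ∫⁻ y, u (y, s, h) := by
  have hS : MeasurableSet {z : Y × ℝ × ℝ | z.2.1 < L} :=
    measurableSet_lt (by fun_prop) measurable_const
  rw [← lintegral_indicator hS, lintegral_phase (hu.indicator hS), ← Ioi_inter_Iio,
    ← lintegral_indicator measurableSet_Ioi,
    ← lintegral_indicator (measurableSet_Ioi.inter measurableSet_Iio)]
  refine lintegral_congr fun s => ?_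
  by_cases hs : s < L <;> by_cases h0 : 0 < s <;> simp [indicator, hs, h0]

lemma volume_univ_Y : volume (univ : Set Y) = ENNReal.ofReal (2 * Real.pi) := by
  rw [Measure.volume_eq_prod T2 S1, ← univ_prod_univ, Measure.prod_prod,
    AddCircle.measure_univ, show (univ : Set T2) = univ.pi fun _ => univ by simp, volume_pi,
    Measure.pi_pi]
  simp

lemma phase_lt_ne_zero {a : ℝ} (ha : 0 < a) : phase {z | z.2.1 < a} ≠ 0 := by
  have e : {z : Y × ℝ × ℝ | z.2.1 < a} = univ ×ˢ (Iio a ×ˢ univ) := by ext; simp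
  rw [e, phase, Measure.prod_prod, Measure.prod_prod, Measure.restrict_apply measurableSet_Iio,
    Measure.restrict_apply MeasurableSet.univ, univ_inter, Iio_inter_Ioi, Real.volume_Ioo,
    Real.volume_Ioo, volume_univ_Y]
  simp [ha, Real.pi_pos]

/-- The data of an evolution of total mass `N` that stays below `M` times the equilibrium. -/
structure BoundedEvolution (M N : ℝ≥0∞) (u : Y × ℝ × ℝ → ℝ≥0∞) (g : ℝ × Y × ℝ → ℝ≥0∞) : Prop where
  measurable : Measurable u
  measurable_trace : Measurable g
  isTrace : IsTrace u g
  le_tail : ∀ y, ∀ s, 0 ≤ s → ∀ h ∈ H, u (y, s, h) ≤ M * tail s h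
  trace_le : ∀ τ, 0 ≤ τ → ∀ y, ∀ h ∈ H, g (τ, y, h) ≤ M
  mass : ∫⁻ z, u z ∂phase = N

lemma BoundedEvolution.of_minTrace (hu : Measurable u)
    (hle : ∀ y, ∀ s, 0 ≤ s → ∀ h ∈ H, u (y, s, h) ≤ M * tail s h) :
    BoundedEvolution M (∫⁻ z, u z ∂phase) u (minTrace u) :=
  ⟨hu, by fun_prop, isTrace_minTrace hu, hle, fun _ ht y _ hh => minTrace_le_const hle ht y hh, rfl⟩

lemma BoundedEvolution.lintegral_evolve (hb : BoundedEvolution M N u g) (hM : M ≠ ∞) {t : ℝ}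
    (ht : 0 ≤ t) : ∫⁻ z, evolve u g t z ∂phase = N := by
  rw [LorentzGas.lintegral_evolve hb.measurable hb.measurable_trace hb.isTrace ht
    (lintegral_flux_ne_top hM hb.trace_le t), hb.mass]

lemma BoundedEvolution.shift (hb : BoundedEvolution M N u g) (hM : M ≠ ∞) {a : ℝ} (ha : 0 ≤ a) :
    BoundedEvolution M N (evolve u g a) (fun z => g (a + z.1, z.2)) where
  measurable := by
    have := hb.measurable
    have := hb.measurable_trace
    fun_prop
  measurable_trace := by
    have := hb.measurable_trace
    fun_prop
  isTrace := hb.isTrace.shift ha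
  le_tail _ _ hs _ hh := evolve_le_tail hb.le_tail (fun τ hτ => hb.trace_le τ hτ.le) ha _ hs hh
  trace_le τ hτ y h hh := hb.trace_le _ (by simp only; linarith) y h hh
  mass := hb.lintegral_evolve hM ha

/-- The mass of the part of the solution that lies below the equilibrium `C * tail`. -/
def overlap (C : ℝ≥0∞) (v : Y × ℝ × ℝ → ℝ≥0∞) : ℝ≥0∞ :=
  ∫⁻ z, min (v z) (C * tail z.2.1 z.2.2) ∂phase

lemma evolve_add {v : Y × ℝ × ℝ → ℝ≥0∞} (hu : Measurable u) (t : ℝ) (z : Y × ℝ × ℝ) :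
    evolve (u + v) (minTrace (u + v)) t z
      = evolve u (minTrace u) t z + evolve v (minTrace v) t z := by
  rw [minTrace_add hu]
  simp only [evolve, Pi.add_apply, gain_add (measurable_minTrace hu)]
  ring

/-- The common part of the solution and the equilibrium stays common to both; the two remainders,
evolving separately, both come to lie above a constant where the next collision is near. -/
lemma overlap_evolve_ge (hM : M ≠ ∞) {C : ℝ≥0∞} (hC : C ≤ M)
    (hN : ∫⁻ z, C * tail z.2.1 z.2.2 ∂phase = N) {L T : ℝ} (hT : 0 ≤ T) {c : ℝ≥0∞}
    (hc : ∀ u : Y × ℝ × ℝ → ℝ≥0∞, ∀ g : ℝ × Y × ℝ → ℝ≥0∞, Measurable u → Measurable g →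
      IsTrace u g → ∀ y, ∀ s ∈ Ioo (0 : ℝ) (1 / 4), ∀ h ∈ H,
        c * ∫⁻ s in Ioo 0 L, ∫⁻ h in H, ∫⁻ y, u (y, s, h) ≤ evolve u g T (y, s, h))
    (hb : BoundedEvolution M N u g) :
    overlap C u + c * (N - overlap C u - ∫⁻ z in {z | z.2.1 < L}ᶜ, M * tail z.2.1 z.2.2 ∂phase) *
      phase {z | z.2.1 < 1 / 4} ≤ overlap C (evolve u g T) := by
  have hu := hb.measurable
  have hg := hb.measurable_trace
  set G : Y × ℝ × ℝ → ℝ≥0∞ := fun z => C * tail z.2.1 z.2.2 with hG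
  set w : Y × ℝ × ℝ → ℝ≥0∞ := fun z => min (u z) (G z) with hw
  have hGm : Measurable G := by fun_prop
  have hwm : Measurable w := by fun_prop
  set u₁ : Y × ℝ × ℝ → ℝ≥0∞ := u - w with hu₁
  set w₁ : Y × ℝ × ℝ → ℝ≥0∞ := G - w with hw₁
  have hu₁m : Measurable u₁ := hu.sub hwm
  have hw₁m : Measurable w₁ := hGm.sub hwm
  have eu : w + u₁ = u := by ext z; exact add_tsub_cancel_of_le (min_le_left _ _)
  have eG : w + w₁ = G := by ext z; exact add_tsub_cancel_of_le (min_le_right _ _)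
  have hNtop : N ≠ ∞ := by
    rw [← hN]
    exact (lintegral_phase_tail_lt_top C (ne_top_of_le_ne_top hM hC)).ne
  have hmw : ∫⁻ z, w z ∂phase = overlap C u := rfl
  have hmN : overlap C u ≤ N := by
    rw [← hb.mass]
    exact lintegral_mono fun z => min_le_left _ _
  have hmtop : overlap C u ≠ ∞ := ne_top_of_le_ne_top hNtop hmN
  -- the masses of the remainders
  have mu₁ : ∫⁻ z, u₁ z ∂phase = N - overlap C u := by
    refine ENNReal.eq_sub_of_add_eq' hNtop ?_
    rw [add_comm, ← hmw, ← lintegral_add_left hwm, ← hb.mass]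
    exact lintegral_congr fun z => congrFun eu z
  have mw₁ : ∫⁻ z, w₁ z ∂phase = N - overlap C u := by
    refine ENNReal.eq_sub_of_add_eq' hNtop ?_
    rw [add_comm, ← hmw, ← lintegral_add_left hwm, ← hN]
    exact lintegral_congr fun z => congrFun eG z
  set ε := ∫⁻ z in {z | z.2.1 < L}ᶜ, M * tail z.2.1 z.2.2 ∂phase with hε
  have hS : MeasurableSet {z : Y × ℝ × ℝ | z.2.1 < L} :=
    measurableSet_lt (by fun_prop) measurable_const
  have near : ∀ v : Y × ℝ × ℝ → ℝ≥0∞, Measurable v → ∫⁻ z, v z ∂phase = N - overlap C u →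
      (∀ y, ∀ s, 0 ≤ s → ∀ h ∈ H, v (y, s, h) ≤ M * tail s h) →
      N - overlap C u - ε ≤ ∫⁻ s in Ioo 0 L, ∫⁻ h in H, ∫⁻ y, v (y, s, h) := by
    intro v hv hvN hvle
    rw [← setLIntegral_phase_lt hv, ← hvN, tsub_le_iff_right, ← lintegral_add_compl v hS]
    gcongr 1
    refine lintegral_mono_ae (ae_restrict_of_ae ?_)
    filter_upwards [ae_phase] with z hz
    exact hvle _ _ hz.1.le _ hz.2
  have n₁ := near u₁ hu₁m mu₁ fun y s hs h hh => tsub_le_self.trans (hb.le_tail y s hs h hh)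
  have n₂ := near w₁ hw₁m mw₁ fun y s hs h hh => tsub_le_self.trans (mul_le_mul_left hC _)
  have hwle : ∀ y, ∀ s, 0 ≤ s → ∀ h ∈ H, w (y, s, h) ≤ M * tail s h := fun y s hs h hh =>
    (min_le_left _ _).trans (hb.le_tail y s hs h hh)
  have hbw := BoundedEvolution.of_minTrace hwm hwle
  have hmass : ∫⁻ z, evolve w (minTrace w) T z ∂phase = overlap C u := hbw.lintegral_evolve hM hT
  have hpoint : ∀ᵐ z ∂phase, evolve w (minTrace w) T z + {z : Y × ℝ × ℝ | z.2.1 < 1 / 4}.indicator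
      (fun _ => c * (N - overlap C u - ε)) z ≤ min (evolve u g T z) (G z) := by
    filter_upwards [ae_phase] with ⟨y, s, h⟩ ⟨hs, hh⟩
    have i₁ : evolve w (minTrace w) T (y, s, h) + evolve u₁ (minTrace u₁) T (y, s, h)
        ≤ evolve u g T (y, s, h) := by
      rw [← evolve_add hwm, eu]
      exact evolve_mono (fun _ _ _ _ _ => le_rfl) (fun τ hτ y h hh =>
        minTrace_le (fun t ht y h hh => (hb.isTrace t ht y h hh).ge) hτ.le y hh) hT y hs.le hh
    have i₂ : evolve w (minTrace w) T (y, s, h) + evolve w₁ (minTrace w₁) T (y, s, h)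
        ≤ G (y, s, h) := by
      rw [← evolve_add hwm, eG]
      refine le_trans ?_ (evolve_tail C hT (y, s, h)).le
      exact evolve_mono (fun _ _ _ _ _ => le_rfl) (fun τ hτ y h hh =>
        minTrace_le_const (fun y s hs h hh => le_rfl) hτ.le y hh) hT y hs.le hh
    refine le_min (le_trans ?_ i₁) (le_trans ?_ i₂)
    all_goals
      gcongr 1
      by_cases hs' : s < 1 / 4
      swap
      · rw [indicator_of_notMem (by exact hs')]
        exact zero_le
      rw [indicator_of_mem (by exact hs')]
    · exact (mul_le_mul_right n₁ c).trans
        (hc u₁ _ hu₁m (measurable_minTrace hu₁m) (isTrace_minTrace hu₁m) y s ⟨hs, hs'⟩ h hh)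
    · exact (mul_le_mul_right n₂ c).trans
        (hc w₁ _ hw₁m (measurable_minTrace hw₁m) (isTrace_minTrace hw₁m) y s ⟨hs, hs'⟩ h hh)
  have hB : MeasurableSet {z : Y × ℝ × ℝ | z.2.1 < 1 / 4} :=
    measurableSet_lt (by fun_prop) measurable_const
  calc _ = ∫⁻ z, (evolve w (minTrace w) T z + {z : Y × ℝ × ℝ | z.2.1 < 1 / 4}.indicator
        (fun _ => c * (N - overlap C u - ε)) z) ∂phase := by
        rw [lintegral_add_left (by fun_prop), hmass, lintegral_indicator_const hB]
    _ ≤ _ := lintegral_mono_ae hpoint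

lemma overlap_mono_evolve (hM : M ≠ ∞) {C : ℝ≥0∞} (hC : C ≤ M)
    (hN : ∫⁻ z, C * tail z.2.1 z.2.2 ∂phase = N) (hb : BoundedEvolution M N u g) {t : ℝ}
    (ht : 0 ≤ t) : overlap C u ≤ overlap C (evolve u g t) :=
  le_self_add.trans (overlap_evolve_ge hM hC hN (L := 0) ht (c := 0) (by simp) hb)

lemma tendsto_lintegral_phase_far (hM : M ≠ ∞) :
    Tendsto (fun n : ℕ => ∫⁻ z in {z | z.2.1 < n}ᶜ, M * tail z.2.1 z.2.2 ∂phase) atTop (𝓝 0) := by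
  set f : Y × ℝ × ℝ → ℝ≥0∞ := fun z => M * tail z.2.1 z.2.2
  have hS : ∀ n : ℕ, MeasurableSet {z : Y × ℝ × ℝ | z.2.1 < n}ᶜ := fun n =>
    (measurableSet_lt (by fun_prop) measurable_const).compl
  have h := tendsto_measure_iInter_atTop (μ := phase.withDensity f)
    (s := fun n : ℕ => {z : Y × ℝ × ℝ | z.2.1 < n}ᶜ) (fun n => (hS n).nullMeasurableSet) ?_ ⟨0, ?_⟩
  · have he : (⋂ n : ℕ, {z : Y × ℝ × ℝ | z.2.1 < n}ᶜ) = ∅ := by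
      refine eq_empty_of_forall_notMem fun z hz => ?_
      obtain ⟨n, hn⟩ := exists_nat_gt z.2.1
      exact mem_iInter.1 hz n hn
    rw [he, measure_empty] at h
    refine h.congr fun n => ?_
    simp only [Function.comp_apply]
    rw [withDensity_apply _ (hS n)]
  · intro m n hmn z hz hz'
    exact hz (lt_of_lt_of_le (show z.2.1 < m from hz') (by exact_mod_cast hmn))
  · rw [withDensity_apply _ (hS 0)]
    exact ((setLIntegral_le_lintegral _ _).trans_lt (lintegral_phase_tail_lt_top M hM)).ne

/-- Convergence to the equilibrium with the same mass: the overlap would otherwise grow by a fixed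
amount infinitely often. -/
theorem BoundedEvolution.tendsto_overlap (hb : BoundedEvolution M N u g) (hM : M ≠ ∞) {C : ℝ≥0∞}
    (hC : C ≤ M) (hN : ∫⁻ z, C * tail z.2.1 z.2.2 ∂phase = N) :
    Tendsto (fun t => overlap C (evolve u g t)) atTop (𝓝 N) := by
  have hNtop : N ≠ ∞ := by
    rw [← hN]
    exact (lintegral_phase_tail_lt_top C (ne_top_of_le_ne_top hM hC)).ne
  have hle : ∀ t, overlap C (evolve u g t) ≤ N := fun t => by
    rw [← hN]
    exact lintegral_mono fun z => min_le_right _ _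
  have hmono : ∀ a t, 0 ≤ a → 0 ≤ t →
      overlap C (evolve u g a) ≤ overlap C (evolve u g (a + t)) := fun a t ha ht => by
    refine (overlap_mono_evolve hM hC hN (hb.shift hM ha) ht).trans_eq ?_
    exact lintegral_congr fun z => by rw [evolve_evolve u g ha ht]
  have hreach : ∀ ℓ < N, ∃ t, 0 ≤ t ∧ ℓ < overlap C (evolve u g t) := by
    intro ℓ hℓ
    by_contra! hcon
    have hpos : 0 < N - ℓ := tsub_pos_of_lt hℓ
    obtain ⟨n, hn⟩ := ((tendsto_order.1 (tendsto_lintegral_phase_far hM)).2 _ hpos).exists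
    set ε := ∫⁻ z in {z | z.2.1 < (n : ℝ)}ᶜ, M * tail z.2.1 z.2.2 ∂phase
    obtain ⟨T, hT, c, hc, hT'⟩ := exists_le_evolve n
    set δ := c * (N - ℓ - ε) * phase {z | z.2.1 < 1 / 4} with hδ
    have hδ0 : δ ≠ 0 := mul_ne_zero (mul_ne_zero hc (tsub_pos_of_lt hn).ne')
      (phase_lt_ne_zero (by norm_num))
    have hstep : ∀ k : ℕ, k * δ ≤ overlap C (evolve u g (k * T)) := by
      intro k
      induction k with
      | zero => simp
      | succ k ih =>
        have hkT : 0 ≤ k * T := by positivity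
        have := overlap_evolve_ge hM hC hN hT hT' (hb.shift hM hkT)
        calc ((k + 1 : ℕ) : ℝ≥0∞) * δ = k * δ + δ := by push_cast; ring
          _ ≤ _ := by
            refine (add_le_add ih ?_).trans (this.trans_eq ?_)
            · rw [hδ]
              gcongr
              exact hcon _ hkT
            · refine lintegral_congr fun z => ?_
              rw [evolve_evolve u g hkT hT, show k * T + T = (k + 1 : ℕ) * T by push_cast; ring]
    obtain ⟨k, hk⟩ := ENNReal.exists_nat_mul_gt hδ0 hNtop
    exact absurd (hk.trans_le ((hstep k).trans (hle _))) (lt_irrefl _)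
  refine tendsto_order.2 ⟨fun ℓ hℓ => ?_, fun ℓ hℓ => .of_forall fun t => (hle t).trans_lt hℓ⟩
  obtain ⟨t₀, h0, ht₀⟩ := hreach ℓ hℓ
  filter_upwards [eventually_ge_atTop t₀] with t ht
  refine ht₀.trans_le ?_
  have := hmono t₀ (t - t₀) h0 (by linarith)
  rwa [add_sub_cancel] at this

end

/-! ### Uniqueness -/

/-- The point of `Phase` with the grouped coordinates `w`. -/
def ungroup (w : Y × ℝ × ℝ) : Phase := (w.1.1, w.1.2, w.2.1, w.2.2)

lemma phaseMeasure_eq : phaseMeasure = (volume : Measure T2).prod ((volume : Measure S1).prod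
    ((volume.restrict (Ioi (0 : ℝ))).prod (volume.restrict H))) := by
  rw [phaseMeasure, restrict_H, Measure.restrict_congr_set Ioi_ae_eq_Ici]

lemma measurePreserving_ungroup : MeasurePreserving ungroup phase phaseMeasure := by
  rw [phaseMeasure_eq]
  exact measurePreserving_prodAssoc _ _ _

/-- The point of `Y × ℝ × ℝ` with the ungrouped coordinates `z`. -/
def regroup (z : Phase) : Y × ℝ × ℝ := ((z.1, z.2.1), z.2.2.1, z.2.2.2)

lemma measurePreserving_regroup : MeasurePreserving regroup phaseMeasure phase := by
  rw [phaseMeasure_eq]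
  exact (measurePreserving_prodAssoc (volume : Measure T2) (volume : Measure S1)
    ((volume.restrict (Ioi (0 : ℝ))).prod (volume.restrict H))).symm MeasurableEquiv.prodAssoc

/-- The measure `dt dy dh` on `(0, T) × (𝐓² × 𝐒¹) × (-1, 1)`. -/
def traceVol (T : ℝ) : Measure (ℝ × Y × ℝ) :=
  (volume.restrict (Ioo 0 T)).prod ((volume : Measure Y).prod (volume.restrict H))

instance (T : ℝ) : IsFiniteMeasure (traceVol T) := by unfold traceVol; infer_instance

/-- The trace of `F` on `s = 0`. -/
def traceOf (F : ℝ → Phase → ℝ) (p : ℝ × Y × ℝ) : ℝ := F p.1 (p.2.1.1, p.2.1.2, 0, p.2.2)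

lemma measurePreserving_traceVol (T : ℝ) :
    MeasurePreserving (fun p : ℝ × Y × ℝ => ((p.1, p.2.1.1, p.2.1.2, p.2.2) : ℝ × T2 × S1 × ℝ))
      (traceVol T) (traceMeasure T) := by
  rw [traceMeasure, traceVol, ← restrict_H,
    Measure.restrict_congr_set (Ioo_ae_eq_Icc (a := (0 : ℝ)) (b := T))]
  exact (MeasurePreserving.id _).prod (measurePreserving_prodAssoc (volume : Measure T2)
    (volume : Measure S1) (volume.restrict H))

lemma measurePreserving_traceVol_symm (T : ℝ) :
    MeasurePreserving (fun p : ℝ × T2 × S1 × ℝ => ((p.1, (p.2.1, p.2.2.1), p.2.2.2) : ℝ × Y × ℝ))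
      (traceMeasure T) (traceVol T) := by
  rw [traceMeasure, traceVol, ← restrict_H,
    Measure.restrict_congr_set (Ioo_ae_eq_Icc (a := (0 : ℝ)) (b := T))]
  have h : MeasurePreserving (fun q : T2 × S1 × ℝ => ((q.1, q.2.1), q.2.2))
      ((volume : Measure T2).prod ((volume : Measure S1).prod (volume.restrict H)))
      ((volume : Measure Y).prod (volume.restrict H)) :=
    (measurePreserving_prodAssoc (volume : Measure T2) (volume : Measure S1)
      (volume.restrict H)).symm MeasurableEquiv.prodAssoc
  exact (MeasurePreserving.id (volume.restrict (Icc 0 T))).prod h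

lemma IsSolution.integrable_traceOf {fin : T2 × S1 → ℝ} {F : ℝ → Phase → ℝ}
    (hF : IsSolution fin F) {T : ℝ} (hT : 0 ≤ T) : Integrable (traceOf F) (traceVol T) :=
  (measurePreserving_traceVol T).integrable_comp_of_integrable (hF.trace_integrable T hT)

/-- Applying to `y` a transformation that depends on the time and on the impact parameter, and that
preserves the measure. -/
lemma measurePreserving_shear (T : ℝ) {θ : ℝ × ℝ → Y → Y} (hθ : Measurable (Function.uncurry θ))
    (hp : ∀ q, MeasurePreserving (θ q)) :
    MeasurePreserving (fun p : Y × ℝ × ℝ => ((p.2.1, θ p.2 p.1, p.2.2) : ℝ × Y × ℝ))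
      ((volume : Measure Y).prod ((volume.restrict (Ioo 0 T)).prod (volume.restrict H)))
      (traceVol T) := by
  set ρ := (volume.restrict (Ioo 0 T)).prod (volume.restrict H) with hρ
  have h1 : MeasurePreserving (fun p : (ℝ × ℝ) × Y => (p.1, θ p.1 p.2))
      (ρ.prod volume) (ρ.prod volume) :=
    (MeasurePreserving.id ρ).skew_product hθ (ae_of_all _ fun q => (hp q).map_eq)
  have h2 : MeasurePreserving (fun p : (ℝ × ℝ) × Y => ((p.1.1, p.1.2, p.2) : ℝ × ℝ × Y))
      (ρ.prod volume) ((volume.restrict (Ioo 0 T)).prod ((volume.restrict H).prod volume)) :=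
    measurePreserving_prodAssoc _ _ _
  have h3 : MeasurePreserving (fun p : ℝ × ℝ × Y => ((p.1, p.2.2, p.2.1) : ℝ × Y × ℝ))
      ((volume.restrict (Ioo 0 T)).prod ((volume.restrict H).prod volume)) (traceVol T) :=
    (MeasurePreserving.id _).prod Measure.measurePreserving_swap
  exact h3.comp (h2.comp (h1.comp Measure.measurePreserving_swap))

/-- The map that sends `(y, τ, h')` to the state from which a collision at the time `τ`, with the
impact parameter `h'`, leads to the characteristic curve starting from `y`. -/
lemma measurePreserving_incoming (T : ℝ) :
    MeasurePreserving (fun p : Y × ℝ × ℝ => ((p.2.1, bounce p.2.2 (flow p.2.1 p.1), p.2.2) :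
      ℝ × Y × ℝ)) ((volume : Measure Y).prod
        ((volume.restrict (Ioo 0 T)).prod (volume.restrict H))) (traceVol T) :=
  measurePreserving_shear T (θ := fun q y => bounce q.2 (flow q.1 y))
    (by simp only [Function.uncurry_def]; fun_prop)
    fun q => (measurePreserving_bounce q.2).comp (measurePreserving_flow q.1)

/-- The map that sends `(y, σ, h)` to the end of the characteristic curve starting there. -/
lemma measurePreserving_endpoint (T : ℝ) :
    MeasurePreserving (fun p : Y × ℝ × ℝ => ((p.2.1, flow p.2.1 p.1, p.2.2) : ℝ × Y × ℝ))
      ((volume : Measure Y).prod ((volume.restrict (Ioo 0 T)).prod (volume.restrict H)))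
      (traceVol T) :=
  measurePreserving_shear T (θ := fun q y => flow q.1 y)
    (by simp only [Function.uncurry_def]; fun_prop) fun q => measurePreserving_flow q.1

lemma ae_integrable_incoming {a : ℝ × Y × ℝ → ℝ} {T : ℝ} (ha : Integrable a (traceVol T)) :
    ∀ᵐ y : Y, Integrable (fun q : ℝ × ℝ => a (q.1, bounce q.2 (flow q.1 y), q.2))
      ((volume.restrict (Ioo 0 T)).prod (volume.restrict H)) :=
  ((measurePreserving_incoming T).integrable_comp_of_integrable ha).prod_right_ae

lemma two_mul_P_eq_toReal {s h h' : ℝ} (hs : 0 < s) (hh : h ∈ H) (hh' : h' ∈ H) :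
    2 * P (2 * s) h h' = (kernel s h h').toReal := by
  rw [kernel, ENNReal.toReal_ofReal
    (two_mul_P_nonneg hs (abs_le_one_of_mem hh) (abs_le_one_of_mem hh'))]

/-- The collision term along a characteristic curve, as a double integral. -/
lemma integral_collisions_eq {a : ℝ × Y × ℝ → ℝ} {T t σ h : ℝ} {y : Y} (hh : h ∈ H)
    (htT : t ≤ T) (htσ : t ≤ σ)
    (ha : Integrable (fun q : ℝ × ℝ => a (q.1, bounce q.2 (flow q.1 y), q.2))
      ((volume.restrict (Ioo 0 T)).prod (volume.restrict H))) :
    Integrable (fun q : ℝ × ℝ => (kernel (σ - q.1) h q.2).toReal *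
      a (q.1, bounce q.2 (flow q.1 y), q.2))
      ((volume.restrict (Ioo 0 t)).prod (volume.restrict H)) ∧
    ∫ τ in Icc (0 : ℝ) t, ∫ h' in Icc (-1 : ℝ) 1, 2 * P (2 * (σ - τ)) h h' *
      a (τ, bounce h' (flow τ y), h') = ∫ q : ℝ × ℝ, (kernel (σ - q.1) h q.2).toReal *
      a (q.1, bounce q.2 (flow q.1 y), q.2)
      ∂((volume.restrict (Ioo 0 t)).prod (volume.restrict H)) := by
  have hmem : ∀ᵐ q : ℝ × ℝ ∂((volume.restrict (Ioo 0 t)).prod (volume.restrict H)),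
      q.1 ∈ Ioo 0 t ∧ q.2 ∈ H := by
    rw [Measure.prod_restrict]
    filter_upwards [ae_restrict_mem (measurableSet_Ioo.prod measurableSet_Ioo)] with q hq
    exact hq
  have hint : Integrable (fun q : ℝ × ℝ => (kernel (σ - q.1) h q.2).toReal *
      a (q.1, bounce q.2 (flow q.1 y), q.2))
      ((volume.restrict (Ioo 0 t)).prod (volume.restrict H)) := by
    have ha' : Integrable (fun q : ℝ × ℝ => a (q.1, bounce q.2 (flow q.1 y), q.2))
        ((volume.restrict (Ioo 0 t)).prod (volume.restrict H)) := by
      refine ha.mono_measure ?_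
      rw [Measure.prod_restrict, Measure.prod_restrict]
      exact Measure.restrict_mono (prod_mono (Ioo_subset_Ioo le_rfl htT) le_rfl) le_rfl
    refine ha'.bdd_mul (c := 1) (Measurable.aestronglyMeasurable (by fun_prop)) ?_
    filter_upwards [hmem] with q hq
    rw [Real.norm_of_nonneg ENNReal.toReal_nonneg]
    exact ENNReal.toReal_le_of_le_ofReal zero_le_one (by
      simpa using kernel_le_one (by linarith [hq.1.2]) hh hq.2)
  refine ⟨hint, ?_⟩
  rw [integral_prod _ hint, ← restrict_H, ← Measure.restrict_congr_set Ioo_ae_eq_Icc]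
  refine setIntegral_congr_fun measurableSet_Ioo fun τ hτ => ?_
  refine setIntegral_congr_fun measurableSet_Ioo fun h' hh' => ?_
  simp only
  rw [two_mul_P_eq_toReal (by linarith [hτ.2]) hh hh']

section
variable {fin : T2 × S1 → ℝ} {F G : ℝ → Phase → ℝ}

/-- Along almost every characteristic curve, the difference of two solutions is bounded by that of
their traces. -/
lemma enorm_sub_le (hF : IsSolution fin F) (hG : IsSolution fin G) {T : ℝ} (hT : 0 ≤ T) :
    ∀ᵐ w ∂phase, ∀ t, 0 ≤ t → t ≤ T → t ≤ w.2.1 →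
      ‖F t (ungroup (flow t w.1, w.2.1 - t, w.2.2)) - G t (ungroup (flow t w.1, w.2.1 - t, w.2.2))‖ₑ
        ≤ ∫⁻ q : ℝ × ℝ, ‖traceOf F (q.1, bounce q.2 (flow q.1 w.1), q.2) -
          traceOf G (q.1, bounce q.2 (flow q.1 w.1), q.2)‖ₑ
            ∂((volume.restrict (Ioo 0 t)).prod (volume.restrict H)) := by
  have iF := (Measure.quasiMeasurePreserving_fst (μ := (volume : Measure Y))
    (ν := (volume.restrict (Ioi (0 : ℝ))).prod (volume.restrict H))).ae
    (ae_integrable_incoming (hF.integrable_traceOf hT))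
  have iG := (Measure.quasiMeasurePreserving_fst (μ := (volume : Measure Y))
    (ν := (volume.restrict (Ioi (0 : ℝ))).prod (volume.restrict H))).ae
    (ae_integrable_incoming (hG.integrable_traceOf hT))
  filter_upwards [ae_phase, iF, iG,
    measurePreserving_ungroup.quasiMeasurePreserving.ae hF.characteristics,
    measurePreserving_ungroup.quasiMeasurePreserving.ae hG.characteristics]
    with ⟨⟨x, ω⟩, σ, h⟩ ⟨hs, hh⟩ jF jG cF cG t h0 htT htσ
  obtain ⟨kF, eF⟩ := integral_collisions_eq (a := traceOf F) hh htT htσ jF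
  obtain ⟨kG, eG⟩ := integral_collisions_eq (a := traceOf G) hh htT htσ jG
  have cF' := cF t ⟨h0, htσ⟩
  have cG' := cG t ⟨h0, htσ⟩
  simp only [ungroup, flow] at cF' cG' ⊢
  rw [cF', cG', add_sub_add_left_eq_sub]
  refine le_trans (le_of_eq ?_) (le_trans (enorm_integral_le_lintegral_enorm
    (μ := (volume.restrict (Ioo 0 t)).prod (volume.restrict H)) (fun q : ℝ × ℝ =>
      (kernel (σ - q.1) h q.2).toReal * traceOf F (q.1, bounce q.2 (flow q.1 (x, ω)), q.2) -
      (kernel (σ - q.1) h q.2).toReal * traceOf G (q.1, bounce q.2 (flow q.1 (x, ω)), q.2))) ?_)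
  · rw [integral_sub kF kG, ← eF, ← eG]
    rfl
  · refine lintegral_mono_ae ?_
    rw [Measure.prod_restrict]
    filter_upwards [ae_restrict_mem (measurableSet_Ioo.prod measurableSet_Ioo)] with q hq
    rw [← mul_sub, enorm_mul]
    refine mul_le_of_le_one_left' ?_
    rw [Real.enorm_of_nonneg ENNReal.toReal_nonneg]
    exact ENNReal.ofReal_toReal_le.trans
      (kernel_le_one (by simp only at htσ; linarith [hq.1.2]) hh hq.2)

/-- A form of Gronwall's lemma: on an interval of length `1/4` the hypothesis bounds the integral by
half of itself. -/
lemma setLIntegral_eq_zero_of_le {q : ℝ → ℝ≥0∞} {T : ℝ} (hfin : ∫⁻ t in Ioo 0 T, q t ≠ ∞)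
    (hq : ∀ a b, 0 ≤ a → a ≤ b → b ≤ T →
      ∫⁻ t in Ioo a b, q t ≤ ENNReal.ofReal (b - a) * (2 * ∫⁻ t in Ioo 0 b, q t)) :
    ∫⁻ t in Ioo 0 T, q t = 0 := by
  rcases le_or_gt T 0 with hT | hT
  · simp [Ioo_eq_empty_of_le hT]
  have key : ∀ n : ℕ, ∫⁻ t in Ioo 0 (min T (n / 4)), q t = 0 := by
    intro n
    induction n with
    | zero => simp [hT.le]
    | succ n ih =>
      set a := min T ((n : ℝ) / 4) with ha
      set b := min T (((n + 1 : ℕ) : ℝ) / 4) with hb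
      have h0a : 0 ≤ a := le_min hT.le (by positivity)
      have hab : a ≤ b := min_le_min_left _ (by push_cast; linarith)
      have hba : b - a ≤ 1 / 4 := by
        rw [sub_le_iff_le_add, ha, ← min_add_add_left]
        refine le_min ((min_le_left _ _).trans (by linarith)) ((min_le_right _ _).trans ?_)
        push_cast; linarith
      have hsub : Ioo 0 b ⊆ Ioo 0 a ∪ Ico a b := fun x hx => by
        rcases lt_or_ge x a with h | h
        · exact Or.inl ⟨hx.1, h⟩
        · exact Or.inr ⟨h, hx.2⟩
      have h1 : ∫⁻ t in Ioo 0 b, q t ≤ ∫⁻ t in Ioo a b, q t := by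
        refine (lintegral_mono_set hsub).trans ((lintegral_union_le _ _ _).trans ?_)
        rw [ih, zero_add, setLIntegral_congr Ioo_ae_eq_Ico]
      have hQ : ∫⁻ t in Ioo 0 b, q t ≠ ∞ :=
        ne_top_of_le_ne_top hfin (lintegral_mono_set (Ioo_subset_Ioo le_rfl (min_le_left _ _)))
      have h2 := h1.trans (hq a b h0a hab (min_le_left _ _))
      have h3 : ∫⁻ t in Ioo 0 b, q t ≤ ENNReal.ofReal (1 / 2) * ∫⁻ t in Ioo 0 b, q t := by
        refine h2.trans ?_
        rw [← mul_assoc]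
        gcongr
        rw [show (2 : ℝ≥0∞) = ENNReal.ofReal 2 by simp, ← ENNReal.ofReal_mul (by linarith)]
        exact ENNReal.ofReal_le_ofReal (by linarith)
      by_contra hne
      have h4 := ENNReal.mul_lt_mul_left hne hQ (show ENNReal.ofReal (1 / 2) < 1 by
        rw [← ENNReal.ofReal_one]; exact (ENNReal.ofReal_lt_ofReal_iff one_pos).2 (by norm_num))
      rw [one_mul] at h4
      exact absurd (h3.trans_lt h4) (lt_irrefl _)
  obtain ⟨n, hn⟩ := exists_nat_ge (4 * T)
  have := key n
  rwa [min_eq_left (by linarith)] at this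

end

lemma prod_prod_absolutelyContinuous {A B : Set ℝ} (h : A ⊆ B) :
    (volume : Measure Y).prod ((volume.restrict A).prod (volume.restrict H))
      ≪ (volume : Measure Y).prod ((volume.restrict B).prod (volume.restrict H)) :=
  Measure.AbsolutelyContinuous.rfl.prod
    ((Measure.restrict_mono h le_rfl).absolutelyContinuous.prod Measure.AbsolutelyContinuous.rfl)

lemma ae_prod_of_subset {a b c d : ℝ} (hca : c ≤ a) (hbd : b ≤ d) {p : ℝ × ℝ → Prop}
    (hp : ∀ᵐ q ∂((volume.restrict (Ioo c d)).prod (volume.restrict H)), p q) :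
    ∀ᵐ q ∂((volume.restrict (Ioo a b)).prod (volume.restrict H)), p q :=
  (Measure.AbsolutelyContinuous.prod (Measure.restrict_mono (Ioo_subset_Ioo hca hbd)
    le_rfl).absolutelyContinuous Measure.AbsolutelyContinuous.rfl).ae_le hp

section
variable {fin : T2 × S1 → ℝ} {F G : ℝ → Phase → ℝ}

/-- A function that is bounded by its incoming values on the past of its characteristic curve
vanishes. -/
lemma ae_eq_zero_of_le_incoming {δ : ℝ × Y × ℝ → ℝ≥0∞} (hδ : Measurable δ) {T : ℝ}
    (hfin : ∫⁻ p, δ p ∂(traceVol T) ≠ ∞)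
    (hle : ∀ᵐ w ∂((volume : Measure Y).prod ((volume.restrict (Ioo 0 T)).prod (volume.restrict H))),
      δ (w.2.1, flow w.2.1 w.1, w.2.2) ≤ ∫⁻ q : ℝ × ℝ, δ (q.1, bounce q.2 (flow q.1 w.1), q.2)
        ∂((volume.restrict (Ioo 0 w.2.1)).prod (volume.restrict H))) :
    δ =ᵐ[traceVol T] 0 := by
  have hflux : ∀ b, ∫⁻ p, δ p ∂(traceVol b) = ∫⁻ t in Ioo 0 b, ∫⁻ h in H, flux δ t h := fun b => by
    rw [← (measurePreserving_endpoint b).lintegral_comp hδ, lintegral_prod_prod (by fun_prop)]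
    refine lintegral_congr fun t => lintegral_congr fun h => ?_
    exact lintegral_flow (f := fun y => δ (t, y, h)) (by fun_prop) t
  rw [hflux] at hfin
  rw [← lintegral_eq_zero_iff hδ, hflux]
  refine setLIntegral_eq_zero_of_le hfin fun a b ha hab hbT => ?_
  have hR : Measurable fun y : Y => ∫⁻ q : ℝ × ℝ, δ (q.1, bounce q.2 (flow q.1 y), q.2)
      ∂((volume.restrict (Ioo 0 b)).prod (volume.restrict H)) :=
    Measurable.lintegral_prod_right' (f := fun r : Y × ℝ × ℝ =>
      δ (r.2.1, bounce r.2.2 (flow r.2.1 r.1), r.2.2)) (by fun_prop)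
  calc ∫⁻ t in Ioo a b, ∫⁻ h in H, flux δ t h
      = ∫⁻ w, δ (w.2.1, flow w.2.1 w.1, w.2.2)
          ∂((volume : Measure Y).prod ((volume.restrict (Ioo a b)).prod (volume.restrict H))) := by
        rw [lintegral_prod_prod (by fun_prop)]
        refine lintegral_congr fun t => lintegral_congr fun h => ?_
        exact (lintegral_flow (f := fun y => δ (t, y, h)) (by fun_prop) t).symm
    _ ≤ ∫⁻ w, ∫⁻ q : ℝ × ℝ, δ (q.1, bounce q.2 (flow q.1 w.1), q.2)
          ∂((volume.restrict (Ioo 0 b)).prod (volume.restrict H))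
          ∂((volume : Measure Y).prod ((volume.restrict (Ioo a b)).prod (volume.restrict H))) := by
        have hm : ∀ᵐ w ∂((volume : Measure Y).prod ((volume.restrict (Ioo a b)).prod
            (volume.restrict H))), w.2.1 ∈ Ioo a b :=
          (Measure.quasiMeasurePreserving_fst.comp Measure.quasiMeasurePreserving_snd).ae
            (ae_restrict_mem measurableSet_Ioo)
        refine lintegral_mono_ae ?_
        filter_upwards [hm, (prod_prod_absolutelyContinuous (Ioo_subset_Ioo ha hbT)).ae_le hle]
          with w hw hw'
        refine hw'.trans (lintegral_mono' ?_ le_rfl)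
        rw [Measure.prod_restrict, Measure.prod_restrict]
        exact Measure.restrict_mono (prod_mono (Ioo_subset_Ioo le_rfl hw.2.le) le_rfl) le_rfl
    _ = ENNReal.ofReal (b - a) * (2 * ∫⁻ y, ∫⁻ q : ℝ × ℝ, δ (q.1, bounce q.2 (flow q.1 y), q.2)
          ∂((volume.restrict (Ioo 0 b)).prod (volume.restrict H))) := by
        rw [lintegral_prod_prod (f := fun w => ∫⁻ q : ℝ × ℝ, δ (q.1, bounce q.2 (flow q.1 w.1), q.2)
          ∂((volume.restrict (Ioo 0 b)).prod (volume.restrict H))) (by fun_prop)]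
        simp only [setLIntegral_const, Real.volume_Ioo]
        norm_num
        ring
    _ = _ := by
        congr 2
        rw [← hflux, ← (measurePreserving_incoming b).lintegral_comp hδ, lintegral_prod _
          (Measurable.aemeasurable (by fun_prop))]

lemma IsSolution.traceOf_ae_eq (hF : IsSolution fin F) (hG : IsSolution fin G) {T : ℝ}
    (hT : 0 ≤ T) : traceOf F =ᵐ[traceVol T] traceOf G := by
  have hd := ((hF.integrable_traceOf hT).sub (hG.integrable_traceOf hT))
  have hδ : AEMeasurable (fun p => ‖traceOf F p - traceOf G p‖ₑ) (traceVol T) :=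
    hd.aestronglyMeasurable.enorm
  obtain ⟨δ, hδm, hδe⟩ := hδ
  have hzero : δ =ᵐ[traceVol T] 0 := by
    refine ae_eq_zero_of_le_incoming hδm ?_ ?_
    · rw [← lintegral_congr_ae hδe]
      exact hd.hasFiniteIntegral.ne
    · have hin := Measure.ae_ae_of_ae_prod
        ((measurePreserving_incoming T).quasiMeasurePreserving.ae hδe)
      have hm : ∀ᵐ w ∂((volume : Measure Y).prod ((volume.restrict (Ioo 0 T)).prod
          (volume.restrict H))), w.2.1 ∈ Ioo 0 T :=
        (Measure.quasiMeasurePreserving_fst.comp Measure.quasiMeasurePreserving_snd).ae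
          (ae_restrict_mem measurableSet_Ioo)
      filter_upwards [hm, Measure.quasiMeasurePreserving_fst.ae hin,
        (measurePreserving_endpoint T).quasiMeasurePreserving.ae hδe,
        (prod_prod_absolutelyContinuous Ioo_subset_Ioi_self).ae_le (enorm_sub_le hF hG hT)]
        with w hw h1 h2 h3
      rw [← h2]
      refine le_trans (le_of_eq ?_) ((h3 w.2.1 hw.1.le hw.2.le le_rfl).trans (le_of_eq ?_))
      · rw [sub_self]
        rfl
      · exact lintegral_congr_ae (ae_prod_of_subset le_rfl hw.2.le h1)
  filter_upwards [hδe, hzero] with p h1 h2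
  rw [h2] at h1
  exact sub_eq_zero.1 (enorm_eq_zero.1 h1)

theorem IsSolution.ae_eq (hF : IsSolution fin F) (hG : IsSolution fin G) {t : ℝ} (ht : 0 ≤ t) :
    F t =ᵐ[phaseMeasure] G t := by
  have hin := Measure.ae_ae_of_ae_prod
    ((measurePreserving_incoming t).quasiMeasurePreserving.ae (hF.traceOf_ae_eq hG ht))
  have h1 : ∀ᵐ w ∂phase, t ≤ w.2.1 → F t (ungroup (flow t w.1, w.2.1 - t, w.2.2))
      = G t (ungroup (flow t w.1, w.2.1 - t, w.2.2)) := by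
    have hin' := (Measure.quasiMeasurePreserving_fst (μ := (volume : Measure Y))
      (ν := (volume.restrict (Ioi (0 : ℝ))).prod (volume.restrict H))).ae hin
    filter_upwards [hin', enorm_sub_le hF hG ht] with w hw h2 htw
    refine sub_eq_zero.1 (enorm_eq_zero.1 (le_antisymm ((h2 t ht le_rfl htw).trans_eq ?_) zero_le))
    rw [← lintegral_zero]
    refine lintegral_congr_ae ?_
    filter_upwards [hw] with q hq
    rw [hq, sub_self, enorm_zero]
  have hshift : Measure.QuasiMeasurePreserving
      (fun w : Y × ℝ × ℝ => (flow (-t) w.1, w.2.1 + t, w.2.2)) phase phase := by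
    have ha := (measurePreserving_add_right (volume : Measure ℝ) t).restrict_preimage
      (measurableSet_Ioi (a := t))
    rw [show (fun x => x + t) ⁻¹' Ioi t = Ioi 0 by ext x; simp] at ha
    have hb := (measurePreserving_flow (-t)).prod (ha.prod (MeasurePreserving.id (volume.restrict H)))
    exact hb.quasiMeasurePreserving.mono_right
      (prod_prod_absolutelyContinuous (Ioi_subset_Ioi ht))
  have h2 : ∀ᵐ w ∂phase, F t (ungroup w) = G t (ungroup w) := by
    filter_upwards [ae_phase, hshift.ae h1] with w hw h3
    have h4 := h3 (le_add_of_nonneg_left hw.1.le)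
    simp only [flow_flow, neg_add_cancel, flow_zero, add_sub_cancel_right] at h4
    exact h4
  exact measurePreserving_regroup.quasiMeasurePreserving.ae h2

end

/-! ### Existence -/

/-- The initial density `f(y) E(s, h)`. -/
def initial (f : Y → ℝ≥0∞) (z : Y × ℝ × ℝ) : ℝ≥0∞ := f z.1 * tail z.2.1 z.2.2

/-- The solution with the initial density `f(y) E(s, h)`. -/
def solution (f : Y → ℝ≥0∞) (t : ℝ) (z : Phase) : ℝ :=
  (evolve (initial f) (minTrace (initial f)) t (regroup z)).toReal

lemma exists_density {fin : T2 × S1 → ℝ} (hfin : MemLp fin ∞ (volume : Measure (T2 × S1)))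
    (hpos : ∀ᵐ z ∂(volume : Measure (T2 × S1)), 0 ≤ fin z) :
    ∃ f : Y → ℝ≥0∞, ∃ M : ℝ≥0∞, M ≠ ∞ ∧ Measurable f ∧ (∀ y, f y ≤ M) ∧
      ∀ᵐ y, fin y = (f y).toReal := by
  obtain ⟨k, hk, hke⟩ := hfin.aestronglyMeasurable
  refine ⟨fun y => min ‖k y‖ₑ (eLpNorm fin ∞ volume), eLpNorm fin ∞ volume, hfin.eLpNorm_ne_top,
    hk.measurable.enorm.min measurable_const, fun y => min_le_right _ _, ?_⟩
  have hle : ∀ᵐ y, ‖fin y‖ₑ ≤ eLpNorm fin ∞ volume := by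
    rw [eLpNorm_exponent_top]
    exact enorm_ae_le_eLpNormEssSup fin volume
  filter_upwards [hke, hpos, hle] with y h1 h2 h3
  rw [← h1, min_eq_left h3, toReal_enorm, Real.norm_of_nonneg h2]

section
variable {f : Y → ℝ≥0∞} {M : ℝ≥0∞}

@[fun_prop]
lemma measurable_initial (hf : Measurable f) : Measurable (initial f) := by
  unfold initial
  fun_prop

lemma boundedEvolution_initial (hf : Measurable f) (hfM : ∀ y, f y ≤ M) :
    BoundedEvolution M (∫⁻ z, initial f z ∂phase) (initial f) (minTrace (initial f)) :=
  .of_minTrace (by fun_prop) fun y _ _ _ _ => mul_le_mul_left (hfM y) _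

lemma evolve_initial_le (hf : Measurable f) (hfM : ∀ y, f y ≤ M) {t : ℝ} (ht : 0 ≤ t) (y : Y)
    {s h : ℝ} (hs : 0 ≤ s) (hh : h ∈ H) :
    evolve (initial f) (minTrace (initial f)) t (y, s, h) ≤ M := by
  have hb := boundedEvolution_initial hf hfM
  refine (evolve_le_tail hb.le_tail (fun τ hτ => hb.trace_le τ hτ.le) ht y hs hh).trans ?_
  exact mul_le_of_le_one_right' (tail_le_one hs hh)

/-- The collision term along a characteristic curve. -/
lemma integral_collisions_toReal {g : ℝ × Y × ℝ → ℝ≥0∞} (hg : Measurable g) (hM : M ≠ ∞)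
    (hgM : ∀ τ, 0 ≤ τ → ∀ y, ∀ h ∈ H, g (τ, y, h) ≤ M) {t σ h : ℝ} (htσ : t ≤ σ) (hh : h ∈ H)
    (y : Y) :
    ∫ τ in Icc (0 : ℝ) t, ∫ h' in Icc (-1 : ℝ) 1, 2 * P (2 * (σ - τ)) h h' *
      (g (τ, bounce h' (flow τ y), h')).toReal = (gain g t (flow t y) (σ - t) h).toReal := by
  have hle : ∀ τ ∈ Ioo 0 t, ∀ h' ∈ H,
      kernel (σ - τ) h h' * g (τ, bounce h' (flow τ y), h') ≤ M := fun τ hτ h' hh' =>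
    (mul_le_mul' (kernel_le_one (by linarith [hτ.2]) hh hh') (hgM τ hτ.1.le _ h' hh')).trans_eq
      (one_mul M)
  have hinner : ∀ τ ∈ Ioo 0 t, ∫⁻ h' in H, kernel (σ - τ) h h' * g (τ, bounce h' (flow τ y), h')
      < ∞ := fun τ hτ => by
    refine (setLIntegral_mono' measurableSet_Ioo (hle τ hτ)).trans_lt ?_
    rw [setLIntegral_const]
    exact ENNReal.mul_lt_top hM.lt_top (by simp)
  have hm : Measurable fun q : ℝ × ℝ =>
      kernel (σ - q.1) h q.2 * g (q.1, bounce q.2 (flow q.1 y), q.2) := by fun_prop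
  have e : gain g t (flow t y) (σ - t) h = ∫⁻ τ in Ioo 0 t, ∫⁻ h' in H,
      kernel (σ - τ) h h' * g (τ, bounce h' (flow τ y), h') := by
    simp only [gain, sub_add_cancel, flow_flow, add_sub_cancel]
  rw [e, ← restrict_H, ← Measure.restrict_congr_set Ioo_ae_eq_Icc, ← integral_toReal
    (Measurable.lintegral_prod_right' hm).aemeasurable
    ((ae_restrict_iff' measurableSet_Ioo).2 (ae_of_all _ hinner))]
  refine setIntegral_congr_fun measurableSet_Ioo fun τ hτ => ?_
  simp only
  rw [← integral_toReal (by fun_prop) ((ae_restrict_iff' measurableSet_Ioo).2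
    (ae_of_all _ fun h' hh' => (hle τ hτ h' hh').trans_lt hM.lt_top))]
  refine setIntegral_congr_fun measurableSet_Ioo fun h' hh' => ?_
  rw [two_mul_P_eq_toReal (by linarith [hτ.2]) hh hh', ENNReal.toReal_mul]

theorem isSolution_solution {fin : T2 × S1 → ℝ} (hf : Measurable f) (hM : M ≠ ∞)
    (hfM : ∀ y, f y ≤ M) (hff : ∀ᵐ y, fin y = (f y).toReal) : IsSolution fin (solution f) where
  integrable t ht := by
    have hb := boundedEvolution_initial hf hfM
    have hm : Measurable fun w => evolve (initial f) (minTrace (initial f)) t w := by fun_prop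
    have hi : Integrable (fun w => (evolve (initial f) (minTrace (initial f)) t w).toReal) phase := by
      refine integrable_toReal_of_lintegral_ne_top hm.aemeasurable ?_
      rw [hb.lintegral_evolve hM ht]
      refine ((lintegral_mono fun z => ?_).trans_lt (lintegral_phase_tail_lt_top M hM)).ne
      exact mul_le_mul_left (hfM _) _
    exact measurePreserving_regroup.integrable_comp_of_integrable hi
  trace_integrable T hT := by
    have hm : Measurable fun p : ℝ × Y × ℝ =>
        evolve (initial f) (minTrace (initial f)) p.1 (p.2.1, 0, p.2.2) := by fun_prop
    have hi : Integrable (fun p : ℝ × Y × ℝ =>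
        (evolve (initial f) (minTrace (initial f)) p.1 (p.2.1, 0, p.2.2)).toReal) (traceVol T) := by
      refine Integrable.of_bound hm.ennreal_toReal.aestronglyMeasurable M.toReal ?_
      have h1 : ∀ᵐ p : ℝ × Y × ℝ ∂(traceVol T), p.1 ∈ Ioo 0 T :=
        Measure.quasiMeasurePreserving_fst.ae (ae_restrict_mem measurableSet_Ioo)
      have h2 : ∀ᵐ p : ℝ × Y × ℝ ∂(traceVol T), p.2.2 ∈ H :=
        (Measure.quasiMeasurePreserving_snd.comp Measure.quasiMeasurePreserving_snd).ae
          (ae_restrict_mem measurableSet_Ioo)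
      filter_upwards [h1, h2] with p h1 h2
      rw [Real.norm_of_nonneg ENNReal.toReal_nonneg]
      exact ENNReal.toReal_mono hM (evolve_initial_le hf hfM h1.1.le _ le_rfl h2)
    exact (measurePreserving_traceVol_symm T).integrable_comp_of_integrable hi
  characteristics := by
    have hb := boundedEvolution_initial hf hfM
    have hff' : ∀ᵐ w ∂phase, fin w.1 = (f w.1).toReal :=
      Measure.quasiMeasurePreserving_fst.ae hff
    have key : ∀ᵐ w ∂phase, ∀ t ∈ Icc 0 w.2.1,
        (evolve (initial f) (minTrace (initial f)) t (flow t w.1, w.2.1 - t, w.2.2)).toReal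
          = fin w.1 * E w.2.1 w.2.2 + ∫ τ in Icc (0 : ℝ) t, ∫ h' in Icc (-1 : ℝ) 1,
            2 * P (2 * (w.2.1 - τ)) w.2.2 h' * (evolve (initial f) (minTrace (initial f)) τ
              (bounce h' (flow τ w.1), 0, h')).toReal := by
      filter_upwards [ae_phase, hff'] with ⟨y, s, h⟩ ⟨hs, hh⟩ hy t ht
      simp only [← minTrace_eq (measurable_initial hf)]
      rw [integral_collisions_toReal (by fun_prop) hM hb.trace_le ht.2 hh, hy,
        E_eq_toReal_tail hs.le hh, ← ENNReal.toReal_mul, ← ENNReal.toReal_add]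
      · simp only [evolve, initial, flow_flow, add_neg_cancel, flow_zero, sub_add_cancel]
      · exact ENNReal.mul_ne_top (ne_top_of_le_ne_top hM (hfM y))
          (ne_top_of_le_ne_top ENNReal.one_ne_top (tail_le_one hs.le hh))
      · refine ne_top_of_le_ne_top hM (le_trans ?_ (evolve_initial_le hf hfM ht.1 (flow t y)
          (s := s - t) (by linarith [ht.2]) hh))
        exact le_add_self
    exact measurePreserving_regroup.quasiMeasurePreserving.ae key

end

/-! ### Weak-* convergence -/

section
variable {α : Type*} [MeasurableSpace α] {μ : Measure α}

/-- A bounded family that converges to `0` in `L¹` converges to `0` weak-* in `L^∞`. -/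
lemma tendsto_lintegral_mul_of_bounded {e : ℝ → α → ℝ≥0∞} {B : ℝ≥0∞} (hB : B ≠ ∞)
    (hem : ∀ t, 0 ≤ t → AEMeasurable (e t) μ) (heB : ∀ t, 0 ≤ t → ∀ᵐ z ∂μ, e t z ≤ B)
    (he : Tendsto (fun t => ∫⁻ z, e t z ∂μ) atTop (𝓝 0)) {φ : α → ℝ≥0∞} (hφ : AEMeasurable φ μ)
    (hφi : ∫⁻ z, φ z ∂μ ≠ ∞) : Tendsto (fun t => ∫⁻ z, e t z * φ z ∂μ) atTop (𝓝 0) := by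
  have htail : Tendsto (fun n : ℕ => B * ∫⁻ z, (φ z - n) ∂μ) atTop (𝓝 0) := by
    have h : Tendsto (fun n : ℕ => ∫⁻ z, (φ z - n) ∂μ) atTop (𝓝 (∫⁻ _, 0 ∂μ)) := by
      refine tendsto_lintegral_of_dominated_convergence' φ (fun n => hφ.sub_const _)
        (fun n => ae_of_all _ fun z => tsub_le_self) hφi ?_
      filter_upwards [ae_lt_top' hφ hφi] with z hz
      obtain ⟨n, hn⟩ := ENNReal.exists_nat_gt hz.ne
      refine tendsto_const_nhds.congr' ?_
      filter_upwards [eventually_ge_atTop n] with m hm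
      exact (tsub_eq_zero_of_le (hn.le.trans (by exact_mod_cast hm))).symm
    rw [lintegral_zero] at h
    simpa using ENNReal.Tendsto.const_mul h (Or.inr hB)
  refine tendsto_order.2 ⟨fun a ha => absurd ha not_lt_zero, fun a ha => ?_⟩
  have ha2 : 0 < a / 2 := ENNReal.half_pos ha.ne'
  obtain ⟨n, hn⟩ := ((tendsto_order.1 htail).2 _ ha2).exists
  have hne : Tendsto (fun t => n * ∫⁻ z, e t z ∂μ) atTop (𝓝 0) := by
    simpa using ENNReal.Tendsto.const_mul he (Or.inr (ENNReal.natCast_ne_top n))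
  filter_upwards [(tendsto_order.1 hne).2 _ ha2, eventually_ge_atTop 0] with t ht ht0
  calc ∫⁻ z, e t z * φ z ∂μ ≤ ∫⁻ z, (n * e t z + B * (φ z - n)) ∂μ := by
        refine lintegral_mono_ae ?_
        filter_upwards [heB t ht0] with z hz
        calc e t z * φ z ≤ e t z * (n + (φ z - n)) := by gcongr; exact le_add_tsub
          _ = n * e t z + e t z * (φ z - n) := by ring
          _ ≤ n * e t z + B * (φ z - n) := by gcongr
    _ = n * ∫⁻ z, e t z ∂μ + B * ∫⁻ z, (φ z - n) ∂μ := by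
        rw [lintegral_add_left' ((hem t ht0).const_mul _), lintegral_const_mul' _ _ (by simp),
          lintegral_const_mul' _ _ hB]
    _ < a := by
        rw [← ENNReal.add_halves a]
        exact ENNReal.add_lt_add ht hn

lemma tendstoWeakStar_of_tendsto_lintegral {u : ℝ → α → ℝ} {v : α → ℝ} {B : ℝ}
    (hu : ∀ t, 0 ≤ t → AEStronglyMeasurable (u t) μ) (hv : AEStronglyMeasurable v μ)
    (huB : ∀ t, 0 ≤ t → ∀ᵐ z ∂μ, ‖u t z‖ ≤ B) (hvB : ∀ᵐ z ∂μ, ‖v z‖ ≤ B)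
    (h : Tendsto (fun t => ∫⁻ z, ‖u t z - v z‖ₑ ∂μ) atTop (𝓝 0)) : TendstoWeakStar μ u v := by
  refine ⟨fun t ht => memLp_top_of_bound (hu t ht) B (huB t ht), memLp_top_of_bound hv B hvB,
    fun φ hφ => ?_⟩
  have hlim := tendsto_lintegral_mul_of_bounded (B := ENNReal.ofReal (B + B)) ENNReal.ofReal_ne_top
    (fun t ht => ((hu t ht).sub hv).enorm) (fun t ht => by
      filter_upwards [huB t ht, hvB] with z h1 h2
      rw [← ofReal_norm]
      exact ENNReal.ofReal_le_ofReal ((norm_sub_le _ _).trans (add_le_add h1 h2))) h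
    hφ.aestronglyMeasurable.enorm hφ.hasFiniteIntegral.ne
  refine tendsto_iff_edist_tendsto_0.2 ?_
  refine tendsto_of_tendsto_of_tendsto_of_le_of_le' tendsto_const_nhds hlim
    (.of_forall fun t => zero_le) ?_
  filter_upwards [eventually_ge_atTop 0] with t ht
  rw [edist_eq_enorm_sub, ← integral_sub (hφ.bdd_mul (hu t ht) (huB t ht)) (hφ.bdd_mul hv hvB)]
  refine (enorm_integral_le_lintegral_enorm _).trans (le_of_eq ?_)
  refine lintegral_congr fun z => ?_
  rw [← sub_mul, enorm_mul]
  rfl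

end

lemma enorm_toReal_sub_le {a b : ℝ≥0∞} (ha : a ≠ ∞) (hb : b ≠ ∞) :
    ‖a.toReal - b.toReal‖ₑ ≤ (a - min a b) + (b - min a b) := by
  rcases le_total a b with h | h
  · rw [min_eq_left h, tsub_self, zero_add, ← enorm_neg, neg_sub, Real.enorm_of_nonneg
      (sub_nonneg.2 (ENNReal.toReal_mono hb h)), ENNReal.ofReal_sub _ ENNReal.toReal_nonneg,
      ENNReal.ofReal_toReal ha, ENNReal.ofReal_toReal hb]
  · rw [min_eq_right h, tsub_self, add_zero, Real.enorm_of_nonneg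
      (sub_nonneg.2 (ENNReal.toReal_mono ha h)), ENNReal.ofReal_sub _ ENNReal.toReal_nonneg,
      ENNReal.ofReal_toReal ha, ENNReal.ofReal_toReal hb]

lemma BoundedEvolution.tendsto_lintegral_enorm_sub {u : Y × ℝ × ℝ → ℝ≥0∞} {g : ℝ × Y × ℝ → ℝ≥0∞}
    {M N : ℝ≥0∞} (hb : BoundedEvolution M N u g) (hM : M ≠ ∞) {C : ℝ≥0∞} (hC : C ≤ M)
    (hN : ∫⁻ z, C * tail z.2.1 z.2.2 ∂phase = N) :
    Tendsto (fun t => ∫⁻ w, ‖(evolve u g t w).toReal - (C * tail w.2.1 w.2.2).toReal‖ₑ ∂phase)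
      atTop (𝓝 0) := by
  have hu := hb.measurable
  have hg := hb.measurable_trace
  have hCtop := ne_top_of_le_ne_top hM hC
  have hNtop : N ≠ ∞ := by
    rw [← hN]
    exact (lintegral_phase_tail_lt_top C hCtop).ne
  have hlim : Tendsto (fun t => (N - overlap C (evolve u g t)) + (N - overlap C (evolve u g t)))
      atTop (𝓝 0) := by
    have h := ENNReal.Tendsto.sub (tendsto_const_nhds (x := N)) (hb.tendsto_overlap hM hC hN)
      (Or.inl hNtop)
    rw [tsub_self] at h
    simpa using h.add h
  refine tendsto_of_tendsto_of_tendsto_of_le_of_le' tendsto_const_nhds hlim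
    (.of_forall fun t => zero_le) ?_
  filter_upwards [eventually_ge_atTop 0] with t ht
  have hmin : Measurable fun w : Y × ℝ × ℝ => min (evolve u g t w) (C * tail w.2.1 w.2.2) := by
    fun_prop
  have hov : overlap C (evolve u g t) ≠ ∞ :=
    ne_top_of_le_ne_top hNtop ((lintegral_mono fun z => min_le_right _ _).trans_eq hN)
  calc _ ≤ ∫⁻ w, ((evolve u g t w - min (evolve u g t w) (C * tail w.2.1 w.2.2)) +
        (C * tail w.2.1 w.2.2 - min (evolve u g t w) (C * tail w.2.1 w.2.2))) ∂phase := by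
        refine lintegral_mono_ae ?_
        filter_upwards [ae_phase] with ⟨y, s, h⟩ ⟨hs, hh⟩
        have htail := ne_top_of_le_ne_top ENNReal.one_ne_top (tail_le_one hs.le hh)
        refine enorm_toReal_sub_le ?_ (ENNReal.mul_ne_top hCtop htail)
        exact ne_top_of_le_ne_top (ENNReal.mul_ne_top hM htail) (evolve_le_tail hb.le_tail
          (fun τ hτ => hb.trace_le τ hτ.le) ht y hs.le hh)
    _ = _ := by
        rw [lintegral_add_left (by fun_prop), lintegral_sub hmin hov
          (ae_of_all _ fun w => min_le_left _ _), lintegral_sub hmin hov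
          (ae_of_all _ fun w => min_le_right _ _), hb.lintegral_evolve hM ht, hN]
        rfl

section
variable {f : Y → ℝ≥0∞} {M : ℝ≥0∞}

/-- The constant for which the equilibrium has the mass of the initial density. -/
def meanValue (f : Y → ℝ≥0∞) : ℝ≥0∞ := (∫⁻ y, f y) / ENNReal.ofReal (2 * Real.pi)

lemma meanValue_le (hfM : ∀ y, f y ≤ M) : meanValue f ≤ M := by
  refine ENNReal.div_le_of_le_mul ?_
  rw [← volume_univ_Y, ← lintegral_const]
  exact lintegral_mono hfM

lemma lintegral_meanValue_mul_tail (hf : Measurable f) :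
    ∫⁻ z, meanValue f * tail z.2.1 z.2.2 ∂phase = ∫⁻ z, initial f z ∂phase := by
  rw [lintegral_phase (by fun_prop), lintegral_phase (by fun_prop)]
  refine lintegral_congr fun s => lintegral_congr fun h => ?_
  simp only [initial]
  rw [lintegral_const, lintegral_mul_const _ hf, volume_univ_Y, mul_right_comm, meanValue,
    ENNReal.div_mul_cancel (by simp [Real.pi_pos]) ENNReal.ofReal_ne_top]

lemma toReal_meanValue {fin : T2 × S1 → ℝ} (hf : Measurable f) (hM : M ≠ ∞) (hfM : ∀ y, f y ≤ M)
    (hff : ∀ᵐ y, fin y = (f y).toReal) :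
    (meanValue f).toReal = 1 / (2 * Real.pi) * ∫ y, fin y := by
  rw [integral_congr_ae hff, integral_toReal hf.aemeasurable
    (ae_of_all _ fun y => (hfM y).trans_lt hM.lt_top), meanValue, ENNReal.toReal_div,
    ENNReal.toReal_ofReal Real.two_pi_pos.le]
  ring

theorem tendstoWeakStar_of_isSolution {fin : T2 × S1 → ℝ} {F : ℝ → Phase → ℝ}
    (hF : IsSolution fin F) (hf : Measurable f) (hM : M ≠ ∞) (hfM : ∀ y, f y ≤ M)
    (hff : ∀ᵐ y, fin y = (f y).toReal) :
    TendstoWeakStar phaseMeasure F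
      (fun z => (1 / (2 * Real.pi) * ∫ y, fin y) * E z.2.2.1 z.2.2.2) := by
  have hb := boundedEvolution_initial hf hfM
  have hC := meanValue_le hfM
  have hCtop := ne_top_of_le_ne_top hM hC
  have hFS : ∀ t, 0 ≤ t → F t =ᵐ[phaseMeasure] solution f t := fun t ht =>
    hF.ae_eq (isSolution_solution hf hM hfM hff) ht
  set v : Phase → ℝ := fun z => (1 / (2 * Real.pi) * ∫ y, fin y) * E z.2.2.1 z.2.2.2 with hv
  have hmem : ∀ᵐ z ∂phaseMeasure, 0 < z.2.2.1 ∧ z.2.2.2 ∈ H :=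
    measurePreserving_regroup.quasiMeasurePreserving.ae ae_phase
  set e : Y × ℝ × ℝ → ℝ := fun w => (meanValue f * tail w.2.1 w.2.2).toReal with he
  have hve : v =ᵐ[phaseMeasure] fun z => e (regroup z) := by
    filter_upwards [hmem] with z hz
    simp only [hv, he, regroup]
    rw [E_eq_toReal_tail hz.1.le hz.2, ENNReal.toReal_mul, toReal_meanValue hf hM hfM hff]
  have hem : Measurable e := by fun_prop
  have hreg : Measurable regroup := measurePreserving_regroup.measurable
  have hsol : ∀ t, Measurable (solution f t) := fun t => by
    unfold solution
    fun_prop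
  refine tendstoWeakStar_of_tendsto_lintegral (B := M.toReal)
    (fun t ht => (hsol t).aestronglyMeasurable.congr (hFS t ht).symm)
    ((hem.comp hreg).aestronglyMeasurable.congr hve.symm) (fun t ht => ?_) ?_ ?_
  · filter_upwards [hFS t ht, hmem] with z h1 h2
    rw [h1, solution, Real.norm_of_nonneg ENNReal.toReal_nonneg]
    exact ENNReal.toReal_mono hM (evolve_initial_le hf hfM ht _ h2.1.le h2.2)
  · filter_upwards [hve, hmem] with z h1 h2
    rw [h1, Real.norm_of_nonneg ENNReal.toReal_nonneg]
    exact ENNReal.toReal_mono hM ((mul_le_of_le_one_right' (tail_le_one h2.1.le h2.2)).trans hC)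
  · refine (hb.tendsto_lintegral_enorm_sub hM hC (lintegral_meanValue_mul_tail hf)).congr' ?_
    filter_upwards [eventually_ge_atTop 0] with t ht
    rw [← measurePreserving_regroup.lintegral_comp (by fun_prop)]
    refine lintegral_congr_ae ?_
    filter_upwards [hFS t ht, hve] with z h1 h2
    rw [h1, h2]
    rfl

end

end LorentzGas

end

/-- For nonnegative `fin ∈ L^∞(𝐓² × 𝐒¹)` the Cauchy problem has a solution, unique up to null sets
at each time, and it converges to `C E` weak-* in `L^∞` as `t → ∞`. -/
theorem theorem3p4 (fin : LorentzGas.T2 × LorentzGas.S1 → ℝ)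
    (hfin : MemLp fin ∞ (volume : Measure (LorentzGas.T2 × LorentzGas.S1)))
    (hpos : ∀ᵐ z ∂(volume : Measure (LorentzGas.T2 × LorentzGas.S1)), 0 ≤ fin z) :
    (∃ F : ℝ → LorentzGas.Phase → ℝ, LorentzGas.IsSolution fin F) ∧
    (∀ F G : ℝ → LorentzGas.Phase → ℝ,
      LorentzGas.IsSolution fin F → LorentzGas.IsSolution fin G →
        ∀ t : ℝ, 0 ≤ t → F t =ᵐ[LorentzGas.phaseMeasure] G t) ∧
    (∀ F : ℝ → LorentzGas.Phase → ℝ, LorentzGas.IsSolution fin F →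
      LorentzGas.TendstoWeakStar LorentzGas.phaseMeasure F
        (fun z => (1 / (2 * Real.pi) * ∫ y, fin y) * LorentzGas.E z.2.2.1 z.2.2.2)) := by
  obtain ⟨f, M, hM, hf, hfM, hff⟩ := LorentzGas.exists_density hfin hpos
  exact ⟨⟨_, LorentzGas.isSolution_solution hf hM hfM hff⟩,
    fun F G hF hG t ht => hF.ae_eq hG ht,
    fun F hF => LorentzGas.tendstoWeakStar_of_isSolution hF hf hM hfM hff⟩
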